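/- There are a deterministic algorithm on the real RAM and an absolute constant $K$ such that the following holds. Let $d,m,n,k,\ell\ge 1$ be integers, let $0<\varepsilon\le 1$, and let $g_1,\dots,g_m$ be polygonal curves in $\mathbb{R}^d$, each given by a sequence of at least one and at most $n$ vertices. Given these curves together with $d,m,k,\ell,\varepsilon$, the algorithm computes curves $c_1,\dots,c_k$ in $\mathbb{R}^d$, each with at most $\ell$ vertices, such that $$\max_{1\le j\le m}\min_{1\le i\le k} d_{dF}(c_i,g_j)\;\le\;(1+\varepsilon)\,\max_{1\le j\le m}\min_{1\le i\le k} d_{dF}(c'_i,g_j)$$ for all curves $c'_1,\dots,c'_k$ in $\mathbb{R}^d$ with at most $\ell$ vertices each; that is, it computes a $(1+\varepsilon)$-approximation to the $(k,\ell)$-center problem under the discrete Fréchet distance. Its running time is at most $$K\cdot\bigl((Ck\ell)^{k\ell}+\log(\ell+n)\bigr)\cdot k\ell\cdot mn,\qquad C=\Bigl(\frac{6\sqrt d}{\varepsilon}+1\Bigr)^{d}.$$ Here the discrete Fréchet distance of curves $x=(x_1,\dots,x_p)$ and $y=(y_1,\dots,y_q)$ is $d_{dF}(x,y)=\min_W\max_{(i,j)\in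 W}\|x_i-y_j\|$ with the Euclidean norm, where $W$ ranges over the sequences of index pairs from $(1,1)$ to $(p,q)$ in which consecutive pairs differ by $(0,1)$, $(1,0)$ or $(1,1)$. The real RAM takes one unit of time for each arithmetic operation ($+,-,\cdot,/,\sqrt{\ }$ on reals, $+,-$ on natural numbers, conversion of a natural number to a real), comparison, memory access (with indirect addressing) and control step; it has no rounding operation. -/

import Mathlib

/-! ### Polygonal curves and the discrete Fréchet distance -/

/-- A polygonal curve in `ℝ^d`, given by its nonempty sequence of vertices.  The number of vertices
is the complexity of the curve. -/
structure Curve (d : ℕ) where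
  complexity : ℕ
  complexity_pos : 0 < complexity
  vertex : Fin complexity → EuclideanSpace ℝ (Fin d)

/-- One step of a warping path: the index pair increases by `(0,1)`, `(1,0)` or `(1,1)`. -/
def WarpStep {p q : ℕ} (a b : Fin p × Fin q) : Prop :=
  ((b.1 : ℕ) = a.1 ∧ (b.2 : ℕ) = a.2 + 1) ∨
  ((b.1 : ℕ) = a.1 + 1 ∧ (b.2 : ℕ) = a.2) ∨
  ((b.1 : ℕ) = a.1 + 1 ∧ (b.2 : ℕ) = a.2 + 1)

/-- `W` is a warping path between two curves with `p` and `q` vertices: it starts at the pair of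
first indices, ends at the pair of last indices, and moves by warping steps (indices from `0`). -/
structure IsWarpingPath {p q : ℕ} (W : List (Fin p × Fin q)) : Prop where
  first : ∃ a ∈ W.head?, (a.1 : ℕ) = 0 ∧ (a.2 : ℕ) = 0
  last : ∃ a ∈ W.getLast?, (a.1 : ℕ) + 1 = p ∧ (a.2 : ℕ) + 1 = q
  step : W.IsChain WarpStep

/-- The maximum of the Euclidean distances of the matched pairs of vertices (all of them are
nonnegative, so starting the maximum from `0` is harmless). -/
noncomputable def warpCost {d : ℕ} (x y : Curve d)
    (W : List (Fin x.complexity × Fin y.complexity)) : ℝ :=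
  (W.map fun w => dist (x.vertex w.1) (y.vertex w.2)).foldr max 0

/-- The discrete Fréchet distance: the minimum cost of a warping path.  (There are finitely many
warping paths, and at least one.) -/
noncomputable def discreteFrechet {d : ℕ} (x y : Curve d) : ℝ :=
  sInf {r : ℝ | ∃ W, IsWarpingPath W ∧ r = warpCost x y W}

/-- The `k`-center cost of the centers `c` for the curves `g`: the maximum over the curves of the
distance to the nearest center.  It is used for `0 < m` and `0 < k` only. -/
noncomputable def centerCost {d m k : ℕ} (g : Fin m → Curve d) (c : Fin k → Curve d) : ℝ :=
  ⨆ j, ⨅ i, discreteFrechet (c i) (g j)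

/-- `c` is a feasible solution of the `(k,ℓ)`-center problem: each center has complexity at most
`ℓ`. -/
def IsFeasible {d k : ℕ} (ℓ : ℕ) (c : Fin k → Curve d) : Prop :=
  ∀ i, (c i).complexity ≤ ℓ

/-- `c` is an `α`-approximation to the `(k,ℓ)`-center problem for `g` under the discrete Fréchet
distance: it is feasible, and its cost is at most `α` times the cost of every feasible solution
(equivalently, `α` times the optimal cost). -/
def IsCenterApprox {d m k : ℕ} (ℓ : ℕ) (α : ℝ) (g : Fin m → Curve d) (c : Fin k → Curve d) : Prop :=
  IsFeasible ℓ c ∧ ∀ c' : Fin k → Curve d, IsFeasible ℓ c' → centerCost g c ≤ α * centerCost g c'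

/-! ### The real RAM

A deterministic random access machine.  It has natural number variables and real variables, and
finitely many (a program mentions only finitely many) unbounded arrays of either kind, with indirect
addressing.  On naturals there are addition and truncated subtraction, on reals the four field
operations and the square root; there is no rounding from reals to naturals.  Every arithmetic
operation, memory access, comparison and control step costs one unit of time. -/

namespace RealRAM

/-- A configuration of the memory. -/
structure State where
  nvar : ℕ → ℕ
  rvar : ℕ → ℝ
  narr : ℕ → ℕ → ℕ
  rarr : ℕ → ℕ → ℝ

/-- Natural number expressions; `get a e` reads array `a` at index `e`. -/
inductive NExpr where
  | const (c : ℕ)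
  | var (x : ℕ)
  | get (a : ℕ) (e : NExpr)
  | add (e f : NExpr)
  | sub (e f : NExpr)

/-- Real expressions; `get a e` reads array `a` at index `e`, and `cast` turns a natural number into
a real number. -/
inductive RExpr where
  | cast (e : NExpr)
  | var (x : ℕ)
  | get (a : ℕ) (e : NExpr)
  | add (e f : RExpr)
  | sub (e f : RExpr)
  | mul (e f : RExpr)
  | div (e f : RExpr)
  | sqrt (e : RExpr)

/-- Tests. -/
inductive BExpr where
  | nlt (e f : NExpr)
  | neq (e f : NExpr)
  | rlt (e f : RExpr)
  | req (e f : RExpr)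
  | not (b : BExpr)
  | and (b c : BExpr)

/-- Programs. -/
inductive Cmd where
  | skip
  | nset (x : ℕ) (e : NExpr)
  | rset (x : ℕ) (e : RExpr)
  | nstore (a : ℕ) (i : NExpr) (e : NExpr)
  | rstore (a : ℕ) (i : NExpr) (e : RExpr)
  | seq (p q : Cmd)
  | ite (b : BExpr) (p q : Cmd)
  | while (b : BExpr) (p : Cmd)

/-- The value of a natural number expression. -/
def NExpr.eval (s : State) : NExpr → ℕ
  | .const c => c
  | .var x => s.nvar x
  | .get a e => s.narr a (e.eval s)
  | .add e f => e.eval s + f.eval s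
  | .sub e f => e.eval s - f.eval s

/-- The value of a real expression (with value `0` for a division by `0` and for the square root of
a negative number). -/
noncomputable def RExpr.eval (s : State) : RExpr → ℝ
  | .cast e => (e.eval s : ℝ)
  | .var x => s.rvar x
  | .get a e => s.rarr a (e.eval s)
  | .add e f => e.eval s + f.eval s
  | .sub e f => e.eval s - f.eval s
  | .mul e f => e.eval s * f.eval s
  | .div e f => e.eval s / f.eval s
  | .sqrt e => Real.sqrt (e.eval s)

/-- The truth of a test. -/
def BExpr.holds (s : State) : BExpr → Prop
  | .nlt e f => e.eval s < f.eval s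
  | .neq e f => e.eval s = f.eval s
  | .rlt e f => e.eval s < f.eval s
  | .req e f => e.eval s = f.eval s
  | .not b => ¬ b.holds s
  | .and b c => b.holds s ∧ c.holds s

/-- The time to evaluate a natural number expression: one unit per operation or access. -/
def NExpr.time : NExpr → ℕ
  | .const _ => 1
  | .var _ => 1
  | .get _ e => e.time + 1
  | .add e f => e.time + f.time + 1
  | .sub e f => e.time + f.time + 1

/-- The time to evaluate a real expression: one unit per operation or access. -/
def RExpr.time : RExpr → ℕ
  | .cast e => e.time + 1
  | .var _ => 1
  | .get _ e => e.time + 1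
  | .add e f => e.time + f.time + 1
  | .sub e f => e.time + f.time + 1
  | .mul e f => e.time + f.time + 1
  | .div e f => e.time + f.time + 1
  | .sqrt e => e.time + 1

/-- The time to evaluate a test: one unit per operation or access. -/
def BExpr.time : BExpr → ℕ
  | .nlt e f => e.time + f.time + 1
  | .neq e f => e.time + f.time + 1
  | .rlt e f => e.time + f.time + 1
  | .req e f => e.time + f.time + 1
  | .not b => b.time + 1
  | .and b c => b.time + c.time + 1

/-- `Exec p s t s'`: the program `p`, started in the memory configuration `s`, halts after `t` units
of time in the memory configuration `s'`. -/
inductive Exec : Cmd → State → ℕ → State → Prop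
  | skip (s : State) : Exec .skip s 1 s
  | nset (s : State) (x : ℕ) (e : NExpr) :
      Exec (.nset x e) s (e.time + 1)
        { s with nvar := Function.update s.nvar x (e.eval s) }
  | rset (s : State) (x : ℕ) (e : RExpr) :
      Exec (.rset x e) s (e.time + 1)
        { s with rvar := Function.update s.rvar x (e.eval s) }
  | nstore (s : State) (a : ℕ) (i e : NExpr) :
      Exec (.nstore a i e) s (i.time + e.time + 1)
        { s with narr := Function.update s.narr a
                          (Function.update (s.narr a) (i.eval s) (e.eval s)) }
  | rstore (s : State) (a : ℕ) (i : NExpr) (e : RExpr) :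
      Exec (.rstore a i e) s (i.time + e.time + 1)
        { s with rarr := Function.update s.rarr a
                          (Function.update (s.rarr a) (i.eval s) (e.eval s)) }
  | seq {p q : Cmd} {s s' s'' : State} {t t' : ℕ}
      (hp : Exec p s t s') (hq : Exec q s' t' s'') : Exec (.seq p q) s (t + t') s''
  | iteTrue {b : BExpr} {p q : Cmd} {s s' : State} {t : ℕ}
      (hb : b.holds s) (hp : Exec p s t s') : Exec (.ite b p q) s (b.time + 1 + t) s'
  | iteFalse {b : BExpr} {p q : Cmd} {s s' : State} {t : ℕ}
      (hb : ¬ b.holds s) (hq : Exec q s t s') : Exec (.ite b p q) s (b.time + 1 + t) s'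
  | whileTrue {b : BExpr} {p : Cmd} {s s' s'' : State} {t t' : ℕ}
      (hb : b.holds s) (hp : Exec p s t s') (hw : Exec (.while b p) s' t' s'') :
      Exec (.while b p) s (b.time + 1 + t + t') s''
  | whileFalse {b : BExpr} {p : Cmd} {s : State}
      (hb : ¬ b.holds s) : Exec (.while b p) s (b.time + 1) s

/-- The coordinates of a finite sequence of curves, written one after the other: curve by curve,
vertex by vertex, coordinate by coordinate. -/
def coords {d m : ℕ} (g : Fin m → Curve d) : List ℝ :=
  (List.ofFn g).flatMap fun c =>
    (List.ofFn c.vertex).flatMap fun v => List.ofFn fun i => v i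

/-- The initial memory configuration.  The variables hold `d`, `m`, `k`, `ℓ` and `ε`, array `0` of
naturals holds the complexities of the curves and array `0` of reals holds their coordinates.  The
rest of the memory is `0`. -/
noncomputable def input {d m : ℕ} (k ℓ : ℕ) (ε : ℝ) (g : Fin m → Curve d) : State where
  nvar := fun x => [d, m, k, ℓ].getD x 0
  rvar := fun x => [ε].getD x 0
  narr := fun a i => if a = 0 then (List.ofFn fun j => (g j).complexity).getD i 0 else 0
  rarr := fun a i => if a = 0 then (coords g).getD i 0 else 0

/-- The memory configuration `s` holds the output `c`: array `1` of naturals starts with the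
complexities of the curves and array `1` of reals starts with their coordinates. -/
def Outputs {d k : ℕ} (s : State) (c : Fin k → Curve d) : Prop :=
  (∀ i : Fin k, s.narr 1 i = (c i).complexity) ∧
  ∀ i : Fin (coords c).length, s.rarr 1 i = (coords c).get i

end RealRAM

/-! The program searches exhaustively through a finite set of candidates that contains a
near-optimal solution. Let o be the cost of an arbitrary feasible solution. A farthest-first
traversal selects kℓ + 1 input vertices whose pairwise distances are at least the distance of any
input vertex to the first kℓ of them. Each selected vertex lies within o of one of the at most kℓ
vertices of the centers, so two of them share such a vertex, and the first kℓ cover all input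
vertices with radius 2o (`Traversal.exists_dist_le`). A vertex of a center that serves some curve is
within o of an input vertex, hence within 3o of the traversal (`Traversal.exists_rawDist_le`).
Centers that serve no curve may be replaced by anything (`cost_cand_le`).

Moving the vertices of the serving centers into the traversal changes Fréchet distances by at most
3o. So the best cost r of a solution with vertices in the traversal is at most 4o. If r ≤ o, this
solution is already good enough. Otherwise one of the sizes b = r, 3r/5, 9r/25 satisfies 3b/5 ≤ o ≤
b. The cube of side 6b around each traversal point is divided into N^d cells with N = ⌈5√d/ε⌉.
Rounding a vertex to the midpoint of its cell moves it by at most √d · 3b/N ≤ εo (`exists_grid`,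
`Data.Valid.exists_cand`). `Searched.le_centerCost` combines these estimates.

A candidate is a number in mixed radix: kℓ digits in base kℓ choose cubes, and kℓd digits in base N
choose grid points. There are (kℓ · N^d)^(kℓ) candidates, and four passes over them. Each is
evaluated by the usual dynamic program (`discreteFrechet_eq`) in time O(d · kℓ · mn). The extra
factor d is absorbed by the constant 6 in C: N ≤ (6/7)(6√d/ε + 1) gains (6/7)^d, and d(6/7)^d ≤ 6
(`mul_pow_gridSize_le`).

Correctness and time of the program are proved together with Hoare-style rules for `Runs`. The
specifications speak of functions on plain natural numbers (`Data`); `centerCost_curveOf` and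
`outputs_curveOf` translate them to curves. -/

namespace RealRAM

/-! ### Reasoning about programs -/

/-- The natural number variables that a program may write. -/
def Cmd.writesNVar : Cmd → ℕ → Bool
  | .nset x _, y => x == y
  | .seq p q, y => p.writesNVar y || q.writesNVar y
  | .ite _ p q, y => p.writesNVar y || q.writesNVar y
  | .while _ p, y => p.writesNVar y
  | _, _ => false

/-- The real variables that a program may write. -/
def Cmd.writesRVar : Cmd → ℕ → Bool
  | .rset x _, y => x == y
  | .seq p q, y => p.writesRVar y || q.writesRVar y
  | .ite _ p q, y => p.writesRVar y || q.writesRVar y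
  | .while _ p, y => p.writesRVar y
  | _, _ => false

/-- The arrays of natural numbers that a program may write. -/
def Cmd.writesNArr : Cmd → ℕ → Bool
  | .nstore x _ _, y => x == y
  | .seq p q, y => p.writesNArr y || q.writesNArr y
  | .ite _ p q, y => p.writesNArr y || q.writesNArr y
  | .while _ p, y => p.writesNArr y
  | _, _ => false

/-- The arrays of reals that a program may write. -/
def Cmd.writesRArr : Cmd → ℕ → Bool
  | .rstore x _ _, y => x == y
  | .seq p q, y => p.writesRArr y || q.writesRArr y
  | .ite _ p q, y => p.writesRArr y || q.writesRArr y
  | .while _ p, y => p.writesRArr y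
  | _, _ => false

/-- The states `s` and `s'` agree on everything that the program `c` does not write. -/
structure Frame (c : Cmd) (s s' : State) : Prop where
  nvar : ∀ x, c.writesNVar x = false → s'.nvar x = s.nvar x
  rvar : ∀ x, c.writesRVar x = false → s'.rvar x = s.rvar x
  narr : ∀ x, c.writesNArr x = false → s'.narr x = s.narr x
  rarr : ∀ x, c.writesRArr x = false → s'.rarr x = s.rarr x

theorem Frame.refl (c : Cmd) (s : State) : Frame c s s :=
  ⟨fun _ _ => rfl, fun _ _ => rfl, fun _ _ => rfl, fun _ _ => rfl⟩

theorem Frame.trans {c : Cmd} {s s' s'' : State} (h : Frame c s s') (h' : Frame c s' s'') :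
    Frame c s s'' :=
  ⟨fun x hx => (h'.nvar x hx).trans (h.nvar x hx), fun x hx => (h'.rvar x hx).trans (h.rvar x hx),
    fun x hx => (h'.narr x hx).trans (h.narr x hx), fun x hx => (h'.rarr x hx).trans (h.rarr x hx)⟩

theorem Frame.mono {c c' : Cmd} {s s' : State} (h : Frame c s s')
    (h₁ : ∀ x, c'.writesNVar x = false → c.writesNVar x = false)
    (h₂ : ∀ x, c'.writesRVar x = false → c.writesRVar x = false)
    (h₃ : ∀ x, c'.writesNArr x = false → c.writesNArr x = false)
    (h₄ : ∀ x, c'.writesRArr x = false → c.writesRArr x = false) : Frame c' s s' :=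
  ⟨fun x hx => h.nvar x (h₁ x hx), fun x hx => h.rvar x (h₂ x hx),
    fun x hx => h.narr x (h₃ x hx), fun x hx => h.rarr x (h₄ x hx)⟩

theorem Frame.seq_left {p q : Cmd} {s s' : State} (h : Frame p s s') : Frame (.seq p q) s s' :=
  h.mono (by simp +contextual [Cmd.writesNVar]) (by simp +contextual [Cmd.writesRVar])
    (by simp +contextual [Cmd.writesNArr]) (by simp +contextual [Cmd.writesRArr])

theorem Frame.seq_right {p q : Cmd} {s s' : State} (h : Frame q s s') : Frame (.seq p q) s s' :=
  h.mono (by simp +contextual [Cmd.writesNVar]) (by simp +contextual [Cmd.writesRVar])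
    (by simp +contextual [Cmd.writesNArr]) (by simp +contextual [Cmd.writesRArr])

theorem Frame.ite_left {b : BExpr} {p q : Cmd} {s s' : State} (h : Frame p s s') :
    Frame (.ite b p q) s s' :=
  h.mono (by simp +contextual [Cmd.writesNVar]) (by simp +contextual [Cmd.writesRVar])
    (by simp +contextual [Cmd.writesNArr]) (by simp +contextual [Cmd.writesRArr])

theorem Frame.ite_right {b : BExpr} {p q : Cmd} {s s' : State} (h : Frame q s s') :
    Frame (.ite b p q) s s' :=
  h.mono (by simp +contextual [Cmd.writesNVar]) (by simp +contextual [Cmd.writesRVar])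
    (by simp +contextual [Cmd.writesNArr]) (by simp +contextual [Cmd.writesRArr])

theorem Frame.while_body {b : BExpr} {p : Cmd} {s s' : State} (h : Frame p s s') :
    Frame (.while b p) s s' :=
  h.mono (fun _ => id) (fun _ => id) (fun _ => id) (fun _ => id)

/-- The sets of written locations are computed from the syntax, so for a concrete program each fact
"this location is unchanged" is obtained with `rfl`. -/
theorem Exec.frame {c : Cmd} {s s' : State} {t : ℕ} (h : Exec c s t s') : Frame c s s' := by
  induction h with
  | skip | whileFalse => exact Frame.refl _ _
  | nset s x e | rset s x e | nstore s x i e | rstore s x i e =>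
    constructor <;> intro y hy <;> first
      | rfl
      | exact Function.update_of_ne (by rintro rfl; exact absurd hy (by
          simp [Cmd.writesNVar, Cmd.writesRVar, Cmd.writesNArr, Cmd.writesRArr])) _ _
  | seq _ _ ihp ihq => exact ihp.seq_left.trans ihq.seq_right
  | iteTrue _ _ ih => exact ih.ite_left
  | iteFalse _ _ ih => exact ih.ite_right
  | whileTrue _ _ _ ihp ihw => exact ihp.while_body.trans ihw

/-- The program `c`, started in `s`, halts within time `T` in a state that satisfies `Q`. -/
def Runs (c : Cmd) (s : State) (T : ℕ) (Q : State → Prop) : Prop :=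
  ∃ t s', Exec c s t s' ∧ t ≤ T ∧ Q s'

theorem Runs.mono {c : Cmd} {s : State} {T T' : ℕ} {Q Q' : State → Prop} (h : Runs c s T Q)
    (hT : T ≤ T') (hQ : ∀ s', Frame c s s' → Q s' → Q' s') : Runs c s T' Q' := by
  obtain ⟨t, s', he, ht, hq⟩ := h
  exact ⟨t, s', he, ht.trans hT, hQ s' he.frame hq⟩

theorem Runs.seq {p q : Cmd} {s : State} {T T' T'' : ℕ} {Q Q' : State → Prop} (h : Runs p s T Q)
    (h' : ∀ s', Frame p s s' → Q s' → Runs q s' T' Q') (hT : T + T' ≤ T'') :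
    Runs (.seq p q) s T'' Q' := by
  obtain ⟨t, s', he, ht, hq⟩ := h
  obtain ⟨t', s'', he', ht', hq'⟩ := h' s' he.frame hq
  exact ⟨t + t', s'', he.seq he', by omega, hq'⟩

theorem Runs.ite {b : BExpr} {p q : Cmd} {s : State} {T T' : ℕ} {Q : State → Prop}
    (hp : b.holds s → Runs p s T Q) (hq : ¬ b.holds s → Runs q s T Q) (hT : b.time + 1 + T ≤ T') :
    Runs (.ite b p q) s T' Q := by
  by_cases hb : b.holds s
  · obtain ⟨t, s', he, ht, h⟩ := hp hb
    exact ⟨_, s', .iteTrue hb he, by omega, h⟩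
  · obtain ⟨t, s', he, ht, h⟩ := hq hb
    exact ⟨_, s', .iteFalse hb he, by omega, h⟩

/-- Programs without loops. -/
def Cmd.loopFree : Cmd → Bool
  | .seq p q => p.loopFree && q.loopFree
  | .ite _ p q => p.loopFree && q.loopFree
  | .while _ _ => false
  | _ => true

/-- An upper bound for the running time of a program without loops. -/
def Cmd.maxTime : Cmd → ℕ
  | .skip => 1
  | .nset _ e => e.time + 1
  | .rset _ e => e.time + 1
  | .nstore _ i e => i.time + e.time + 1
  | .rstore _ i e => i.time + e.time + 1
  | .seq p q => p.maxTime + q.maxTime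
  | .ite b p q => b.time + 1 + max p.maxTime q.maxTime
  -- A dummy value: `Runs.of_run` assumes `loopFree`.
  | .while _ _ => 0

open Classical in
/-- The final state of a program without loops. -/
noncomputable def Cmd.run : Cmd → State → State
  | .skip, s => s
  | .nset x e, s => { s with nvar := Function.update s.nvar x (e.eval s) }
  | .rset x e, s => { s with rvar := Function.update s.rvar x (e.eval s) }
  | .nstore a i e, s =>
    { s with narr := Function.update s.narr a
                      (Function.update (s.narr a) (i.eval s) (e.eval s)) }
  | .rstore a i e, s =>
    { s with rarr := Function.update s.rarr a
                      (Function.update (s.rarr a) (i.eval s) (e.eval s)) }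
  | .seq p q, s => q.run (p.run s)
  | .ite b p q, s => if b.holds s then p.run s else q.run s
  | .while _ _, s => s

/-- Reduces code without loops to symbolic evaluation of `Cmd.run`; the numerical bound on `maxTime`
is then usually closed by `decide`. -/
theorem Runs.of_run {c : Cmd} {s : State} {Q : State → Prop} (hc : c.loopFree = true)
    (h : Q (c.run s)) : Runs c s c.maxTime Q := by
  induction c generalizing s Q with
  | skip => exact ⟨_, _, .skip s, le_rfl, h⟩
  | nset x e => exact ⟨_, _, .nset s x e, le_rfl, h⟩
  | rset x e => exact ⟨_, _, .rset s x e, le_rfl, h⟩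
  | nstore a i e => exact ⟨_, _, .nstore s a i e, le_rfl, h⟩
  | rstore a i e => exact ⟨_, _, .rstore s a i e, le_rfl, h⟩
  | seq p q ihp ihq =>
    simp only [Cmd.loopFree, Bool.and_eq_true] at hc
    exact (ihp (Q := fun s' => s' = p.run s) hc.1 rfl).seq
      (fun s' _ hs' => ihq hc.2 (by subst hs'; exact h)) le_rfl
  | ite b p q ihp ihq =>
    simp only [Cmd.loopFree, Bool.and_eq_true] at hc
    refine Runs.ite (T := max p.maxTime q.maxTime) (fun hb => ?_) (fun hb => ?_) le_rfl
    · exact (ihp hc.1 (by simpa [Cmd.run, hb] using h)).mono (le_max_left _ _) fun _ _ => id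
    · exact (ihq hc.2 (by simpa [Cmd.run, hb] using h)).mono (le_max_right _ _) fun _ _ => id
  | _ => simp [Cmd.loopFree] at hc

/-- The measure decreases in each iteration, so there are at most `μ s` iterations, plus one final
test. The frame of the whole loop is available at every iteration, so invariants need not mention
memory that the body leaves alone. -/
theorem Runs.while {b : BExpr} {p : Cmd} {s : State} {T Tb : ℕ} {Q : State → Prop}
    (I : State → Prop) (μ : State → ℕ) (h0 : I s)
    (hstep : ∀ s', Frame (.while b p) s s' → I s' → b.holds s' →
      Runs p s' Tb fun s'' => I s'' ∧ μ s'' < μ s')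
    (hQ : ∀ s', Frame (.while b p) s s' → I s' → ¬ b.holds s' → Q s')
    (hT : μ s * (Tb + b.time + 1) + b.time + 1 ≤ T) : Runs (.while b p) s T Q := by
  suffices H : ∀ n, ∀ s', μ s' = n → Frame (.while b p) s s' → I s' →
      Runs (.while b p) s' (n * (Tb + b.time + 1) + b.time + 1) Q from
    (H _ s rfl (Frame.refl _ _) h0).mono hT fun _ _ => id
  intro n
  -- Strong induction, because the measure may drop by more than one.
  induction n using Nat.strong_induction_on with
  | _ n ih =>
    intro s' hn hf hi
    by_cases hb : b.holds s'
    · obtain ⟨t, s'', he, ht, hi', hμ⟩ := hstep s' hf hi hb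
      obtain ⟨t', s₃, he', ht', hq⟩ :=
        ih (μ s'') (hn ▸ hμ) s'' rfl (hf.trans he.frame.while_body) hi'
      refine ⟨_, s₃, .whileTrue hb he he', ?_, hq⟩
      have : (μ s'' + 1) * (Tb + b.time + 1) ≤ n * (Tb + b.time + 1) :=
        Nat.mul_le_mul_right _ (by omega)
      rw [add_mul] at this
      omega
    · exact ⟨_, s', .whileFalse hb, by omega, hQ s' hf hi hb⟩

/-- The state `s` with the natural number variable `x` set to `v`. -/
def State.setN (s : State) (x v : ℕ) : State := { s with nvar := Function.update s.nvar x v }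

@[simp] theorem State.setN_rvar (s : State) (x v : ℕ) : (s.setN x v).rvar = s.rvar := rfl
@[simp] theorem State.setN_narr (s : State) (x v : ℕ) : (s.setN x v).narr = s.narr := rfl
@[simp] theorem State.setN_rarr (s : State) (x v : ℕ) : (s.setN x v).rarr = s.rarr := rfl
@[simp] theorem State.setN_nvar (s : State) (x v y : ℕ) :
    (s.setN x v).nvar y = if y = x then v else s.nvar y := by
  simp [State.setN, Function.update_apply]

/-- The loop `for x < e do p`. -/
def forLoop (x : ℕ) (e : NExpr) (p : Cmd) : Cmd :=
  .seq (.nset x (.const 0))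
    (.while (.nlt (.var x) e) (.seq p (.nset x (.add (.var x) (.const 1)))))

/-- The rule for `for` loops, where every execution of the body takes time at most `Tb`. -/
theorem Runs.for {x : ℕ} {e : NExpr} {p : Cmd} {s : State} {n T Tb : ℕ} {Q : State → Prop}
    (I : ℕ → State → Prop) (hn : 1 ≤ n) (hx : p.writesNVar x = false)
    (he : ∀ s', Frame (forLoop x e p) s s' → e.eval s' = n)
    (h0 : I 0 (s.setN x 0))
    (hstep : ∀ i < n, ∀ s', Frame (forLoop x e p) s s' → s'.nvar x = i → I i s' →
      Runs p s' Tb fun s'' => I (i + 1) (s''.setN x (i + 1)))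
    (hQ : ∀ s', Frame (forLoop x e p) s s' → I n s' → Q s')
    (hT : n * (Tb + 2 * e.time + 12) ≤ T) : Runs (forLoop x e p) s T Q := by
  have hf0 : Frame (forLoop x e p) s (s.setN x 0) :=
    (Exec.nset s x (.const 0)).frame.seq_left
  refine Runs.seq (T := 2) (T' := n * (Tb + e.time + 7) + e.time + 3)
    (Q := fun s' => s' = s.setN x 0) ⟨_, _, .nset s x (.const 0), le_rfl, rfl⟩ ?_ ?_
  · rintro _ - rfl
    refine Runs.while (Tb := Tb + 4) (fun s' => s'.nvar x ≤ n ∧ I (s'.nvar x) s')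
      (fun s' => n - s'.nvar x) (by simpa using h0) ?_ ?_ ?_
    · intro s' hf ⟨hle, hi⟩ hb
      have hf' := hf0.trans hf.seq_right
      have hlt : s'.nvar x < n := by simpa [BExpr.holds, NExpr.eval, he s' hf'] using hb
      refine (hstep _ hlt s' hf' rfl hi).seq (T' := 4) ?_ le_rfl
      intro s'' hf'' hi''
      have hx' := hf''.nvar x hx
      refine ⟨4, _, .nset s'' x _, le_rfl, ?_⟩
      have heq : NExpr.eval s'' (.add (.var x) (.const 1)) = s'.nvar x + 1 := by
        simp [NExpr.eval, hx']
      rw [heq]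
      have : ({ s'' with nvar := Function.update s''.nvar x (s'.nvar x + 1) } : State)
        = s''.setN x (s'.nvar x + 1) := rfl
      rw [this]
      simp only [State.setN_nvar, if_true]
      exact ⟨⟨hlt, hi''⟩, by omega⟩
    · intro s' hf ⟨hle, hi⟩ hb
      have hf' := hf0.trans hf.seq_right
      have : s'.nvar x = n := by
        have : ¬ s'.nvar x < n := by simpa [BExpr.holds, NExpr.eval, he s' hf'] using hb
        omega
      exact hQ s' hf' (this ▸ hi)
    · simp only [State.setN_nvar, if_true, BExpr.time, NExpr.time, Nat.sub_zero]
      have : Tb + 4 + (1 + e.time + 1) + 1 = Tb + e.time + 7 := by ring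
      rw [this]
      omega
  -- Since `1 ≤ n`, the initialization and the last test can be charged to the iterations, which
  -- keeps nested time bounds purely multiplicative.
  · have : n * (Tb + 2 * e.time + 12) = n * (Tb + e.time + 7) + n * (e.time + 5) := by ring
    have : 1 * (e.time + 5) ≤ n * (e.time + 5) := Nat.mul_le_mul_right _ hn
    omega

/-! ### The values that the program computes -/

/-- The Euclidean distance of two points of `ℝ^d`, given by their coordinates. -/
noncomputable def rawDist (d : ℕ) (x y : ℕ → ℝ) : ℝ :=
  √(∑ c ∈ Finset.range d, (x c - y c) * (x c - y c))

/-- The dynamic program for the discrete Fréchet distance, where `D a b` is the distance of vertex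
`a` of the first curve and vertex `b` of the second curve. -/
noncomputable def frechetRec (D : ℕ → ℕ → ℝ) : ℕ → ℕ → ℝ
  | 0, 0 => D 0 0
  | 0, b + 1 => max (D 0 (b + 1)) (frechetRec D 0 b)
  | a + 1, 0 => max (D (a + 1) 0) (frechetRec D a 0)
  | a + 1, b + 1 => max (D (a + 1) (b + 1))
      (min (min (frechetRec D a (b + 1)) (frechetRec D (a + 1) b)) (frechetRec D a b))

open Classical in
/-- The minimum of the first `n` values of a nonnegative sequence, and `-1` if `n = 0`. -/
noncomputable def runMin (f : ℕ → ℝ) : ℕ → ℝ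
  | 0 => -1
  | n + 1 => if runMin f n < 0 ∨ f n < runMin f n then f n else runMin f n

/-- The maximum of `0` and the first `n` values of a sequence. -/
noncomputable def runMax (f : ℕ → ℝ) : ℕ → ℝ
  | 0 => 0
  | n + 1 => max (runMax f n) (f n)

/-- An instance of the `(k,ℓ)`-center problem, given by the complexities of the curves and the
coordinates of all vertices of all curves, together with the grid size that is used to solve it. -/
structure Data where
  (d m k ℓ N : ℕ)
  len : ℕ → ℕ
  pt : ℕ → ℕ → ℝ

namespace Data

/-- The index of the first vertex of curve `j`. -/
def start (D : Data) (j : ℕ) : ℕ := ∑ i ∈ Finset.range j, D.len i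

/-- The number of all vertices. -/
def V (D : Data) : ℕ := D.start D.m

/-- The total number of vertices of the centers. -/
def kl (D : Data) : ℕ := D.k * D.ℓ

/-- The number of digits that determine a candidate solution. -/
def digits (D : Data) : ℕ := D.kl + D.kl * D.d

/-- The number of values of digit `p`. -/
def base (D : Data) (p : ℕ) : ℕ := if p < D.kl then D.kl else D.N

/-- The sequence `e` of digits determines a candidate solution. -/
structure IsDigits (D : Data) (e : ℕ → ℕ) : Prop where
  lt : ∀ p < D.digits, e p < D.base p
  eq_zero : ∀ p, D.digits ≤ p → e p = 0

/-- The data are not degenerate. -/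
structure Valid (D : Data) : Prop where
  d : 1 ≤ D.d
  m : 1 ≤ D.m
  k : 1 ≤ D.k
  ℓ : 1 ≤ D.ℓ
  N : 1 ≤ D.N
  len : ∀ j < D.m, 1 ≤ D.len j

/-- The coordinates of the vertices of the candidate solution with the digits `e`: vertex `u` is a
point of the grid with `N ^ d` points in the cube of side `6 * b` around the input vertex
`q (e u)`. -/
noncomputable def cand (D : Data) (q e : ℕ → ℕ) (b : ℝ) (u c : ℕ) : ℝ :=
  D.pt (q (e u)) c + 3 * b * (((e (D.kl + u * D.d + c) + e (D.kl + u * D.d + c) + 1 : ℕ) : ℝ) / D.N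
    - 1)

/-- The distances between the vertices of center `i` and the vertices of curve `j`. -/
noncomputable def pairDist (D : Data) (Y : ℕ → ℕ → ℝ) (i j a b : ℕ) : ℝ :=
  rawDist D.d (Y (i * D.ℓ + a)) (D.pt (D.start j + b))

/-- The Fréchet distance of center `i` and curve `j`. -/
noncomputable def frechet (D : Data) (Y : ℕ → ℕ → ℝ) (i j : ℕ) : ℝ :=
  frechetRec (D.pairDist Y i j) (D.ℓ - 1) (D.len j - 1)

/-- The `k`-center cost of the centers with the coordinates `Y`. -/
noncomputable def cost (D : Data) (Y : ℕ → ℕ → ℝ) : ℝ :=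
  runMax (fun j => runMin (fun i => D.frechet Y i j) D.k) D.m

theorem start_succ (D : Data) (j : ℕ) : D.start (j + 1) = D.start j + D.len j :=
  Finset.sum_range_succ _ _

theorem start_mono (D : Data) : Monotone D.start := fun _ _ h =>
  Finset.sum_le_sum_of_subset (Finset.range_mono h)

theorem start_add_lt (D : Data) {j b : ℕ} (hj : j < D.m) (hb : b < D.len j) :
    D.start j + b < D.V :=
  (Nat.add_lt_add_left hb _).trans_le ((D.start_succ j).ge.trans (D.start_mono hj))

theorem index_lt (D : Data) {i a : ℕ} (hi : i < D.k) (ha : a < D.ℓ) : i * D.ℓ + a < D.kl := by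
  have : (i + 1) * D.ℓ ≤ D.k * D.ℓ := Nat.mul_le_mul_right _ hi
  rw [add_mul] at this
  unfold kl
  omega

theorem digit_lt (D : Data) {u c : ℕ} (hu : u < D.kl) (hc : c < D.d) :
    D.kl + u * D.d + c < D.digits := by
  have : (u + 1) * D.d ≤ D.kl * D.d := Nat.mul_le_mul_right _ hu
  rw [add_mul] at this
  unfold digits
  omega

end Data

/-! ### Computing the cost of a candidate solution -/

/-- Memory contents that are set up once: natural number variables `0`-`7` hold `d`, `m`, `k`, `ℓ`,
`kℓ`, the number of vertices, the grid size and the number of digits, array `0` of naturals the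
complexities, array `2` the multiples of `d`, and array `5` the bases of the digits. -/
structure Ctx (D : Data) (s : State) : Prop where
  d : s.nvar 0 = D.d
  m : s.nvar 1 = D.m
  k : s.nvar 2 = D.k
  ℓ : s.nvar 3 = D.ℓ
  kl : s.nvar 4 = D.kl
  V : s.nvar 5 = D.V
  N : s.nvar 6 = D.N
  digits : s.nvar 7 = D.digits
  len : ∀ j < D.m, s.narr 0 j = D.len j
  out : ∀ i < D.k, s.narr 1 i = D.ℓ
  off : ∀ v ≤ D.V + D.kl, s.narr 2 v = v * D.d
  base : ∀ p < D.digits, s.narr 5 p = D.base p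
  pt : ∀ v < D.V, ∀ c < D.d, s.rarr 0 (v * D.d + c) = D.pt v c

/-- The program does not change what `Ctx` describes. -/
def Cmd.keepsCtx (c : Cmd) : Bool :=
  (List.range 8).all (fun x => !c.writesNVar x) && !c.writesNArr 0 && !c.writesNArr 1 &&
    !c.writesNArr 2 && !c.writesNArr 5 && !c.writesRArr 0

/-- The side condition is a syntactic check, discharged by `rfl` for each concrete program. -/
theorem Ctx.frame {D : Data} {c : Cmd} {s s' : State} (h : Ctx D s) (hf : Frame c s s')
    (hc : c.keepsCtx = true) : Ctx D s' := by
  simp only [Cmd.keepsCtx, Bool.and_eq_true, List.all_eq_true, List.mem_range,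
    Bool.not_eq_eq_eq_not, Bool.not_true] at hc
  obtain ⟨⟨⟨⟨⟨h1, h2⟩, h3⟩, h4⟩, h5⟩, h6⟩ := hc
  have e := fun x hx => hf.nvar x (h1 x hx)
  constructor
  · rw [e 0 (by norm_num), h.d]
  · rw [e 1 (by norm_num), h.m]
  · rw [e 2 (by norm_num), h.k]
  · rw [e 3 (by norm_num), h.ℓ]
  · rw [e 4 (by norm_num), h.kl]
  · rw [e 5 (by norm_num), h.V]
  · rw [e 6 (by norm_num), h.N]
  · rw [e 7 (by norm_num), h.digits]
  · rw [hf.narr 0 h2]; exact h.len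
  · rw [hf.narr 1 h3]; exact h.out
  · rw [hf.narr 2 h4]; exact h.off
  · rw [hf.narr 5 h5]; exact h.base
  · rw [hf.rarr 0 h6]; exact h.pt

/-- The memory describes a candidate solution: array `3` of naturals holds the input vertices at the
centers of the cubes, array `4` the digits, and real variable `1` the size of the cubes. -/
structure CandCtx (D : Data) (q e : ℕ → ℕ) (b : ℝ) (s : State) : Prop extends Ctx D s where
  q_eq : s.narr 3 = q
  e_eq : s.narr 4 = e
  b_eq : s.rvar 1 = b
  q_lt : ∀ u < D.kl, q u < D.V
  isDigits : D.IsDigits e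

/-- The program does not change what `CandCtx` describes. -/
def Cmd.keepsCand (c : Cmd) : Bool :=
  c.keepsCtx && !c.writesNArr 3 && !c.writesNArr 4 && !c.writesRVar 1

theorem CandCtx.frame {D : Data} {q e : ℕ → ℕ} {b : ℝ} {c : Cmd} {s s' : State}
    (h : CandCtx D q e b s) (hf : Frame c s s') (hc : c.keepsCand = true) :
    CandCtx D q e b s' := by
  simp only [Cmd.keepsCand, Bool.and_eq_true, Bool.not_eq_eq_eq_not, Bool.not_true] at hc
  obtain ⟨⟨⟨h1, h2⟩, h3⟩, h4⟩ := hc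
  exact ⟨h.toCtx.frame hf h1, (hf.narr 3 h2).trans h.q_eq, (hf.narr 4 h3).trans h.e_eq,
    (hf.rvar 1 h4).trans h.b_eq, h.q_lt, h.isDigits⟩

theorem CandCtx.e_lt_kl {D : Data} {q e : ℕ → ℕ} {b : ℝ} {s : State} (h : CandCtx D q e b s) {u : ℕ}
    (hu : u < D.kl) : e u < D.kl := by
  have := h.isDigits.lt u (by unfold Data.digits; omega)
  rwa [Data.base, if_pos hu] at this

/-- Coordinate `c` of input vertex `v`, where `c` is in variable `20`. -/
def inputCoord (v : NExpr) : RExpr := .get 0 (.add (.get 2 v) (.var 20))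

/-- Coordinate `c` of vertex `u` of the candidate solution, where `c` is in variable `20`. -/
def candCoord (u : NExpr) : RExpr :=
  let g : NExpr := .get 4 (.add (.add (.var 4) (.get 2 u)) (.var 20))
  .add (inputCoord (.get 3 (.get 4 u)))
    (.mul (.mul (.cast (.const 3)) (.var 1))
      (.sub (.div (.cast (.add (.add g g) (.const 1))) (.cast (.var 6))) (.cast (.const 1))))

/-- Addresses cannot be multiplied on this machine, so the offset `v * d` is looked up in the
precomputed array `2`. -/
theorem eval_inputCoord {D : Data} {s : State} (h : Ctx D s) {v : NExpr} (hv : v.eval s < D.V)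
    (hc : s.nvar 20 < D.d) : (inputCoord v).eval s = D.pt (v.eval s) (s.nvar 20) := by
  simp only [inputCoord, RExpr.eval, NExpr.eval]
  rw [h.off _ (by omega), h.pt _ hv _ hc]

theorem eval_candCoord {D : Data} {q e : ℕ → ℕ} {b : ℝ} {s : State} (h : CandCtx D q e b s)
    {u : NExpr} (hu : u.eval s < D.kl) (hc : s.nvar 20 < D.d) :
    (candCoord u).eval s = D.cand q e b (u.eval s) (s.nvar 20) := by
  have hq : NExpr.eval s (.get 3 (.get 4 u)) = q (e (u.eval s)) := by
    simp only [NExpr.eval, h.q_eq, h.e_eq]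
  have := eval_inputCoord h.toCtx (v := .get 3 (.get 4 u))
    (hq ▸ h.q_lt _ (h.e_lt_kl hu)) hc
  simp only [candCoord, RExpr.eval, this]
  rw [hq]
  simp only [NExpr.eval, h.kl, h.N, h.b_eq, h.e_eq, h.off _ (show u.eval s ≤ D.V + D.kl by omega)]
  rw [Data.cand]
  norm_num

/-- Sets real variable `3` to the distance of two points, where `x` and `y` are the coordinates with
the index in variable `20`. -/
def distCmd (x y : RExpr) : Cmd :=
  .seq (.rset 3 (.cast (.const 0)))
    (.seq (forLoop 20 (.var 0) (.rset 3 (.add (.var 3) (.mul (.sub x y) (.sub x y)))))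
      (.rset 3 (.sqrt (.var 3))))

/-- The expressions are evaluated in states that differ from `s` only where the program writes, so
the hypotheses on them quantify over exactly those. The factor `2` in the time bound is there
because each difference is written out twice to form its square. -/
theorem distCmd_runs {x y : RExpr} {s : State} {d : ℕ} (hd : s.nvar 0 = d) (hd1 : 1 ≤ d)
    (f g : ℕ → ℝ)
    (hx : ∀ s', Frame (distCmd x y) s s' → s'.nvar 20 < d → x.eval s' = f (s'.nvar 20))
    (hy : ∀ s', Frame (distCmd x y) s s' → s'.nvar 20 < d → y.eval s' = g (s'.nvar 20)) :
    Runs (distCmd x y) s (d * (2 * (x.time + y.time) + 30))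
      fun s' => s'.rvar 3 = rawDist d f g := by
  refine Runs.seq (T := 3) (T' := d * (2 * (x.time + y.time) + 21) + 3)
    (Q := fun s' => s'.rvar 3 = 0)
    ⟨_, _, .rset s 3 _, le_rfl, by simp [RExpr.eval, NExpr.eval]⟩ ?_ (by nlinarith)
  intro s₁ hf₁ h₁
  have hF₁ : Frame (distCmd x y) s s₁ := hf₁.seq_left
  refine Runs.seq (T := d * (2 * (x.time + y.time) + 21)) (T' := 3)
    (Q := fun s' => s'.rvar 3 = ∑ c ∈ Finset.range d, (f c - g c) * (f c - g c)) ?_ ?_ le_rfl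
  · refine Runs.for (Tb := 2 * (x.time + y.time) + 7)
      (fun i s' => s'.rvar 3 = ∑ c ∈ Finset.range i, (f c - g c) * (f c - g c)) hd1 rfl ?_
      (by simpa using h₁) ?_ (fun _ _ h => h) ?_
    · intro s' hf
      simp only [NExpr.eval]
      rw [hf.nvar 0 rfl, hf₁.nvar 0 rfl, hd]
    · intro i hi s' hf hi' hI
      have hF : Frame (distCmd x y) s s' := hF₁.trans hf.seq_left.seq_right
      refine (Runs.of_run rfl ?_).mono (T := _) ?_ fun _ _ h => h
      · simp only [Cmd.run, State.setN_rvar, Function.update_self, RExpr.eval,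
          hx s' hF (hi'.symm ▸ hi), hy s' hF (hi'.symm ▸ hi), hI, hi', Finset.sum_range_succ]
      · simp only [Cmd.maxTime, RExpr.time]; omega
    · simp only [NExpr.time]
      rw [show 2 * (x.time + y.time) + 7 + 2 * 1 + 12 = 2 * (x.time + y.time) + 21 by ring]
  · intro s₂ _ h₂
    exact ⟨_, _, .rset s₂ 3 _, le_rfl, by simp [RExpr.eval, h₂, rawDist]⟩

/-- Increases real variable `x` to the value of `e`, if this is larger. -/
def maxCmd (x : ℕ) (e : RExpr) : Cmd := .ite (.rlt (.var x) e) (.rset x e) .skip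

/-- Decreases real variable `x` to the value of `e`, if this is smaller. -/
def minCmd (x : ℕ) (e : RExpr) : Cmd := .ite (.rlt e (.var x)) (.rset x e) .skip

theorem run_maxCmd (x : ℕ) (e : RExpr) (s : State) : (maxCmd x e).run s =
    { s with rvar := Function.update s.rvar x (max (s.rvar x) (e.eval s)) } := by
  by_cases h : s.rvar x < e.eval s
  · simp [maxCmd, Cmd.run, BExpr.holds, RExpr.eval, h, max_eq_right h.le]
  · simp [maxCmd, Cmd.run, BExpr.holds, RExpr.eval, h, max_eq_left (not_lt.1 h)]

theorem run_minCmd (x : ℕ) (e : RExpr) (s : State) : (minCmd x e).run s =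
    { s with rvar := Function.update s.rvar x (min (s.rvar x) (e.eval s)) } := by
  by_cases h : e.eval s < s.rvar x
  · simp [minCmd, Cmd.run, BExpr.holds, RExpr.eval, h, min_eq_right h.le]
  · simp [minCmd, Cmd.run, BExpr.holds, RExpr.eval, h, min_eq_left (not_lt.1 h)]

/-- Computes one cell of the table for the Fréchet distance and appends it to array `3`, whose
length is in variable `14`.  The cell is for vertex `13` of the center that starts at vertex `16`, and
vertex `12` of the curve that starts at vertex `15`. -/
def cellCmd : Cmd :=
  .seq (distCmd (candCoord (.add (.var 16) (.var 13))) (inputCoord (.add (.var 15) (.var 12))))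
    (.seq
      (.ite (.neq (.var 13) (.const 0))
        (.ite (.neq (.var 12) (.const 0))
          .skip
          (maxCmd 3 (.get 3 (.sub (.var 14) (.var 3)))))
        (.seq (.rset 6 (.get 3 (.sub (.var 14) (.const 1))))
          (.seq
            (.ite (.neq (.var 12) (.const 0))
              .skip
              (.seq (minCmd 6 (.get 3 (.sub (.var 14) (.var 3))))
                (minCmd 6 (.get 3 (.sub (.sub (.var 14) (.var 3)) (.const 1))))))
            (maxCmd 3 (.var 6)))))
      (.seq (.rstore 3 (.var 14) (.var 3)) (.nset 14 (.add (.var 14) (.const 1)))))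

/-- Cell `(a, b)` is stored at `b * ℓ + a`, where `a` is the center vertex. Its predecessors in `a`,
in `b` and in both are therefore `1`, `ℓ` and `ℓ + 1` places back, and no index multiplication is
needed. -/
theorem cellCmd_runs {D : Data} (hD : D.Valid) {q e : ℕ → ℕ} {w : ℝ} {s : State}
    (h : CandCtx D q e w s) {i j a b : ℕ} (hi : i < D.k) (hj : j < D.m) (ha : a < D.ℓ)
    (hb : b < D.len j) (h12 : s.nvar 12 = b) (h13 : s.nvar 13 = a)
    (h14 : s.nvar 14 = b * D.ℓ + a) (h15 : s.nvar 15 = D.start j) (h16 : s.nvar 16 = i * D.ℓ)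
    (hrow : ∀ a' < a, s.rarr 3 (b * D.ℓ + a') = frechetRec (D.pairDist (D.cand q e w) i j) a' b)
    (hprev : ∀ b' < b, ∀ a' < D.ℓ,
      s.rarr 3 (b' * D.ℓ + a') = frechetRec (D.pairDist (D.cand q e w) i j) a' b') :
    Runs cellCmd s (D.d * 300) fun s' =>
      s'.nvar 14 = b * D.ℓ + a + 1 ∧
      s'.rarr 3 = Function.update (s.rarr 3) (b * D.ℓ + a)
        (frechetRec (D.pairDist (D.cand q e w) i j) a b) := by
  have hd := hD.d
  refine Runs.seq (T := D.d * 150) (T' := 100)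
    (Q := fun s' => s'.rvar 3 = D.pairDist (D.cand q e w) i j a b) ?_ ?_ (by omega)
  · refine (distCmd_runs h.d hD.d _ _ ?_ ?_).mono ?_ fun _ _ h => h
    · intro s' hf hc
      have hu : NExpr.eval s' (.add (.var 16) (.var 13)) = i * D.ℓ + a := by
        simp only [NExpr.eval]; rw [hf.nvar 16 rfl, hf.nvar 13 rfl, h16, h13]
      rw [eval_candCoord (h.frame hf rfl) (by rw [hu]; exact D.index_lt hi ha) hc, hu]
    · intro s' hf hc
      have hu : NExpr.eval s' (.add (.var 15) (.var 12)) = D.start j + b := by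
        simp only [NExpr.eval]; rw [hf.nvar 15 rfl, hf.nvar 12 rfl, h15, h12]
      rw [eval_inputCoord (h.frame hf rfl).toCtx (by rw [hu]; exact D.start_add_lt hj hb) hc, hu]
    · refine Nat.mul_le_mul_left _ (show _ ≤ _ from ?_)
      decide
  · intro s₁ hf h₁
    refine (Runs.of_run rfl ?_).mono (by decide) fun _ _ h => h
    have e3 := (hf.nvar 3 rfl).trans h.ℓ
    have e12 := (hf.nvar 12 rfl).trans h12
    have e13 := (hf.nvar 13 rfl).trans h13
    have e14 := (hf.nvar 14 rfl).trans h14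
    have eF := hf.rarr 3 rfl
    generalize s.rarr 3 = F at hrow hprev eF ⊢
    generalize D.pairDist (D.cand q e w) i j = Δ at *
    -- The four cases are the four equations of `frechetRec`; on the border only one predecessor
    -- exists.
    rcases a with _ | a <;> rcases b with _ | b
    · simp [Cmd.run, BExpr.holds, NExpr.eval, RExpr.eval, *, frechetRec]
    · have p1 := hprev b (by omega) 0 ha
      have i1 : (b + 1) * D.ℓ - D.ℓ = b * D.ℓ := by rw [add_mul]; omega
      simp_all [Cmd.run, BExpr.holds, NExpr.eval, RExpr.eval, frechetRec, run_maxCmd]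
    · have p1 := hrow a (by omega)
      simp_all [Cmd.run, BExpr.holds, NExpr.eval, RExpr.eval, frechetRec, run_maxCmd]
    · have p1 := hrow a (by omega)
      have p2 := hprev b (by omega) (a + 1) ha
      have p3 := hprev b (by omega) a (by omega)
      have i1 : (b + 1) * D.ℓ + (a + 1) - D.ℓ = b * D.ℓ + (a + 1) := by rw [add_mul]; omega
      have i2 : b * D.ℓ + (a + 1) - 1 = b * D.ℓ + a := by omega
      have i3 : (b + 1) * D.ℓ + (a + 1) - 1 = (b + 1) * D.ℓ + a := by omega
      clear hrow hprev
      simp [Cmd.run, BExpr.holds, NExpr.eval, RExpr.eval, frechetRec, run_maxCmd, run_minCmd, e3,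
        e12, e13, e14, eF, i1, i2, i3, p1, p2, p3, h₁, min_comm]

/-- Computes the table for the Fréchet distance of the center that starts at vertex `16` and curve
`10`, which starts at vertex `15`. -/
def frechetCmd : Cmd :=
  .seq (.nset 14 (.const 0)) (forLoop 12 (.get 0 (.var 10)) (forLoop 13 (.var 3) cellCmd))

theorem frechetCmd_runs {D : Data} (hD : D.Valid) {q e : ℕ → ℕ} {w : ℝ} {s : State}
    (h : CandCtx D q e w s) {i j : ℕ} (hi : i < D.k) (hj : j < D.m) (h10 : s.nvar 10 = j)
    (h15 : s.nvar 15 = D.start j) (h16 : s.nvar 16 = i * D.ℓ) :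
    Runs frechetCmd s (D.len j * (D.ℓ * (D.d * 340))) fun s' =>
      s'.rarr 3 (s'.nvar 14 - 1) = D.frechet (D.cand q e w) i j := by
  have hd := hD.d
  have hℓ := hD.ℓ
  have hld : 1 ≤ D.ℓ * D.d := Nat.mul_pos hℓ hd
  have hlen := hD.len j hj
  refine Runs.seq (T := 2) (Q := fun s' => s'.nvar 14 = 0)
    ⟨_, _, .nset s 14 _, le_rfl, by simp [NExpr.eval]⟩ (T' := D.len j * (D.ℓ * (D.d * 330))) ?_
    (by nlinarith [Nat.mul_pos hlen hld])
  intro s₁ hf₁ h₁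
  have H₁ := h.frame hf₁ rfl
  refine Runs.for (n := D.len j) (Tb := D.ℓ * (D.d * 314)) (fun b s' => s'.nvar 14 = b * D.ℓ ∧
      ∀ b' < b, ∀ a' < D.ℓ, s'.rarr 3 (b' * D.ℓ + a') =
        frechetRec (D.pairDist (D.cand q e w) i j) a' b') hlen rfl ?_ ?_ ?_ ?_ ?_
  · intro s' hf
    simp only [NExpr.eval]
    rw [hf.narr 0 rfl, hf.nvar 10 rfl, hf₁.nvar 10 rfl, h10, H₁.len j hj]
  · simp [h₁]
  · intro b hb s₂ hf₂ h12 ⟨h14, hI⟩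
    have H₂ := H₁.frame hf₂ rfl
    have e10 := (hf₂.nvar 10 rfl).trans ((hf₁.nvar 10 rfl).trans h10)
    have e15 := (hf₂.nvar 15 rfl).trans ((hf₁.nvar 15 rfl).trans h15)
    have e16 := (hf₂.nvar 16 rfl).trans ((hf₁.nvar 16 rfl).trans h16)
    refine Runs.for (n := D.ℓ) (Tb := D.d * 300) (fun a s' => s'.nvar 14 = b * D.ℓ + a ∧
      (∀ a' < a, s'.rarr 3 (b * D.ℓ + a') =
        frechetRec (D.pairDist (D.cand q e w) i j) a' b) ∧
      ∀ b' < b, ∀ a' < D.ℓ, s'.rarr 3 (b' * D.ℓ + a') =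
        frechetRec (D.pairDist (D.cand q e w) i j) a' b') hℓ rfl ?_ ?_ ?_ ?_ ?_
    · intro s' hf
      simp only [NExpr.eval]
      rw [hf.nvar 3 rfl, H₂.ℓ]
    · simpa [h14] using hI
    · intro a ha s₃ hf₃ h13 ⟨h14, hr, hp⟩
      refine (cellCmd_runs hD (H₂.frame hf₃ rfl) hi hj ha hb ((hf₃.nvar 12 rfl).trans h12) h13 h14
        ((hf₃.nvar 15 rfl).trans e15) ((hf₃.nvar 16 rfl).trans e16) hr hp).mono le_rfl ?_
      rintro s₄ - ⟨g14, gF⟩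
      refine ⟨by simp [g14, add_assoc], fun a' ha' => ?_, fun b' hb' a' ha' => ?_⟩
      · simp only [State.setN_rarr, gF]
        rcases Nat.lt_succ_iff_lt_or_eq.1 ha' with h | rfl
        · rw [Function.update_of_ne (by omega), hr _ h]
        · simp
      · simp only [State.setN_rarr, gF]
        rw [Function.update_of_ne, hp _ hb' _ ha']
        have : (b' + 1) * D.ℓ ≤ b * D.ℓ := Nat.mul_le_mul_right _ hb'
        rw [add_mul] at this
        omega
    · rintro s' - ⟨h14, hr, hp⟩
      refine ⟨by simp [h14, add_mul], fun b' hb' a' ha' => ?_⟩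
      rcases Nat.lt_succ_iff_lt_or_eq.1 hb' with h | rfl
      · exact hp b' h a' ha'
      · exact hr a' ha'
    · refine Nat.mul_le_mul_left _ ?_
      simp only [NExpr.time]
      omega
  · rintro s' - ⟨h14, hI⟩
    rw [h14, Data.frechet]
    have := hI (D.len j - 1) (by omega) (D.ℓ - 1) (by omega)
    rw [← this]
    -- The last cell written is `(len - 1) * ℓ + (ℓ - 1) = len * ℓ - 1`.
    congr 1
    obtain ⟨x, hx⟩ := Nat.exists_eq_add_of_le' hlen
    simp only [hx, Nat.add_sub_cancel, add_mul]
    omega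
  · refine Nat.mul_le_mul_left _ ?_
    simp only [NExpr.time]
    nlinarith

/-- Real variable `x` is negative, or the value of `e` is smaller. -/
def better (x : ℕ) (e : RExpr) : BExpr :=
  .not (.and (.not (.rlt (.var x) (.cast (.const 0)))) (.not (.rlt e (.var x))))

theorem holds_better {x : ℕ} {e : RExpr} {s : State} :
    (better x e).holds s ↔ s.rvar x < 0 ∨ e.eval s < s.rvar x := by
  simp only [better, BExpr.holds, RExpr.eval, NExpr.eval, Nat.cast_zero]
  tauto

/-- Computes in real variable `5` the distance of curve `10` to the nearest center. -/
def nearestCmd : Cmd :=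
  .seq (.rset 5 (.sub (.cast (.const 0)) (.cast (.const 1)))) (.seq (.nset 16 (.const 0))
    (forLoop 11 (.var 2) (.seq frechetCmd
      (.seq (.rset 3 (.get 3 (.sub (.var 14) (.const 1))))
        (.seq (.ite (better 5 (.var 3)) (.rset 5 (.var 3)) .skip)
          (.nset 16 (.add (.var 16) (.var 3))))))))

theorem nearestCmd_runs {D : Data} (hD : D.Valid) {q e : ℕ → ℕ} {w : ℝ} {s : State}
    (h : CandCtx D q e w s) {j : ℕ} (hj : j < D.m) (h10 : s.nvar 10 = j)
    (h15 : s.nvar 15 = D.start j) :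
    Runs nearestCmd s (D.k * (D.len j * (D.ℓ * (D.d * 420)))) fun s' =>
      s'.rvar 5 = runMin (fun i => D.frechet (D.cand q e w) i j) D.k := by
  have hk := hD.k
  have hld : 1 ≤ D.len j * (D.ℓ * D.d) := Nat.mul_pos (hD.len j hj) (Nat.mul_pos hD.ℓ hD.d)
  -- The value `-1` means "no distance seen yet", as in `runMin` of an empty sequence.
  refine Runs.seq (T := 6) (Q := fun s' => s'.rvar 5 = -1)
    ⟨_, _, .rset s 5 _, le_rfl, by simp [NExpr.eval, RExpr.eval]⟩
    (T' := D.k * (D.len j * (D.ℓ * (D.d * 410)))) ?_ (by nlinarith [Nat.mul_pos hk hld])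
  intro s₁ hf₁ h₁
  refine Runs.seq (T := 2) (Q := fun s' => s'.nvar 16 = 0)
    ⟨_, _, .nset s₁ 16 _, le_rfl, by simp [NExpr.eval]⟩
    (T' := D.k * (D.len j * (D.ℓ * (D.d * 400)))) ?_ (by nlinarith [Nat.mul_pos hk hld])
  intro s₂ hf₂ h₂
  have H₂ := (h.frame hf₁ rfl).frame hf₂ rfl
  have e10 := (hf₂.nvar 10 rfl).trans ((hf₁.nvar 10 rfl).trans h10)
  have e15 := (hf₂.nvar 15 rfl).trans ((hf₁.nvar 15 rfl).trans h15)
  refine Runs.for (n := D.k) (Tb := D.len j * (D.ℓ * (D.d * 340)) + 30) (fun i s' =>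
      s'.nvar 16 = i * D.ℓ ∧ s'.rvar 5 = runMin (fun i => D.frechet (D.cand q e w) i j) i)
      hk rfl ?_ ?_ ?_ (fun _ _ h => h.2) ?_
  · intro s' hf
    simp only [NExpr.eval]
    rw [hf.nvar 2 rfl, H₂.k]
  · simp [h₂, hf₂.rvar 5 rfl, h₁, runMin]
  · intro i hi s₃ hf₃ h11 ⟨h16, h5⟩
    have H₃ := H₂.frame hf₃ rfl
    refine (frechetCmd_runs hD H₃ hi hj ((hf₃.nvar 10 rfl).trans e10)
      ((hf₃.nvar 15 rfl).trans e15) h16).seq (T' := 30) ?_ le_rfl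
    intro s₄ hf₄ h₄
    refine (Runs.of_run rfl ?_).mono (by decide) fun _ _ h => h
    have e16 := (hf₄.nvar 16 rfl).trans h16
    have e5 := (hf₄.rvar 5 rfl).trans h5
    have e3 := (H₃.frame hf₄ rfl).ℓ
    by_cases hc : runMin (fun i => D.frechet (D.cand q e w) i j) i < 0 ∨
        D.frechet (D.cand q e w) i j < runMin (fun i => D.frechet (D.cand q e w) i j) i
    · simp [Cmd.run, holds_better, RExpr.eval, NExpr.eval, e5, h₄, e16, e3, add_mul, runMin, hc]
    · simp [Cmd.run, holds_better, RExpr.eval, NExpr.eval, e5, h₄, e16, e3, add_mul, runMin, hc]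
  · refine Nat.mul_le_mul_left _ ?_
    simp only [NExpr.time]
    nlinarith

/-- Computes in real variable `4` the cost of the candidate solution. -/
def costCmd : Cmd :=
  .seq (.rset 4 (.cast (.const 0))) (.seq (.nset 15 (.const 0))
    (forLoop 10 (.var 1) (.seq nearestCmd
      (.seq (maxCmd 4 (.var 5)) (.nset 15 (.add (.var 15) (.get 0 (.var 10))))))))

theorem costCmd_runs {D : Data} (hD : D.Valid) {n : ℕ} (hn : ∀ j < D.m, D.len j ≤ n)
    {q e : ℕ → ℕ} {w : ℝ} {s : State} (h : CandCtx D q e w s) :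
    Runs costCmd s (D.m * (D.k * (n * (D.ℓ * (D.d * 500))))) fun s' =>
      s'.rvar 4 = D.cost (D.cand q e w) := by
  have hm := hD.m
  have hn1 : 1 ≤ n := (hD.len 0 hm).trans (hn 0 hm)
  have hld : 1 ≤ D.k * (n * (D.ℓ * D.d)) :=
    Nat.mul_pos hD.k (Nat.mul_pos hn1 (Nat.mul_pos hD.ℓ hD.d))
  refine Runs.seq (T := 3) (Q := fun s' => s'.rvar 4 = 0)
    ⟨_, _, .rset s 4 _, le_rfl, by simp [NExpr.eval, RExpr.eval]⟩
    (T' := D.m * (D.k * (n * (D.ℓ * (D.d * 490))))) ?_ (by nlinarith [Nat.mul_pos hm hld])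
  intro s₁ hf₁ h₁
  refine Runs.seq (T := 2) (Q := fun s' => s'.nvar 15 = 0)
    ⟨_, _, .nset s₁ 15 _, le_rfl, by simp [NExpr.eval]⟩
    (T' := D.m * (D.k * (n * (D.ℓ * (D.d * 480))))) ?_ (by nlinarith [Nat.mul_pos hm hld])
  intro s₂ hf₂ h₂
  have H₂ := (h.frame hf₁ rfl).frame hf₂ rfl
  refine Runs.for (n := D.m) (Tb := D.k * (n * (D.ℓ * (D.d * 420))) + 20) (fun j s' =>
      s'.nvar 15 = D.start j ∧ s'.rvar 4 =
        runMax (fun j => runMin (fun i => D.frechet (D.cand q e w) i j) D.k) j)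
      hm rfl ?_ ?_ ?_ (fun _ _ h => h.2) ?_
  · intro s' hf
    simp only [NExpr.eval]
    rw [hf.nvar 1 rfl, H₂.m]
  · simp [h₂, hf₂.rvar 4 rfl, h₁, runMax, Data.start]
  · intro j hj s₃ hf₃ h10 ⟨h15, h4⟩
    have H₃ := H₂.frame hf₃ rfl
    refine (nearestCmd_runs hD H₃ hj h10 h15).seq (T' := 20) ?_ ?_
    · intro s₄ hf₄ h₄
      refine (Runs.of_run rfl ?_).mono (by decide) fun _ _ h => h
      have e15 := (hf₄.nvar 15 rfl).trans h15
      have e10 := (hf₄.nvar 10 rfl).trans h10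
      have e4 := (hf₄.rvar 4 rfl).trans h4
      have e0 := (H₃.frame hf₄ rfl).len j hj
      simp [Cmd.run, run_maxCmd, RExpr.eval, NExpr.eval, e4, e15, e0, e10, h₄, D.start_succ, runMax]
    · gcongr
      exact hn j hj
  · refine Nat.mul_le_mul_left _ ?_
    simp only [NExpr.time]
    nlinarith

/-- The memory holds centers with the coordinates `Y` in the output array, and their cost in real
variable `2`. -/
structure Recorded (D : Data) (Y : ℕ → ℕ → ℝ) (s : State) : Prop where
  cost : s.rvar 2 = D.cost Y
  coord : ∀ u < D.kl, ∀ c < D.d, s.rarr 1 (u * D.d + c) = Y u c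

/-- Stores the candidate solution and its cost as the best solution that has been found. -/
def recordCmd : Cmd :=
  .seq (.rset 2 (.var 4)) (forLoop 22 (.var 4) (forLoop 20 (.var 0)
    (.rstore 1 (.add (.get 2 (.var 22)) (.var 20)) (candCoord (.var 22)))))

theorem Data.Valid.kl {D : Data} (hD : D.Valid) : 1 ≤ D.kl := Nat.mul_pos hD.k hD.ℓ

theorem recordCmd_runs {D : Data} (hD : D.Valid) {q e : ℕ → ℕ} {w : ℝ} {s : State}
    (h : CandCtx D q e w s) (h4 : s.rvar 4 = D.cost (D.cand q e w)) :
    Runs recordCmd s (D.kl * (D.d * 150)) (Recorded D (D.cand q e w)) := by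
  have hd := hD.d
  have hkl := hD.kl
  refine Runs.seq (T := 2) (Q := fun s' => s'.rvar 2 = D.cost (D.cand q e w))
    ⟨_, _, .rset s 2 _, le_rfl, by simp [RExpr.eval, h4]⟩
    (T' := D.kl * (D.d * 140)) ?_ (by nlinarith [Nat.mul_pos hkl hd])
  intro s₁ hf₁ h₁
  have H₁ := h.frame hf₁ rfl
  refine Runs.for (n := D.kl) (Tb := D.d * 114) (fun u s' =>
      ∀ u' < u, ∀ c < D.d, s'.rarr 1 (u' * D.d + c) = D.cand q e w u' c)
      hkl rfl ?_ (by simp) ?_ (fun s' hf h => ⟨(hf.rvar 2 rfl).trans h₁, h⟩) ?_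
  · intro s' hf
    simp only [NExpr.eval]
    rw [hf.nvar 4 rfl, H₁.kl]
  · intro u hu s₂ hf₂ h22 hI
    have H₂ := H₁.frame hf₂ rfl
    refine Runs.for (n := D.d) (Tb := 100) (fun c s' =>
      (∀ u' < u, ∀ c < D.d, s'.rarr 1 (u' * D.d + c) = D.cand q e w u' c) ∧
      ∀ c' < c, s'.rarr 1 (u * D.d + c') = D.cand q e w u c')
      hd rfl ?_ (by simpa using hI) ?_ ?_ ?_
    · intro s' hf
      simp only [NExpr.eval]
      rw [hf.nvar 0 rfl, H₂.d]
    · intro c hc s₃ hf₃ h20 ⟨hI₁, hI₂⟩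
      have H₃ := H₂.frame hf₃ rfl
      refine (Runs.of_run rfl ?_).mono (by decide) fun _ _ h => h
      have e22 : NExpr.eval s₃ (.var 22) = u := (hf₃.nvar 22 rfl).trans h22
      have hcand := eval_candCoord H₃ (u := .var 22) (by rwa [e22]) (by rwa [h20])
      rw [e22, h20] at hcand
      have hoff := H₃.off u (by omega)
      simp only [NExpr.eval] at e22
      simp only [Cmd.run, hcand, NExpr.eval, e22, h20, hoff, State.setN_rarr,
        Function.update_self]
      refine ⟨fun u' hu' c' hc' => ?_, fun c' hc' => ?_⟩
      · rw [Function.update_of_ne, hI₁ u' hu' c' hc']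
        -- The blocks of `d` coordinates of different vertices are disjoint, so earlier blocks
        -- survive this store.
        have : (u' + 1) * D.d ≤ u * D.d := Nat.mul_le_mul_right _ hu'
        rw [add_mul] at this
        omega
      · rcases Nat.lt_succ_iff_lt_or_eq.1 hc' with h | rfl
        · rw [Function.update_of_ne (by omega), hI₂ _ h]
        · simp
    · rintro s' - ⟨h1, h2⟩ u' hu' c hc
      rcases Nat.lt_succ_iff_lt_or_eq.1 hu' with h | rfl
      · exact h1 u' h c hc
      · exact h2 c hc
    · refine Nat.mul_le_mul_left _ ?_
      simp [NExpr.time]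
  · refine Nat.mul_le_mul_left _ ?_
    simp only [NExpr.time]
    omega

/-! ### Enumerating the candidate solutions -/

namespace Data

/-- The place value of digit `p`. -/
def weight (D : Data) (p : ℕ) : ℕ := ∏ i ∈ Finset.range p, D.base i

/-- The number with the digits `e`. -/
def value (D : Data) (e : ℕ → ℕ) : ℕ := ∑ p ∈ Finset.range D.digits, e p * D.weight p

theorem weight_succ (D : Data) (p : ℕ) : D.weight (p + 1) = D.weight p * D.base p :=
  Finset.prod_range_succ _ _

theorem sum_lt_weight (D : Data) {e : ℕ → ℕ} {p : ℕ} (h : ∀ i < p, e i < D.base i) :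
    ∑ i ∈ Finset.range p, e i * D.weight i < D.weight p := by
  induction p with
  | zero => simp [weight]
  | succ p ih =>
    rw [Finset.sum_range_succ, weight_succ]
    have h1 := ih fun i hi => h i (by omega)
    have h2 : (e p + 1) * D.weight p ≤ D.base p * D.weight p :=
      Nat.mul_le_mul_right _ (h p (by omega))
    rw [mul_comm (D.weight p)]
    rw [add_mul] at h2
    omega

/-- By `sum_lt_weight` the lower digits together contribute less than one unit of the top digit, so
the top digits agree, and then induction applies. -/
theorem eq_of_sum_eq (D : Data) {e f : ℕ → ℕ} {p : ℕ} (he : ∀ i < p, e i < D.base i)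
    (hf : ∀ i < p, f i < D.base i)
    (h : ∑ i ∈ Finset.range p, e i * D.weight i = ∑ i ∈ Finset.range p, f i * D.weight i) :
    ∀ i < p, e i = f i := by
  induction p with
  | zero => simp
  | succ p ih =>
    have h1 := D.sum_lt_weight fun i (hi : i < p) => he i (by omega)
    have h2 := D.sum_lt_weight fun i (hi : i < p) => hf i (by omega)
    rw [Finset.sum_range_succ, Finset.sum_range_succ] at h
    have hp : e p = f p := by
      rcases lt_trichotomy (e p) (f p) with hlt | heq | hlt
      · have : (e p + 1) * D.weight p ≤ f p * D.weight p := Nat.mul_le_mul_right _ hlt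
        rw [add_mul] at this
        omega
      · exact heq
      · have : (f p + 1) * D.weight p ≤ e p * D.weight p := Nat.mul_le_mul_right _ hlt
        rw [add_mul] at this
        omega
    intro i hi
    rcases Nat.lt_succ_iff_lt_or_eq.1 hi with hi | rfl
    · exact ih (fun i hi => he i (by omega)) (fun i hi => hf i (by omega))
        (by rw [hp] at h; omega) i hi
    · exact hp

theorem IsDigits.value_lt {D : Data} {e : ℕ → ℕ} (he : D.IsDigits e) :
    D.value e < D.weight D.digits :=
  D.sum_lt_weight he.lt

/-- Injectivity is what turns counting through all values into visiting all candidates. Digits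
beyond the range are `0`, so equality holds as functions. -/
theorem IsDigits.eq_of_value_eq {D : Data} {e f : ℕ → ℕ} (he : D.IsDigits e) (hf : D.IsDigits f)
    (h : D.value e = D.value f) : e = f := by
  funext p
  by_cases hp : p < D.digits
  · exact D.eq_of_sum_eq he.lt hf.lt h p hp
  · rw [he.eq_zero p (not_lt.1 hp), hf.eq_zero p (not_lt.1 hp)]

theorem Valid.base_pos {D : Data} (hD : D.Valid) (p : ℕ) : 0 < D.base p := by
  unfold base
  split_ifs
  · exact hD.kl
  · exact hD.N

theorem Valid.isDigits_zero {D : Data} (hD : D.Valid) : D.IsDigits fun _ => 0 :=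
  ⟨fun p _ => hD.base_pos p, fun _ _ => rfl⟩

theorem value_zero (D : Data) : D.value (fun _ => 0) = 0 := by simp [value]

theorem IsDigits.update {D : Data} {e : ℕ → ℕ} (he : D.IsDigits e) {p x : ℕ} (hp : p < D.digits)
    (hx : x < D.base p) : D.IsDigits (Function.update e p x) := by
  refine ⟨fun i hi => ?_, fun i hi => ?_⟩
  · by_cases h : i = p
    · subst h; simpa using hx
    · rw [Function.update_of_ne h]; exact he.lt i hi
  · rw [Function.update_of_ne (by omega)]; exact he.eq_zero i hi

theorem value_update (D : Data) (e : ℕ → ℕ) {p x : ℕ} (hp : p < D.digits) :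
    D.value (Function.update e p x) + e p * D.weight p = D.value e + x * D.weight p := by
  unfold value
  rw [← Finset.add_sum_erase _ (fun i => Function.update e p x i * D.weight i)
    (Finset.mem_range.2 hp), ← Finset.add_sum_erase _ (fun i => e i * D.weight i)
    (Finset.mem_range.2 hp)]
  have : ∑ i ∈ (Finset.range D.digits).erase p, Function.update e p x i * D.weight i =
      ∑ i ∈ (Finset.range D.digits).erase p, e i * D.weight i :=
    Finset.sum_congr rfl fun i hi => by rw [Function.update_of_ne (Finset.ne_of_mem_erase hi)]
  rw [this]
  simp only [Function.update_self]
  ring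

end Data

/-- Replaces the digits by those of the next number, or by zeros and sets variable `19` to `1` if
there is none. -/
def nextCmd : Cmd :=
  .seq (.nset 21 (.const 0)) (.seq
    (.while (.and (.nlt (.var 21) (.var 7))
        (.neq (.add (.get 4 (.var 21)) (.const 1)) (.get 5 (.var 21))))
      (.seq (.nstore 4 (.var 21) (.const 0)) (.nset 21 (.add (.var 21) (.const 1)))))
    (.ite (.nlt (.var 21) (.var 7))
      (.nstore 4 (.var 21) (.add (.get 4 (.var 21)) (.const 1))) (.nset 19 (.const 1))))

/-- Increment with carry. While the loop stands at position `p`, one unit of weight `p` remains to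
be added: value of the present digits plus `weight p` equals the old value plus one. If the carry
leaves the last position, the old number was the largest one, and all digits are now `0`, ready for
the next pass. -/
theorem nextCmd_runs {D : Data} (hD : D.Valid) {q e : ℕ → ℕ} {w : ℝ} {s : State}
    (h : CandCtx D q e w s) :
    Runs nextCmd s (D.kl * (D.d * 100)) fun s' => ∃ e', CandCtx D q e' w s' ∧
      ((s'.nvar 19 = s.nvar 19 ∧ D.value e' = D.value e + 1) ∨
        (s'.nvar 19 = 1 ∧ (e' = fun _ => 0) ∧ D.value e + 1 = D.weight D.digits)) := by
  have hd := hD.d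
  have hkl := hD.kl
  have hL : D.digits ≤ 2 * (D.kl * D.d) := by unfold Data.digits; nlinarith
  have hkd : 1 ≤ D.kl * D.d := Nat.mul_pos hkl hd
  refine Runs.seq (T := 2) (Q := fun s' => s'.nvar 21 = 0)
    ⟨_, _, .nset s 21 _, le_rfl, by simp [NExpr.eval]⟩ (T' := D.digits * 20 + 50) ?_
    (by nlinarith)
  intro s₁ hf₁ h₁
  have H₁ := h.frame hf₁ rfl
  refine Runs.seq (T := D.digits * 20 + 20) (T' := 30) (Q := fun s' => s'.nvar 21 ≤ D.digits ∧
    ∃ f, CandCtx D q f w s' ∧ (∀ p < s'.nvar 21, f p = 0) ∧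
      D.value f + D.weight (s'.nvar 21) = D.value e + 1 ∧
      (s'.nvar 21 < D.digits → f (s'.nvar 21) + 1 ≠ D.base (s'.nvar 21))) ?_ ?_ le_rfl
  · refine Runs.while (Tb := 8) (fun s' => s'.nvar 21 ≤ D.digits ∧
      ∃ f, CandCtx D q f w s' ∧ (∀ p < s'.nvar 21, f p = 0) ∧
      D.value f + D.weight (s'.nvar 21) = D.value e + 1) (fun s' => D.digits - s'.nvar 21)
      ⟨by omega, e, H₁, by simp [h₁], by simp [h₁, Data.weight]⟩ ?_ ?_ ?_
    · intro s₂ hf₂ ⟨hle, f, H₂, h0, hv⟩ hb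
      simp only [BExpr.holds, NExpr.eval, H₂.digits, H₂.e_eq] at hb
      obtain ⟨hlt, hb⟩ := hb
      rw [H₂.base _ hlt] at hb
      refine (Runs.of_run rfl ?_).mono (by decide) fun _ _ h => h
      -- The digit is maximal, so clearing it removes `(base - 1) * weight p`; with the pending
      -- `weight p` this is one unit at position `p + 1`.
      have hu := D.value_update f (x := 0) hlt
      have hw := D.weight_succ (s₂.nvar 21)
      rw [← hb] at hw
      simp only [Cmd.run, NExpr.eval, H₂.e_eq, Function.update_self]
      refine ⟨⟨hlt, Function.update f (s₂.nvar 21) 0, ?_, fun p hp => ?_, ?_⟩, by omega⟩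
      · refine ⟨⟨?_, ?_, ?_, ?_, ?_, ?_, ?_, ?_, H₂.len, H₂.out, H₂.off, H₂.base, H₂.pt⟩, H₂.q_eq,
          by simp, H₂.b_eq, H₂.q_lt, H₂.isDigits.update hlt (hD.base_pos _)⟩ <;>
          simp [H₂.d, H₂.m, H₂.k, H₂.ℓ, H₂.kl, H₂.V, H₂.N, H₂.digits]
      · rcases Nat.lt_succ_iff_lt_or_eq.1 hp with hp | rfl
        · rw [Function.update_of_ne (by omega), h0 p hp]
        · simp
      · rw [hw]
        nlinarith
    · intro s₂ hf₂ ⟨hle, f, H₂, h0, hv⟩ hb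
      refine ⟨hle, f, H₂, h0, hv, fun hlt heq => hb ?_⟩
      simp only [BExpr.holds, NExpr.eval, H₂.digits, H₂.e_eq]
      exact ⟨hlt, heq.trans (H₂.base _ hlt).symm⟩
    · simp only [BExpr.time, NExpr.time, h₁]
      omega
  · intro s₂ hf₂ ⟨hle, f, H₂, h0, hv, hne⟩
    refine (Runs.of_run rfl ?_).mono (by decide) fun _ _ h => h
    by_cases hlt : s₂.nvar 21 < D.digits
    · have hu := D.value_update f (x := f (s₂.nvar 21) + 1) hlt
      have hx := H₂.isDigits.lt _ hlt
      refine ⟨Function.update f (s₂.nvar 21) (f (s₂.nvar 21) + 1), ?_, Or.inl ⟨?_, by nlinarith⟩⟩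
      · simp only [Cmd.run, BExpr.holds, NExpr.eval, H₂.digits, hlt, if_true]
        refine ⟨⟨?_, ?_, ?_, ?_, ?_, ?_, ?_, ?_, H₂.len, H₂.out, H₂.off, H₂.base, H₂.pt⟩, H₂.q_eq,
          by simp [H₂.e_eq], H₂.b_eq, H₂.q_lt, H₂.isDigits.update hlt ?_⟩
        iterate 8 simp [H₂.d, H₂.m, H₂.k, H₂.ℓ, H₂.kl, H₂.V, H₂.N, H₂.digits]
        have := hne hlt
        omega
      · simp only [Cmd.run, BExpr.holds, NExpr.eval, H₂.digits, hlt, if_true]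
        rw [hf₂.nvar 19 rfl, hf₁.nvar 19 rfl]
    · have heq : s₂.nvar 21 = D.digits := by omega
      have hf0 : f = fun _ => 0 := by
        funext p
        by_cases hp : p < D.digits
        · exact h0 p (heq ▸ hp)
        · exact H₂.isDigits.eq_zero p (not_lt.1 hp)
      refine ⟨f, ?_, Or.inr ⟨?_, hf0, ?_⟩⟩
      · simp only [Cmd.run, BExpr.holds, NExpr.eval, H₂.digits, hlt, if_false]
        refine ⟨⟨?_, ?_, ?_, ?_, ?_, ?_, ?_, ?_, H₂.len, H₂.out, H₂.off, H₂.base, H₂.pt⟩, H₂.q_eq,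
          H₂.e_eq, H₂.b_eq, H₂.q_lt, H₂.isDigits⟩ <;>
          simp [H₂.d, H₂.m, H₂.k, H₂.ℓ, H₂.kl, H₂.V, H₂.N, H₂.digits]
      · simp [Cmd.run, BExpr.holds, NExpr.eval, H₂.digits, hlt]
      · rw [hf0, D.value_zero, heq] at hv
        omega

/-! ### One pass over all candidate solutions -/

theorem runMax_nonneg (f : ℕ → ℝ) (n : ℕ) : 0 ≤ runMax f n := by
  induction n with
  | zero => exact le_rfl
  | succ n ih => exact ih.trans (le_max_left _ _)

/-- Evaluates one candidate solution and goes on to the next one. -/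
def candidateCmd : Cmd :=
  .seq costCmd (.seq (.ite (better 2 (.var 4)) recordCmd .skip) nextCmd)

/-- Evaluates all candidate solutions, with cubes of the size in real variable `1`. -/
def passCmd : Cmd :=
  .seq (.nset 19 (.const 0)) (.while (.neq (.var 19) (.const 0)) candidateCmd)

/-- The memory holds a solution, or real variable `2` is negative. -/
def Started (D : Data) (s : State) : Prop := s.rvar 2 < 0 ∨ ∃ Y, Recorded D Y s

theorem Recorded.congr {D : Data} {Y : ℕ → ℕ → ℝ} {s s' : State} (h : Recorded D Y s)
    (h2 : s'.rvar 2 = s.rvar 2) (h1 : s'.rarr 1 = s.rarr 1) : Recorded D Y s' :=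
  ⟨h2.trans h.cost, h1.symm ▸ h.coord⟩

/-- A negative best cost means that nothing is stored yet; real costs are nonnegative. After this
step a solution is stored, it is at least as good as the present candidate, and a previously stored
cost has not increased. -/
theorem candidateCmd_runs {D : Data} (hD : D.Valid) {n : ℕ} (hn : ∀ j < D.m, D.len j ≤ n)
    {q e : ℕ → ℕ} {w : ℝ} {s : State} (h : CandCtx D q e w s) (hs : Started D s) :
    Runs candidateCmd s (D.m * (D.k * (n * (D.ℓ * (D.d * 1000))))) fun s' =>
      (∃ Y, Recorded D Y s') ∧ s'.rvar 2 ≤ D.cost (D.cand q e w) ∧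
      (s.rvar 2 < 0 ∨ s'.rvar 2 ≤ s.rvar 2) ∧ ∃ e', CandCtx D q e' w s' ∧
      ((s'.nvar 19 = s.nvar 19 ∧ D.value e' = D.value e + 1) ∨
        (s'.nvar 19 = 1 ∧ (e' = fun _ => 0) ∧ D.value e + 1 = D.weight D.digits)) := by
  have hn1 : 1 ≤ n := (hD.len 0 hD.m).trans (hn 0 hD.m)
  have hld : 1 ≤ D.kl * D.d := Nat.mul_pos hD.kl hD.d
  have hmn : 1 ≤ D.m * n := Nat.mul_pos hD.m hn1
  refine (costCmd_runs hD hn h).seq (T' := D.kl * (D.d * 300)) ?_ ?_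
  · intro s₁ hf₁ h₁
    have H₁ := h.frame hf₁ rfl
    have e2 := hf₁.rvar 2 rfl
    refine Runs.seq (T := D.kl * (D.d * 150) + 20) (T' := D.kl * (D.d * 100)) (Q := fun s' =>
      (∃ Y, Recorded D Y s') ∧ s'.rvar 2 ≤ D.cost (D.cand q e w) ∧
      (s.rvar 2 < 0 ∨ s'.rvar 2 ≤ s.rvar 2) ∧ CandCtx D q e w s' ∧ s'.nvar 19 = s.nvar 19) ?_ ?_ ?_
    · refine Runs.ite (T := D.kl * (D.d * 150)) (fun hb => ?_) (fun hb => ?_) ?_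
      · rw [holds_better] at hb
        simp only [RExpr.eval, h₁, e2] at hb
        refine (recordCmd_runs hD H₁ h₁).mono le_rfl fun s' hf hR => ?_
        refine ⟨⟨_, hR⟩, hR.cost.le, hb.imp_right fun hb => hR.cost.trans_le hb.le, ?_,
          (hf.nvar 19 rfl).trans (hf₁.nvar 19 rfl)⟩
        have := H₁.toCtx.frame (s' := s') hf rfl
        exact ⟨this, (hf.narr 3 rfl).trans H₁.q_eq, (hf.narr 4 rfl).trans H₁.e_eq,
          (hf.rvar 1 rfl).trans H₁.b_eq, H₁.q_lt, H₁.isDigits⟩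
      · rw [holds_better, not_or] at hb
        simp only [RExpr.eval, h₁, e2, not_lt] at hb
        refine (Runs.of_run rfl ?_).mono (show 1 ≤ _ by nlinarith) fun _ _ h => h
        simp only [Cmd.run]
        refine ⟨?_, e2.trans_le hb.2, Or.inr e2.le, H₁, hf₁.nvar 19 rfl⟩
        rcases hs with hs | ⟨Y, hY⟩
        · linarith [hb.1]
        · exact ⟨Y, hY.congr e2 (hf₁.rarr 1 rfl)⟩
      · simp only [better, BExpr.time, RExpr.time, NExpr.time]
        omega
    · intro s₂ hf₂ ⟨⟨Y, hY⟩, h2, h3, H₂, e19⟩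
      refine (nextCmd_runs hD H₂).mono le_rfl fun s₃ hf₃ h₃ => ?_
      have e2' := hf₃.rvar 2 rfl
      rw [e2']
      refine ⟨⟨Y, hY.congr e2' (hf₃.rarr 1 rfl)⟩, h2, h3, ?_⟩
      rwa [e19] at h₃
    · nlinarith
  -- Recording and counting cost `O(kℓd)`, which is dominated by evaluating the candidate.
  · have : D.kl * (D.d * 300) ≤ D.m * n * (D.kl * (D.d * 300)) := Nat.le_mul_of_pos_left _ hmn
    have e1 : D.m * n * (D.kl * (D.d * 300)) = D.m * (D.k * (n * (D.ℓ * (D.d * 300)))) := by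
      unfold Data.kl; ring
    rw [e1] at this
    nlinarith

/-- While the flag in variable `19` is `0`, the stored cost is at most that of every candidate with
a smaller value than the current one. When the counter wraps around, these are all candidates. -/
theorem passCmd_runs {D : Data} (hD : D.Valid) {n : ℕ} (hn : ∀ j < D.m, D.len j ≤ n)
    {q : ℕ → ℕ} {w : ℝ} {s : State} (h : CandCtx D q (fun _ => 0) w s) (hs : Started D s) :
    Runs passCmd s (D.weight D.digits * (D.m * (D.k * (n * (D.ℓ * (D.d * 1020)))))) fun s' =>
      (∃ Y, Recorded D Y s') ∧ (s.rvar 2 < 0 ∨ s'.rvar 2 ≤ s.rvar 2) ∧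
      CandCtx D q (fun _ => 0) w s' ∧
      ∀ e, D.IsDigits e → s'.rvar 2 ≤ D.cost (D.cand q e w) := by
  have hn1 : 1 ≤ n := (hD.len 0 hD.m).trans (hn 0 hD.m)
  have hB : 1 ≤ D.m * (D.k * (n * (D.ℓ * D.d))) :=
    Nat.mul_pos hD.m (Nat.mul_pos hD.k (Nat.mul_pos hn1 (Nat.mul_pos hD.ℓ hD.d)))
  have hW : 1 ≤ D.weight D.digits := Finset.prod_pos fun i _ => hD.base_pos i
  refine Runs.seq (T := 2) (Q := fun s' => s'.nvar 19 = 0)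
    ⟨_, _, .nset s 19 _, le_rfl, by simp [NExpr.eval]⟩
    (T' := D.weight D.digits * (D.m * (D.k * (n * (D.ℓ * (D.d * 1015)))))) ?_
    (by nlinarith [Nat.mul_pos hW hB])
  intro s₁ hf₁ h₁
  have H₁ := h.frame hf₁ rfl
  have e2 := hf₁.rvar 2 rfl
  refine Runs.while (Tb := D.m * (D.k * (n * (D.ℓ * (D.d * 1000)))))
    (fun s' => (s.rvar 2 < 0 ∨ (0 ≤ s'.rvar 2 ∧ s'.rvar 2 ≤ s.rvar 2)) ∧ ∃ e, CandCtx D q e w s' ∧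
      ((s'.nvar 19 = 0 ∧ Started D s' ∧ ∀ f, D.IsDigits f → D.value f < D.value e →
        0 ≤ s'.rvar 2 ∧ s'.rvar 2 ≤ D.cost (D.cand q f w)) ∨
      (s'.nvar 19 = 1 ∧ (∃ Y, Recorded D Y s') ∧ (e = fun _ => 0) ∧
        ∀ f, D.IsDigits f → s'.rvar 2 ≤ D.cost (D.cand q f w))))
    -- The wrap-around resets the value, so the measure is set to `0` once the flag is raised;
    -- otherwise the last iteration would increase it.
    (fun s' => if s'.nvar 19 = 0 then D.weight D.digits - D.value (s'.narr 4) else 0)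
    ⟨?_, _, H₁, Or.inl ⟨h₁, ?_, ?_⟩⟩ ?_ ?_ ?_
  · rcases lt_or_ge (s.rvar 2) 0 with h0 | h0
    · exact Or.inl h0
    · exact Or.inr ⟨e2 ▸ h0, e2.le⟩
  · rcases hs with hs | ⟨Y, hY⟩
    · exact Or.inl (e2.trans_lt hs)
    · exact Or.inr ⟨Y, hY.congr e2 (hf₁.rarr 1 rfl)⟩
  · intro f _ hf
    rw [D.value_zero] at hf
    omega
  · intro s₂ hf₂ ⟨hle, e, H₂, hcase⟩ hb
    simp only [BExpr.holds, NExpr.eval] at hb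
    rcases hcase with ⟨h19, hst, hI⟩ | ⟨h19, -⟩
    · refine (candidateCmd_runs hD hn H₂ hst).mono le_rfl fun s₃ hf₃ h₃ => ?_
      obtain ⟨⟨Y, hY⟩, hc, hle', f, H₃, h'⟩ := h₃
      have hval := H₂.isDigits.value_lt
      have hpos : 0 ≤ s₃.rvar 2 := hY.cost ▸ runMax_nonneg _ _
      have hold : ∀ g, D.IsDigits g → D.value g < D.value e + 1 →
          s₃.rvar 2 ≤ D.cost (D.cand q g w) := by
        intro g hg hlt
        rcases Nat.lt_succ_iff_lt_or_eq.1 hlt with hlt | heq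
        · obtain ⟨hp, hle₂⟩ := hI g hg hlt
          rcases hle' with hneg | hle'
          · linarith
          · exact hle'.trans hle₂
        · rwa [hg.eq_of_value_eq H₂.isDigits heq]
      refine ⟨⟨?_, f, H₃, ?_⟩, ?_⟩
      · rcases hle with hle | hle
        · exact Or.inl hle
        · rcases hle' with hneg | hle'
          · linarith [hle.1]
          · exact Or.inr ⟨hpos, hle'.trans hle.2⟩
      · rcases h' with ⟨h19', hv⟩ | ⟨h19', hf0, hv⟩
        · exact Or.inl ⟨h19'.trans h19, Or.inr ⟨Y, hY⟩,
            fun g hg hlt => ⟨hpos, hold g hg (hv ▸ hlt)⟩⟩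
        · exact Or.inr ⟨h19', ⟨Y, hY⟩, hf0, fun g hg => hold g hg (hv ▸ hg.value_lt)⟩
      · simp only [h19, if_true, H₂.e_eq, H₃.e_eq]
        rcases h' with ⟨h19', hv⟩ | ⟨h19', hf0, hv⟩
        · rw [h19', if_pos h19]; omega
        · rw [h19', if_neg (by omega)]; omega
    · omega
  · intro s₂ hf₂ ⟨hle, e, H₂, hcase⟩ hb
    simp only [BExpr.holds, NExpr.eval] at hb
    rcases hcase with ⟨h19, -⟩ | ⟨-, hY, he, hI⟩
    · exact absurd h19 hb
    · exact ⟨hY, hle.imp_right And.right, he ▸ H₂, hI⟩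
  · simp only [h₁, if_true, H₁.e_eq, D.value_zero, BExpr.time, NExpr.time, Nat.sub_zero]
    nlinarith [Nat.mul_pos hW hB]

/-! ### Farthest-first traversal of the input vertices -/

/-- The distance of two input vertices. -/
noncomputable def Data.ptDist (D : Data) (u v : ℕ) : ℝ := rawDist D.d (D.pt u) (D.pt v)

theorem rawDist_nonneg (d : ℕ) (x y : ℕ → ℝ) : 0 ≤ rawDist d x y := Real.sqrt_nonneg _

/-- Takes the chosen vertex number `8` into account for the distance in array `2` of vertex `9` to
the nearest chosen vertex, and keeps track of the vertex with the largest distance. -/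
def updateCmd : Cmd :=
  .seq (distCmd (inputCoord (.get 3 (.var 8))) (inputCoord (.var 9))) (.seq
    (.ite (.not (.and (.not (.neq (.var 8) (.const 0))) (.not (.rlt (.var 3) (.get 2 (.var 9))))))
      (.rstore 2 (.var 9) (.var 3)) .skip)
    (.ite (.rlt (.var 7) (.get 2 (.var 9)))
      (.seq (.rset 7 (.get 2 (.var 9))) (.nset 17 (.var 9))) .skip))

/-- Here `z` is the minimum of the old entry and the new distance. For `i = 0` the old entry is
meaningless and `z` is just the new distance, hence the guards `0 < i`. -/
theorem updateCmd_runs {D : Data} (hD : D.Valid) {s : State} (h : Ctx D s) {i v : ℕ}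
    (hv : v < D.V) (hq : s.narr 3 i < D.V) (h8 : s.nvar 8 = i) (h9 : s.nvar 9 = v) :
    Runs updateCmd s (D.d * 100) fun s' => ∃ z,
      z ≤ D.ptDist (s.narr 3 i) v ∧ (0 < i → z ≤ s.rarr 2 v) ∧
      (D.ptDist (s.narr 3 i) v ≤ z ∨ (0 < i ∧ s.rarr 2 v ≤ z)) ∧
      s'.rarr 2 = Function.update (s.rarr 2) v z ∧
      ((s.rvar 7 < z ∧ s'.rvar 7 = z ∧ s'.nvar 17 = v) ∨
        (z ≤ s.rvar 7 ∧ s'.rvar 7 = s.rvar 7 ∧ s'.nvar 17 = s.nvar 17)) := by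
  have hd := hD.d
  refine Runs.seq (T := D.d * 60) (T' := 40)
    (Q := fun s' => s'.rvar 3 = D.ptDist (s.narr 3 i) v) ?_ ?_ (by omega)
  · refine (distCmd_runs h.d hd (D.pt (s.narr 3 i)) (D.pt v) ?_ ?_).mono ?_ fun _ _ h => h
    · intro s' hf hc
      have hu : NExpr.eval s' (.get 3 (.var 8)) = s.narr 3 i := by
        simp only [NExpr.eval]; rw [hf.nvar 8 rfl, hf.narr 3 rfl, h8]
      rw [eval_inputCoord (h.frame hf rfl) (by rwa [hu]) hc, hu]
    · intro s' hf hc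
      have hu : NExpr.eval s' (.var 9) = v := by
        simp only [NExpr.eval]; rw [hf.nvar 9 rfl, h9]
      rw [eval_inputCoord (h.frame hf rfl) (by rwa [hu]) hc, hu]
    · refine Nat.mul_le_mul_left _ (show _ ≤ _ from ?_)
      decide
  · intro s₁ hf₁ h₁
    have e8 := (hf₁.nvar 8 rfl).trans h8
    have e9 := (hf₁.nvar 9 rfl).trans h9
    have eM := hf₁.rarr 2 rfl
    have e7 := hf₁.rvar 7 rfl
    have e17 := hf₁.nvar 17 rfl
    generalize D.ptDist (s.narr 3 i) v = δ at *
    refine Runs.seq (T := 20) (T' := 20) (Q := fun s' => ∃ z, z ≤ δ ∧ (0 < i → z ≤ s.rarr 2 v) ∧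
      (δ ≤ z ∨ (0 < i ∧ s.rarr 2 v ≤ z)) ∧ s'.rarr 2 = Function.update (s.rarr 2) v z) ?_ ?_ le_rfl
    · refine (Runs.of_run rfl ?_).mono (by decide) fun _ _ h => h
      have hcond : BExpr.holds s₁ (.not (.and (.not (.neq (.var 8) (.const 0)))
          (.not (.rlt (.var 3) (.get 2 (.var 9)))))) ↔ i = 0 ∨ δ < s.rarr 2 v := by
        simp only [BExpr.holds, NExpr.eval, RExpr.eval, e8, e9, eM, h₁]
        tauto
      by_cases hc : i = 0 ∨ δ < s.rarr 2 v
      · refine ⟨δ, le_rfl, fun hi => hc.elim (by omega) le_of_lt, Or.inl le_rfl, ?_⟩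
        rw [Cmd.run, if_pos (hcond.2 hc)]
        simp [Cmd.run, NExpr.eval, RExpr.eval, e9, eM, h₁]
      · have hc' := not_or.1 hc
        refine ⟨s.rarr 2 v, not_lt.1 hc'.2, fun _ => le_rfl,
          Or.inr ⟨Nat.pos_of_ne_zero hc'.1, le_rfl⟩, ?_⟩
        rw [Cmd.run, if_neg (hcond.not.2 hc)]
        simp [Cmd.run, eM]
    · rintro s₂ hf₂ ⟨z, z1, z2, z3, hM⟩
      refine (Runs.of_run rfl ?_).mono (by decide) fun _ _ h => h
      have e9' := (hf₂.nvar 9 rfl).trans e9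
      have e7' := (hf₂.rvar 7 rfl).trans e7
      have e17' := (hf₂.nvar 17 rfl).trans e17
      refine ⟨z, z1, z2, z3, ?_⟩
      by_cases hlt : s.rvar 7 < z
      · simp [Cmd.run, BExpr.holds, NExpr.eval, RExpr.eval, e9', e7', hM, hlt]
      · simp [Cmd.run, BExpr.holds, NExpr.eval, RExpr.eval, e9', e7', e17', hM, hlt, not_lt.1 hlt]

/-- Computes the distances to the nearest chosen vertex, where vertex number `8` is the last one
that was chosen, and chooses the vertex with the largest distance. -/
def chooseCmd : Cmd :=
  .seq (.rset 7 (.sub (.cast (.const 0)) (.cast (.const 1))))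
    (.seq (forLoop 9 (.var 5) updateCmd) (.nstore 3 (.add (.var 8) (.const 1)) (.var 17)))

/-- The first `i + 1` input vertices of a farthest-first traversal are `q 0, …, q i`, and `M v` is
the distance of `v` to the first `i` of them. -/
structure Traversal (D : Data) (i : ℕ) (q : ℕ → ℕ) (M : ℕ → ℝ) : Prop where
  lt : ∀ i' ≤ i, q i' < D.V
  near : 0 < i → ∀ v < D.V, ∃ i' < i, D.ptDist (q i') v ≤ M v
  le : ∀ v < D.V, ∀ i' < i, M v ≤ D.ptDist (q i') v
  sep : ∀ j ≤ i, ∀ i' < j, ∀ v < D.V, M v ≤ D.ptDist (q i') (q j)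
  far : 0 < i → ∀ v < D.V, M v ≤ M (q i)

theorem Data.Valid.V_pos {D : Data} (hD : D.Valid) : 1 ≤ D.V :=
  (Nat.zero_le _).trans_lt (D.start_add_lt (j := 0) (b := 0) hD.m (hD.len 0 hD.m))

/-- The separation is preserved for two reasons. The entries of the distance array only decrease,
which settles the old pairs. The new vertex maximizes the entries, and its own entry is at most its
distance to each earlier vertex. -/
theorem chooseCmd_runs {D : Data} (hD : D.Valid) {s : State} (h : Ctx D s) {i : ℕ}
    (h8 : s.nvar 8 = i) (hT : Traversal D i (s.narr 3) (s.rarr 2)) :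
    Runs chooseCmd s (D.V * (D.d * 150)) fun s' => Traversal D (i + 1) (s'.narr 3) (s'.rarr 2) := by
  have hd := hD.d
  have hV := hD.V_pos
  refine Runs.seq (T := 6) (Q := fun s' => s'.rvar 7 = -1)
    ⟨_, _, .rset s 7 _, le_rfl, by simp [NExpr.eval, RExpr.eval]⟩
    (T' := D.V * (D.d * 130)) ?_ (by nlinarith [Nat.mul_pos hV hd])
  intro s₁ hf₁ h₁
  have H₁ := h.frame hf₁ rfl
  have eq₁ := hf₁.narr 3 rfl
  have eM₁ := hf₁.rarr 2 rfl
  have e8₁ := (hf₁.nvar 8 rfl).trans h8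
  rw [← eq₁, ← eM₁] at hT
  refine Runs.seq (T := D.V * (D.d * 120)) (T' := 5) (Q := fun s' => s'.nvar 17 < D.V ∧
      (∀ v < D.V, s'.rarr 2 v ≤ s'.rarr 2 (s'.nvar 17)) ∧
      ∀ v < D.V, s'.rarr 2 v ≤ D.ptDist (s₁.narr 3 i) v ∧ (0 < i → s'.rarr 2 v ≤ s₁.rarr 2 v) ∧
        (D.ptDist (s₁.narr 3 i) v ≤ s'.rarr 2 v ∨ (0 < i ∧ s₁.rarr 2 v ≤ s'.rarr 2 v))) ?_ ?_
      (by nlinarith [Nat.mul_pos hV hd])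
  · refine Runs.for (n := D.V) (Tb := D.d * 100) (fun v s' =>
      (v = 0 ∧ s'.rvar 7 = -1 ∨ s'.nvar 17 < v ∧ s'.rvar 7 = s'.rarr 2 (s'.nvar 17) ∧
        ∀ u < v, s'.rarr 2 u ≤ s'.rvar 7) ∧
      (∀ u, v ≤ u → s'.rarr 2 u = s₁.rarr 2 u) ∧
      ∀ u < v, s'.rarr 2 u ≤ D.ptDist (s₁.narr 3 i) u ∧ (0 < i → s'.rarr 2 u ≤ s₁.rarr 2 u) ∧
        (D.ptDist (s₁.narr 3 i) u ≤ s'.rarr 2 u ∨ (0 < i ∧ s₁.rarr 2 u ≤ s'.rarr 2 u)))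
      hV rfl ?_ ?_ ?_ ?_ ?_
    · intro s' hf
      simp only [NExpr.eval]
      rw [hf.nvar 5 rfl, H₁.V]
    · exact ⟨Or.inl ⟨rfl, h₁⟩, fun u _ => rfl, fun u hu => absurd hu (by omega)⟩
    · intro v hv s₂ hf₂ h9 ⟨hb, hge, hlt⟩
      have H₂ := H₁.frame hf₂ rfl
      have eq₂ := hf₂.narr 3 rfl
      refine (updateCmd_runs hD H₂ hv (by rw [eq₂]; exact hT.lt i le_rfl)
        ((hf₂.nvar 8 rfl).trans e8₁) h9).mono le_rfl ?_
      rintro s₃ - ⟨z, z1, z2, z3, hM, hz⟩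
      rw [eq₂, hge v le_rfl] at *
      -- Nonnegativity makes the first vertex beat the initial maximum `-1`, so variable `17` always
      -- receives a valid index.
      have hz0 : 0 ≤ z := by
        rcases z3 with z3 | ⟨hi, z3⟩
        · exact (rawDist_nonneg _ _ _).trans z3
        · obtain ⟨i', _, hle⟩ := hT.near hi v hv
          exact (rawDist_nonneg _ _ _).trans (hle.trans z3)
      simp only [State.setN_rvar, State.setN_rarr, State.setN_nvar, hM]
      norm_num
      refine ⟨?_, fun u hu => ?_, fun u hu => ?_⟩
      · rcases hz with ⟨hz1, hz2, hz3⟩ | ⟨hz1, hz2, hz3⟩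
        · refine ⟨by omega, by rw [hz2, hz3]; simp, fun u hu => ?_⟩
          rcases Nat.lt_or_eq_of_le hu with hu | rfl
          · rw [Function.update_of_ne (by omega), hz2]
            rcases hb with hb | hb
            · omega
            · exact (hb.2.2 u hu).trans hz1.le
          · simp [hz2]
        · rcases hb with hb | hb
          · linarith [hb.2]
          · refine ⟨by omega, ?_, fun u hu => ?_⟩
            · rw [hz2, hz3, Function.update_of_ne (by omega), hb.2.1]
            · rcases Nat.lt_or_eq_of_le hu with hu | rfl
              · rw [Function.update_of_ne (by omega), hz2]
                exact hb.2.2 u hu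
              · simpa [hz2] using hz1
      · rw [Function.update_of_ne (by omega), hge u (by omega)]
      · rcases Nat.lt_or_eq_of_le hu with hu | rfl
        · rw [Function.update_of_ne (by omega)]
          exact hlt u hu
        · simp only [Function.update_self]
          exact ⟨z1, z2, z3⟩
    · rintro s' - ⟨hb, -, hlt⟩
      rcases hb with hb | hb
      · omega
      · exact ⟨hb.1, fun v hv => hb.2.1 ▸ hb.2.2 v hv, hlt⟩
    · refine Nat.mul_le_mul_left _ ?_
      simp only [NExpr.time]
      omega
  · intro s₂ hf₂ ⟨hlt, hmax, hI⟩
    refine (Runs.of_run rfl ?_).mono (by decide) fun _ _ h => h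
    have e8₂ := (hf₂.nvar 8 rfl).trans e8₁
    have eq₂ := hf₂.narr 3 rfl
    simp only [Cmd.run, NExpr.eval, e8₂, eq₂, Function.update_self]
    generalize s₂.nvar 17 = x at *
    generalize s₁.narr 3 = q at *
    generalize s₁.rarr 2 = M at *
    generalize s₂.rarr 2 = M' at *
    have hq : ∀ i' ≤ i, Function.update q (i + 1) x i' = q i' := fun i' hi' =>
      Function.update_of_ne (by omega) _ _
    have hle : ∀ v < D.V, ∀ i' < i + 1, M' v ≤ D.ptDist (q i') v := by
      intro v hv i' hi'
      rcases Nat.lt_succ_iff_lt_or_eq.1 hi' with hi' | rfl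
      · exact ((hI v hv).2.1 (by omega)).trans (hT.le v hv i' hi')
      · exact (hI v hv).1
    refine ⟨fun i' hi' => ?_, fun _ v hv => ?_, fun v hv i' hi' => ?_, fun j hj i' hi' v hv => ?_,
      fun _ v hv => ?_⟩
    · rcases Nat.le_succ_iff.1 hi' with hi' | rfl
      · rw [hq i' hi']; exact hT.lt i' hi'
      · simpa using hlt
    · rcases (hI v hv).2.2 with hle | ⟨hi, hle⟩
      · exact ⟨i, by omega, by rwa [hq i le_rfl]⟩
      · obtain ⟨i', hi', hn⟩ := hT.near hi v hv
        exact ⟨i', by omega, by rw [hq i' hi'.le]; exact hn.trans hle⟩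
    · rw [hq i' (by omega)]
      exact hle v hv i' hi'
    · rw [hq i' (by omega)]
      rcases Nat.le_succ_iff.1 hj with hj | rfl
      · rw [hq j hj]
        exact ((hI v hv).2.1 (by omega)).trans (hT.sep j hj i' hi' v hv)
      · simp only [Function.update_self]
        exact (hmax v hv).trans (hle x hlt i' hi')
    · simpa using hmax v hv

/-- Chooses input vertices by a farthest-first traversal. -/
def traversalCmd : Cmd := forLoop 8 (.var 4) chooseCmd

theorem traversalCmd_runs {D : Data} (hD : D.Valid) {s : State} (h : Ctx D s)
    (h0 : s.narr 3 0 = 0) :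
    Runs traversalCmd s (D.kl * (D.V * (D.d * 170))) fun s' =>
      Traversal D D.kl (s'.narr 3) (s'.rarr 2) := by
  have hV := hD.V_pos
  refine Runs.for (n := D.kl) (Tb := D.V * (D.d * 150))
    (fun i s' => Traversal D i (s'.narr 3) (s'.rarr 2)) hD.kl rfl ?_ ?_ ?_ (fun _ _ h => h) ?_
  · intro s' hf
    simp only [NExpr.eval]
    rw [hf.nvar 4 rfl, h.kl]
  -- Input vertex `0` is the arbitrary starting point; every other condition is vacuous.
  · refine ⟨fun i' hi' => ?_, fun h => absurd h (by omega), fun v _ i' h => absurd h (by omega),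
      fun j hj i' hi' => absurd hi' (by omega), fun h => absurd h (by omega)⟩
    obtain rfl : i' = 0 := by omega
    simp only [State.setN_narr, h0]
    exact hV
  · intro i hi s' hf h8 hT
    exact chooseCmd_runs hD (h.frame hf rfl) h8 hT
  · refine Nat.mul_le_mul_left _ ?_
    have := Nat.mul_pos hV hD.d
    simp only [NExpr.time]
    nlinarith

/-! ### The whole program -/

/-- Sets up the memory contents that are described by `Ctx`. -/
def setupCmd : Cmd :=
  .seq (forLoop 8 (.var 2) (.nset 4 (.add (.var 4) (.var 3))))
  (.seq (forLoop 8 (.var 1) (.nset 5 (.add (.var 5) (.get 0 (.var 8)))))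
  (.seq (forLoop 8 (.add (.var 5) (.var 4))
      (.nstore 2 (.add (.var 8) (.const 1)) (.add (.get 2 (.var 8)) (.var 0))))
  (.seq (.nset 7 (.add (.var 4) (.get 2 (.var 4))))
  (.seq (.while (.rlt (.mul (.cast (.var 6)) (.var 0))
        (.mul (.cast (.const 5)) (.sqrt (.cast (.var 0)))))
      (.nset 6 (.add (.var 6) (.const 1))))
  (.seq (forLoop 8 (.var 4) (.nstore 5 (.var 8) (.var 4)))
  (.seq (forLoop 8 (.get 2 (.var 4)) (.nstore 5 (.add (.var 4) (.var 8)) (.var 6)))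
    (forLoop 8 (.var 2) (.nstore 1 (.var 8) (.var 3)))))))))

/-- The memory before the setup. -/
structure Initial (D : Data) (ε : ℝ) (s : State) : Prop where
  d : s.nvar 0 = D.d
  m : s.nvar 1 = D.m
  k : s.nvar 2 = D.k
  ℓ : s.nvar 3 = D.ℓ
  n4 : s.nvar 4 = 0
  n5 : s.nvar 5 = 0
  n6 : s.nvar 6 = 0
  ε : s.rvar 0 = ε
  len : ∀ j < D.m, s.narr 0 j = D.len j
  off : s.narr 2 0 = 0
  pt : ∀ v < D.V, ∀ c < D.d, s.rarr 0 (v * D.d + c) = D.pt v c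

/-- Products of naturals are formed by repeated addition. The grid size, a rounded-up real, is found
by counting up until `5√d ≤ Nε`, because there is no rounding; this costs `O(N)` time, hence the
term `D.N`. -/
theorem setupCmd_runs {D : Data} (hD : D.Valid) {ε : ℝ} {s : State} (h : Initial D ε s)
    (hN : ∀ i : ℕ, (i : ℝ) * ε < 5 * √(D.d : ℝ) ↔ i < D.N) :
    Runs setupCmd s (300 * (D.k + D.m + D.V + D.kl * D.d + D.N)) (Ctx D) := by
  have hkl := hD.kl
  have hV := hD.V_pos
  have hkd : 1 ≤ D.kl * D.d := Nat.mul_pos hkl hD.d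
  have hkkd : D.kl ≤ D.kl * D.d := Nat.le_mul_of_pos_right _ hD.d
  have hk := hD.k
  have hm := hD.m
  have hNp := hD.N
  refine Runs.seq (T := D.k * 20) (Q := fun s' => s'.nvar 4 = D.kl) (T' := 200 *
    (D.k + D.m + D.V + D.kl * D.d + D.N)) ?_ ?_ (by omega)
  · refine Runs.for (n := D.k) (Tb := 4) (fun i s' => s'.nvar 4 = i * D.ℓ) hk rfl ?_
      (by simp [h.n4]) ?_ (fun _ _ h => h) (by simp only [NExpr.time]; omega)
    · intro s' hf
      simp only [NExpr.eval]
      rw [hf.nvar 2 rfl, h.k]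
    · intro i hi s' hf h8 hI
      refine (Runs.of_run rfl ?_).mono (by decide) fun _ _ h => h
      have := (hf.nvar 3 rfl).trans h.ℓ
      simp [Cmd.run, NExpr.eval, hI, this, add_mul]
  intro s₁ hf₁ h4
  refine Runs.seq (T := D.m * 21) (Q := fun s' => s'.nvar 5 = D.V) (T' := 179 *
    (D.k + D.m + D.V + D.kl * D.d + D.N)) ?_ ?_ (by omega)
  · refine Runs.for (n := D.m) (Tb := 5) (fun i s' => s'.nvar 5 = D.start i) hm rfl ?_
      (by simp [hf₁.nvar 5 rfl, h.n5, Data.start]) ?_ (fun _ _ h => h)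
      (by simp only [NExpr.time]; omega)
    · intro s' hf
      simp only [NExpr.eval]
      rw [hf.nvar 1 rfl, hf₁.nvar 1 rfl, h.m]
    · intro i hi s' hf h8 hI
      refine (Runs.of_run rfl ?_).mono (by decide) fun _ _ h => h
      have := h.len i hi
      rw [← hf₁.narr 0 rfl, ← hf.narr 0 rfl] at this
      simp [Cmd.run, NExpr.eval, hI, h8, this, D.start_succ]
  intro s₂ hf₂ h5
  have e4 := (hf₂.nvar 4 rfl).trans h4
  refine Runs.seq (T := (D.V + D.kl) * 26) (Q := fun s' => ∀ v ≤ D.V + D.kl, s'.narr 2 v = v * D.d)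
    (T' := 150 * (D.k + D.m + D.V + D.kl * D.d + D.N)) ?_ ?_ (by omega)
  · refine Runs.for (n := D.V + D.kl) (Tb := 8) (fun i s' => ∀ v ≤ i, s'.narr 2 v = v * D.d)
      (by omega) rfl ?_ ?_ ?_ (fun _ _ h => h) (by simp [NExpr.time])
    · intro s' hf
      simp only [NExpr.eval]
      rw [hf.nvar 5 rfl, hf.nvar 4 rfl, h5, e4]
    · intro v hv
      obtain rfl : v = 0 := by omega
      simp [hf₂.narr 2 rfl, hf₁.narr 2 rfl, h.off]
    · intro i hi s' hf h8 hI
      refine (Runs.of_run rfl ?_).mono (by decide) fun _ _ h => h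
      have := (hf.nvar 0 rfl).trans ((hf₂.nvar 0 rfl).trans ((hf₁.nvar 0 rfl).trans h.d))
      intro v hv
      simp only [Cmd.run, NExpr.eval, h8, this, hI i le_rfl, State.setN_narr, Function.update_self]
      rcases Nat.le_succ_iff.1 hv with hv | rfl
      · rw [Function.update_of_ne (by omega), hI v hv]
      · simp [add_mul]
  intro s₃ hf₃ hoff
  have e4₃ := (hf₃.nvar 4 rfl).trans e4
  refine Runs.seq (T := 5) (Q := fun s' => s'.nvar 7 = D.digits) ⟨_, _, .nset s₃ 7 _, le_rfl, ?_⟩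
    (T' := 145 * (D.k + D.m + D.V + D.kl * D.d + D.N)) ?_ (by omega)
  · simp [NExpr.eval, e4₃, hoff, Data.digits]
  intro s₄ hf₄ h7
  have e0 : s₄.nvar 0 = D.d := (hf₄.nvar 0 rfl).trans ((hf₃.nvar 0 rfl).trans
    ((hf₂.nvar 0 rfl).trans ((hf₁.nvar 0 rfl).trans h.d)))
  have eε : s₄.rvar 0 = ε := (hf₄.rvar 0 rfl).trans ((hf₃.rvar 0 rfl).trans
    ((hf₂.rvar 0 rfl).trans ((hf₁.rvar 0 rfl).trans h.ε)))
  have e6 : s₄.nvar 6 = 0 := (hf₄.nvar 6 rfl).trans ((hf₃.nvar 6 rfl).trans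
    ((hf₂.nvar 6 rfl).trans ((hf₁.nvar 6 rfl).trans h.n6)))
  refine Runs.seq (T := D.N * 20 + 20) (Q := fun s' => s'.nvar 6 = D.N)
    (T' := 100 * (D.k + D.m + D.V + D.kl * D.d + D.N)) ?_ ?_ (by omega)
  · have hcond : ∀ s' : State, s'.nvar 0 = D.d → s'.rvar 0 = ε →
        (BExpr.holds s' (.rlt (.mul (.cast (.var 6)) (.var 0))
        (.mul (.cast (.const 5)) (.sqrt (.cast (.var 0))))) ↔ s'.nvar 6 < D.N) := by
      intro s' h0 hε
      rw [← hN]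
      simp [BExpr.holds, RExpr.eval, NExpr.eval, h0, hε]
    refine Runs.while (Tb := 4) (fun s' => s'.nvar 6 ≤ D.N) (fun s' => D.N - s'.nvar 6)
      (by omega) ?_ ?_ ?_
    · intro s' hf hle hb
      rw [hcond s' ((hf.nvar 0 rfl).trans e0) ((hf.rvar 0 rfl).trans eε)] at hb
      refine (Runs.of_run rfl ?_).mono (by decide) fun _ _ h => h
      simp only [Cmd.run, NExpr.eval, Function.update_self]
      omega
    · intro s' hf hle hb
      rw [hcond s' ((hf.nvar 0 rfl).trans e0) ((hf.rvar 0 rfl).trans eε)] at hb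
      omega
    · simp only [e6, BExpr.time, RExpr.time, NExpr.time]
      omega
  intro s₅ hf₅ h6
  have e4₅ : s₅.nvar 4 = D.kl := (hf₅.nvar 4 rfl).trans ((hf₄.nvar 4 rfl).trans e4₃)
  refine Runs.seq (T := D.kl * 17) (Q := fun s' => ∀ p < D.kl, s'.narr 5 p = D.kl)
    (T' := 80 * (D.k + D.m + D.V + D.kl * D.d + D.N)) ?_ ?_ (by omega)
  · refine Runs.for (n := D.kl) (Tb := 3) (fun i s' => ∀ p < i, s'.narr 5 p = D.kl)
      hkl rfl ?_ (by simp) ?_ (fun _ _ h => h) (by simp [NExpr.time])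
    · intro s' hf
      simp only [NExpr.eval]
      rw [hf.nvar 4 rfl, e4₅]
    · intro i hi s' hf h8 hI
      refine (Runs.of_run rfl ?_).mono (by decide) fun _ _ h => h
      have := (hf.nvar 4 rfl).trans e4₅
      intro p hp
      simp only [Cmd.run, NExpr.eval, h8, this, State.setN_narr, Function.update_self]
      rcases Nat.lt_succ_iff_lt_or_eq.1 hp with hp | rfl
      · rw [Function.update_of_ne (by omega), hI p hp]
      · simp
  intro s₆ hf₆ hb₁
  have e4₆ := (hf₆.nvar 4 rfl).trans e4₅
  have e6₆ := (hf₆.nvar 6 rfl).trans h6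
  have eoff : s₆.narr 2 = s₃.narr 2 := (hf₆.narr 2 rfl).trans ((hf₅.narr 2 rfl).trans
    (hf₄.narr 2 rfl))
  refine Runs.seq (T := D.kl * D.d * 21) (Q := fun s' => (∀ p < D.kl, s'.narr 5 p = D.kl) ∧
    ∀ p < D.kl * D.d, s'.narr 5 (D.kl + p) = D.N)
    (T' := 50 * (D.k + D.m + D.V + D.kl * D.d + D.N)) ?_ ?_ (by omega)
  · refine Runs.for (n := D.kl * D.d) (Tb := 5) (fun i s' => (∀ p < D.kl, s'.narr 5 p = D.kl) ∧
      ∀ p < i, s'.narr 5 (D.kl + p) = D.N)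
      hkd rfl ?_ (by simpa using hb₁) ?_ (fun _ _ h => h) (by simp [NExpr.time])
    · intro s' hf
      simp only [NExpr.eval]
      rw [hf.narr 2 rfl, hf.nvar 4 rfl, e4₆, eoff, hoff _ (by omega)]
    · intro i hi s' hf h8 ⟨hI₁, hI₂⟩
      refine (Runs.of_run rfl ?_).mono (by decide) fun _ _ h => h
      have e4' := (hf.nvar 4 rfl).trans e4₆
      have e6' := (hf.nvar 6 rfl).trans e6₆
      simp only [Cmd.run, NExpr.eval, h8, e4', e6', State.setN_narr, Function.update_self]
      refine ⟨fun p hp => ?_, fun p hp => ?_⟩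
      · rw [Function.update_of_ne (by omega), hI₁ p hp]
      · rcases Nat.lt_succ_iff_lt_or_eq.1 hp with hp | rfl
        · rw [Function.update_of_ne (by omega), hI₂ p hp]
        · simp
  intro s₇ hf₇ ⟨hb₂, hb₃⟩
  have e2 : s₇.nvar 2 = D.k := (hf₇.nvar 2 rfl).trans ((hf₆.nvar 2 rfl).trans
    ((hf₅.nvar 2 rfl).trans ((hf₄.nvar 2 rfl).trans ((hf₃.nvar 2 rfl).trans
    ((hf₂.nvar 2 rfl).trans ((hf₁.nvar 2 rfl).trans h.k))))))
  have e3 : s₇.nvar 3 = D.ℓ := (hf₇.nvar 3 rfl).trans ((hf₆.nvar 3 rfl).trans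
    ((hf₅.nvar 3 rfl).trans ((hf₄.nvar 3 rfl).trans ((hf₃.nvar 3 rfl).trans
    ((hf₂.nvar 3 rfl).trans ((hf₁.nvar 3 rfl).trans h.ℓ))))))
  refine Runs.for (n := D.k) (Tb := 3) (fun i s' => ∀ p < i, s'.narr 1 p = D.ℓ)
    hk rfl ?_ (by simp) ?_ ?_ (by simp only [NExpr.time]; omega)
  · intro s' hf
    simp only [NExpr.eval]
    rw [hf.nvar 2 rfl, e2]
  · intro i hi s' hf h8 hI
    refine (Runs.of_run rfl ?_).mono (by decide) fun _ _ h => h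
    have := (hf.nvar 3 rfl).trans e3
    intro p hp
    simp only [Cmd.run, NExpr.eval, h8, this, State.setN_narr, Function.update_self]
    rcases Nat.lt_succ_iff_lt_or_eq.1 hp with hp | rfl
    · rw [Function.update_of_ne (by omega), hI p hp]
    · simp
  · intro s₈ hf₈ hout
    refine ⟨?_, ?_, (hf₈.nvar 2 rfl).trans e2, (hf₈.nvar 3 rfl).trans e3,
      (hf₈.nvar 4 rfl).trans ((hf₇.nvar 4 rfl).trans e4₆), ?_,
      (hf₈.nvar 6 rfl).trans ((hf₇.nvar 6 rfl).trans e6₆), ?_, ?_, hout, ?_, ?_, ?_⟩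
    · rw [hf₈.nvar 0 rfl, hf₇.nvar 0 rfl, hf₆.nvar 0 rfl, hf₅.nvar 0 rfl, e0]
    · rw [hf₈.nvar 1 rfl, hf₇.nvar 1 rfl, hf₆.nvar 1 rfl, hf₅.nvar 1 rfl, hf₄.nvar 1 rfl,
        hf₃.nvar 1 rfl, hf₂.nvar 1 rfl, hf₁.nvar 1 rfl, h.m]
    · rw [hf₈.nvar 5 rfl, hf₇.nvar 5 rfl, hf₆.nvar 5 rfl, hf₅.nvar 5 rfl, hf₄.nvar 5 rfl,
        hf₃.nvar 5 rfl, h5]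
    · rw [hf₈.nvar 7 rfl, hf₇.nvar 7 rfl, hf₆.nvar 7 rfl, hf₅.nvar 7 rfl, h7]
    · rw [hf₈.narr 0 rfl, hf₇.narr 0 rfl, hf₆.narr 0 rfl, hf₅.narr 0 rfl, hf₄.narr 0 rfl,
        hf₃.narr 0 rfl, hf₂.narr 0 rfl, hf₁.narr 0 rfl]
      exact h.len
    · rw [hf₈.narr 2 rfl, hf₇.narr 2 rfl, eoff]
      exact hoff
    · intro p hp
      rw [hf₈.narr 5 rfl, Data.base]
      split_ifs with hlt
      · exact hb₂ p hlt
      · have := hb₃ (p - D.kl) (by unfold Data.digits at hp; omega)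
        rwa [Nat.add_sub_cancel' (not_lt.1 hlt)] at this
    · rw [hf₈.rarr 0 rfl, hf₇.rarr 0 rfl, hf₆.rarr 0 rfl, hf₅.rarr 0 rfl, hf₄.rarr 0 rfl,
        hf₃.rarr 0 rfl, hf₂.rarr 0 rfl, hf₁.rarr 0 rfl]
      exact h.pt

/-! ### The four passes of the search -/

/-- Enumerates four sets of candidate solutions: first those with vertices in the traversal, then
those in grids of decreasing size, according to the cost of the best solution of the first kind. -/
def searchCmd : Cmd :=
  .seq (.rset 2 (.sub (.cast (.const 0)) (.cast (.const 1)))) (forLoop 18 (.const 4)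
    (.seq passCmd (.ite (.neq (.var 18) (.const 0)) (.rset 1 (.var 2))
      (.rset 1 (.mul (.var 1) (.div (.cast (.const 3)) (.cast (.const 5))))))))

/-- The cost `x` is at most `r`, and `r` is at most the cost of every candidate solution with
vertices among the points `q 0, …, q (kℓ - 1)`. -/
structure Searched (D : Data) (q : ℕ → ℕ) (r : ℝ) (x : ℝ) : Prop where
  nonneg : 0 ≤ r
  first : ∀ e, D.IsDigits e → r ≤ D.cost (D.cand q e 0)
  le : x ≤ r

/-- With size `0` the grid digits are irrelevant and all candidates have their vertices in the
traversal; the best cost of this pass is `r`. The later passes use the sizes `r`, `3r/5`, `9r/25`,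
and the stored cost never increases. -/
theorem searchCmd_runs {D : Data} (hD : D.Valid) {n : ℕ} (hn : ∀ j < D.m, D.len j ≤ n)
    {q : ℕ → ℕ} {s : State} (h : CandCtx D q (fun _ => 0) 0 s) :
    Runs searchCmd s (D.weight D.digits * (D.m * (D.k * (n * (D.ℓ * (D.d * 4300)))))) fun s' =>
      (∃ Y, Recorded D Y s') ∧ Ctx D s' ∧ ∃ r, Searched D q r (s'.rvar 2) ∧
        ∀ i < 3, ∀ e, D.IsDigits e → s'.rvar 2 ≤ D.cost (D.cand q e (r * (3 / 5) ^ i)) := by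
  have hn1 : 1 ≤ n := (hD.len 0 hD.m).trans (hn 0 hD.m)
  have hB : 1 ≤ D.weight D.digits * (D.m * (D.k * (n * (D.ℓ * D.d)))) :=
    Nat.mul_pos (Finset.prod_pos fun i _ => hD.base_pos i)
     (Nat.mul_pos hD.m (Nat.mul_pos hD.k (Nat.mul_pos hn1 (Nat.mul_pos hD.ℓ hD.d))))
  refine Runs.seq (T := 6) (Q := fun s' => s'.rvar 2 = -1)
    ⟨_, _, .rset s 2 _, le_rfl, by simp [NExpr.eval, RExpr.eval]⟩
    (T' := D.weight D.digits * (D.m * (D.k * (n * (D.ℓ * (D.d * 4290)))))) ?_ (by nlinarith)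
  intro s₁ hf₁ h₁
  have H₁ := h.frame hf₁ rfl
  refine Runs.for (n := 4)
    (Tb := D.weight D.digits * (D.m * (D.k * (n * (D.ℓ * (D.d * 1020))))) + 20)
    (fun i s' => ∃ w, CandCtx D q (fun _ => 0) w s' ∧
      (i = 0 ∧ w = 0 ∧ s'.rvar 2 = -1 ∨ (∃ Y, Recorded D Y s') ∧ ∃ r, Searched D q r (s'.rvar 2) ∧
        ∃ i', i = i' + 1 ∧ w = r * (3 / 5) ^ i' ∧ ∀ i < i', ∀ e, D.IsDigits e →
          s'.rvar 2 ≤ D.cost (D.cand q e (r * (3 / 5) ^ i))))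
    (by norm_num) rfl (fun _ _ => rfl) ?_ ?_ ?_ ?_
  · exact ⟨0, H₁.frame (Exec.nset s₁ 18 (.const 0)).frame rfl, Or.inl ⟨rfl, rfl, h₁⟩⟩
  · intro i hi s₂ hf₂ h18 ⟨w, H₂, hI⟩
    have hst : Started D s₂ := by
      rcases hI with ⟨-, -, hI⟩ | ⟨hI, -⟩
      · exact Or.inl (by rw [hI]; norm_num)
      · exact Or.inr hI
    refine (passCmd_runs hD hn H₂ hst).seq (T' := 20) ?_ le_rfl
    rintro s₃ hf₃ ⟨⟨Y, hY⟩, hle, H₃, hopt⟩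
    have e18 := (hf₃.nvar 18 rfl).trans h18
    refine (Runs.of_run rfl ?_).mono (by decide) fun s₄ hf₄ h => h
    have hpos : 0 ≤ s₃.rvar 2 := hY.cost ▸ runMax_nonneg _ _
    have key : ∀ x, CandCtx D q (fun _ => 0) x
        (State.setN { s₃ with rvar := Function.update s₃.rvar 1 x } 18 (i + 1)) := by
      intro x
      refine ⟨?_, by simpa using H₃.q_eq, by simpa using H₃.e_eq, by simp, H₃.q_lt, H₃.isDigits⟩
      refine ⟨?_, ?_, ?_, ?_, ?_, ?_, ?_, ?_, H₃.len, H₃.out, H₃.off, H₃.base, H₃.pt⟩ <;>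
        simp [H₃.d, H₃.m, H₃.k, H₃.ℓ, H₃.kl, H₃.V, H₃.N, H₃.digits]
    rcases hI with ⟨rfl, rfl, hI⟩ | ⟨⟨Y', hY'⟩, r, hr, i', rfl, rfl, hI⟩
    · refine ⟨s₃.rvar 2, ?_, Or.inr ⟨⟨Y, ?_⟩, s₃.rvar 2, ?_, 0, rfl, by simp, by simp⟩⟩
      · simpa [Cmd.run, BExpr.holds, NExpr.eval, e18, RExpr.eval] using key (s₃.rvar 2)
      · refine hY.congr ?_ ?_ <;> simp [Cmd.run, BExpr.holds, NExpr.eval, e18, RExpr.eval]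
      · exact ⟨hpos, hopt, by simp [Cmd.run, BExpr.holds, NExpr.eval, e18, RExpr.eval]⟩
    · have e2' : ((Cmd.ite (.neq (.var 18) (.const 0)) (.rset 1 (.var 2))
          (.rset 1 (.mul (.var 1) (.div (.cast (.const 3)) (.cast (.const 5)))))).run s₃) =
          { s₃ with rvar := Function.update s₃.rvar 1 (r * (3 / 5) ^ (i' + 1)) } := by
        simp [Cmd.run, BExpr.holds, NExpr.eval, e18, RExpr.eval, H₃.b_eq, pow_succ, mul_assoc]
      rw [e2']
      have hle' : s₃.rvar 2 ≤ s₂.rvar 2 := by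
        rcases hle with hle | hle
        · have : 0 ≤ s₂.rvar 2 := by rw [hY'.cost]; exact runMax_nonneg _ _
          linarith
        · exact hle
      refine ⟨_, key _, Or.inr ⟨⟨Y, ?_⟩, r, ?_, i' + 1, rfl, rfl, ?_⟩⟩
      · exact hY.congr (by simp) (by simp)
      · exact ⟨hr.nonneg, hr.first, by simpa using hle'.trans hr.le⟩
      · intro i hi e he
        simp only [State.setN_rvar, ne_eq, OfNat.ofNat_ne_one, not_false_eq_true,
          Function.update_of_ne]
        rcases Nat.lt_succ_iff_lt_or_eq.1 hi with hi | rfl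
        · exact hle'.trans (hI i hi e he)
        · exact hopt e he
  · rintro s' - ⟨w, H, hI⟩
    rcases hI with ⟨hI, -⟩ | ⟨hY, r, hr, i', hi', -, hI⟩
    · omega
    · obtain rfl : i' = 3 := by omega
      exact ⟨hY, H.toCtx, r, hr, hI⟩
  · simp only [NExpr.time]
    nlinarith

/-- The approximation algorithm. -/
def centerCmd : Cmd := .seq setupCmd (.seq traversalCmd searchCmd)

theorem centerCmd_runs {D : Data} (hD : D.Valid) {n : ℕ} (hn : ∀ j < D.m, D.len j ≤ n) {ε : ℝ}
    {s : State} (h : Initial D ε s) (hN : ∀ i : ℕ, (i : ℝ) * ε < 5 * √(D.d : ℝ) ↔ i < D.N)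
    (h3 : s.narr 3 0 = 0) (h4 : s.narr 4 = fun _ => 0) (h1 : s.rvar 1 = 0) :
    Runs centerCmd s (300 * (D.k + D.m + D.V + D.kl * D.d + D.N) + D.kl * (D.V * (D.d * 170)) +
        D.weight D.digits * (D.m * (D.k * (n * (D.ℓ * (D.d * 4300)))))) fun s' =>
      (∃ Y, Recorded D Y s') ∧ Ctx D s' ∧ ∃ q M r, Traversal D D.kl q M ∧
        Searched D q r (s'.rvar 2) ∧
        ∀ i < 3, ∀ e, D.IsDigits e → s'.rvar 2 ≤ D.cost (D.cand q e (r * (3 / 5) ^ i)) := by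
  refine (setupCmd_runs hD h hN).seq (T' := _) ?_ (add_assoc _ _ _).ge
  intro s₁ hf₁ H₁
  refine (traversalCmd_runs hD H₁ (by rw [hf₁.narr 3 rfl, h3])).seq (T' := _) ?_ le_rfl
  intro s₂ hf₂ hT
  refine (searchCmd_runs hD hn (q := s₂.narr 3) ⟨H₁.frame hf₂ rfl, rfl, ?_, ?_,
    fun u hu => hT.lt u hu.le, hD.isDigits_zero⟩).mono le_rfl ?_
  · rw [hf₂.narr 4 rfl, hf₁.narr 4 rfl, h4]
  · rw [hf₂.rvar 1 rfl, hf₁.rvar 1 rfl, h1]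
  · rintro s₃ - ⟨hY, hC, r, hr, hopt⟩
    exact ⟨hY, hC, _, _, r, hT, hr, hopt⟩

end RealRAM

/-! ### The discrete Fréchet distance and dynamic programming -/

namespace RealRAM

theorem frechetRec_self_le (D : ℕ → ℕ → ℝ) (a b : ℕ) : D a b ≤ frechetRec D a b := by
  cases a <;> cases b <;> simp [frechetRec]

/-- The recursion uses only `max` and `min`, which are monotone and commute with adding a constant.
This is the stability of the Fréchet distance under moving vertices. -/
theorem frechetRec_le_add {D D' : ℕ → ℕ → ℝ} {δ : ℝ} {a b : ℕ}
    (h : ∀ a' ≤ a, ∀ b' ≤ b, D a' b' ≤ D' a' b' + δ) :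
    frechetRec D a b ≤ frechetRec D' a b + δ := by
  induction a, b using frechetRec.induct with
  | case1 => simpa [frechetRec] using h 0 le_rfl 0 le_rfl
  | case2 b ih =>
    have h1 := h 0 le_rfl (b + 1) le_rfl
    have h2 := ih fun a' ha b' hb => h a' ha b' (by omega)
    rw [frechetRec, frechetRec, ← max_add_add_right]
    exact max_le_max h1 h2
  | case3 a ih =>
    have h1 := h (a + 1) le_rfl 0 le_rfl
    have h2 := ih fun a' ha b' hb => h a' (by omega) b' hb
    rw [frechetRec, frechetRec, ← max_add_add_right]
    exact max_le_max h1 h2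
  | case4 a b ih1 ih2 ih3 =>
    have h1 := h (a + 1) le_rfl (b + 1) le_rfl
    have i1 := ih1 fun a' ha b' hb => h a' (by omega) b' (by omega)
    have i2 := ih2 fun a' ha b' hb => h a' (by omega) b' (by omega)
    have i3 := ih3 fun a' ha b' hb => h a' (by omega) b' (by omega)
    rw [frechetRec, frechetRec, ← max_add_add_right, ← min_add_add_right, ← min_add_add_right]
    exact max_le_max h1 (min_le_min (min_le_min i1 i2) i3)

theorem frechetRec_congr {D D' : ℕ → ℕ → ℝ} {a b : ℕ}
    (h : ∀ a' ≤ a, ∀ b' ≤ b, D a' b' = D' a' b') : frechetRec D a b = frechetRec D' a b :=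
  le_antisymm
    (by simpa using frechetRec_le_add (δ := 0) fun a' ha b' hb => by simp [h a' ha b' hb])
    (by simpa using frechetRec_le_add (δ := 0) fun a' ha b' hb => by simp [h a' ha b' hb])

/-- An optimal warping path passes through every index of the first curve, and each of its pairs
costs at most the bottleneck value. -/
theorem exists_le_frechetRec_of_le_left (D : ℕ → ℕ → ℝ) (a b : ℕ) :
    ∀ a' ≤ a, ∃ b' ≤ b, D a' b' ≤ frechetRec D a b := by
  induction a, b using frechetRec.induct with
  | case1 =>
    intro a' ha
    obtain rfl : a' = 0 := by omega
    exact ⟨0, le_rfl, frechetRec_self_le _ _ _⟩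
  | case2 b ih =>
    intro a' ha
    obtain ⟨b', hb, h⟩ := ih a' ha
    exact ⟨b', by omega, by rw [frechetRec]; exact h.trans (le_max_right _ _)⟩
  | case3 a ih =>
    intro a' ha
    rcases Nat.le_succ_iff.1 ha with ha | rfl
    · obtain ⟨b', hb, h⟩ := ih a' ha
      exact ⟨b', by omega, by rw [frechetRec]; exact h.trans (le_max_right _ _)⟩
    · exact ⟨0, le_rfl, frechetRec_self_le _ _ _⟩
  | case4 a b ih1 ih2 ih3 =>
    intro a' ha
    rcases Nat.le_succ_iff.1 ha with ha | rfl
    · obtain ⟨b1, hb1, h1⟩ := ih1 a' ha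
      obtain ⟨b2, hb2, h2⟩ := ih2 a' (by omega)
      obtain ⟨b3, hb3, h3⟩ := ih3 a' ha
      rw [frechetRec]
      rcases min_choice (min (frechetRec D a (b + 1)) (frechetRec D (a + 1) b)) (frechetRec D a b)
        with h | h <;> rw [h]
      · rcases min_choice (frechetRec D a (b + 1)) (frechetRec D (a + 1) b) with h | h <;> rw [h]
        · exact ⟨b1, hb1, h1.trans (le_max_right _ _)⟩
        · exact ⟨b2, by omega, h2.trans (le_max_right _ _)⟩
      · exact ⟨b3, by omega, h3.trans (le_max_right _ _)⟩
    · exact ⟨b + 1, le_rfl, frechetRec_self_le _ _ _⟩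

theorem frechetRec_swap (D : ℕ → ℕ → ℝ) (a b : ℕ) :
    frechetRec (fun b a => D a b) b a = frechetRec D a b := by
  induction a, b using frechetRec.induct with
  | case1 => simp [frechetRec]
  | case2 b ih => rw [frechetRec, frechetRec, ih]
  | case3 a ih => rw [frechetRec, frechetRec, ih]
  | case4 a b ih1 ih2 ih3 =>
    rw [frechetRec, frechetRec, ih1, ih2, ih3, min_comm (frechetRec D (a + 1) b)]

theorem exists_le_frechetRec_of_le_right (D : ℕ → ℕ → ℝ) (a b : ℕ) :
    ∀ b' ≤ b, ∃ a' ≤ a, D a' b' ≤ frechetRec D a b := by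
  rw [← frechetRec_swap]
  exact exists_le_frechetRec_of_le_left (fun b a => D a b) b a

theorem frechetRec_succ_left_le (D : ℕ → ℕ → ℝ) (a b : ℕ) :
    frechetRec D (a + 1) b ≤ max (D (a + 1) b) (frechetRec D a b) := by
  cases b with
  | zero => exact (frechetRec.eq_3 D a).le
  | succ b =>
    rw [frechetRec.eq_4]
    exact max_le_max le_rfl ((min_le_left _ _).trans (min_le_left _ _))

theorem frechetRec_succ_right_le (D : ℕ → ℕ → ℝ) (a b : ℕ) :
    frechetRec D a (b + 1) ≤ max (D a (b + 1)) (frechetRec D a b) := by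
  cases a with
  | zero => exact (frechetRec.eq_2 D b).le
  | succ a =>
    rw [frechetRec.eq_4]
    exact max_le_max le_rfl ((min_le_left _ _).trans (min_le_right _ _))

theorem frechetRec_le_of_step {p q : ℕ} (D : ℕ → ℕ → ℝ) {v w : Fin p × Fin q} (h : WarpStep v w) :
    frechetRec D w.1 w.2 ≤ max (D w.1 w.2) (frechetRec D v.1 v.2) := by
  obtain ⟨⟨a, ha⟩, ⟨b, hb⟩⟩ := v
  obtain ⟨⟨a', ha'⟩, ⟨b', hb'⟩⟩ := w
  simp only [WarpStep] at h ⊢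
  rcases h with ⟨rfl, rfl⟩ | ⟨rfl, rfl⟩ | ⟨rfl, rfl⟩
  · exact frechetRec_succ_right_le D _ _
  · exact frechetRec_succ_left_le D _ _
  · rw [frechetRec.eq_4]
    exact max_le_max le_rfl (min_le_right _ _)

/-- The dynamic program is no worse than any path: follow the path and apply `frechetRec_le_of_step`
at each step. -/
theorem frechetRec_getLast_le {p q : ℕ} (D : ℕ → ℕ → ℝ) {M : ℝ} (W : List (Fin p × Fin q)) :
    ∀ v : Fin p × Fin q, (v :: W).IsChain WarpStep → frechetRec D v.1 v.2 ≤ M →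
      (∀ w ∈ W, D w.1 w.2 ≤ M) → ∀ w ∈ (v :: W).getLast?, frechetRec D w.1 w.2 ≤ M := by
  induction W with
  | nil => simp
  | cons w W ih =>
    intro v hc hv hW x hx
    rw [List.isChain_cons_cons] at hc
    rw [List.getLast?_cons_cons] at hx
    exact ih w hc.2 ((frechetRec_le_of_step D hc.1).trans (max_le (hW w (by simp)) hv))
      (fun y hy => hW y (by simp [hy])) x hx

/-- The dynamic program is attained by a path: trace back to the predecessor that realizes the
minimum and append the last pair. The auxiliary `key` is the appending of one pair. -/
theorem exists_warpingPath {p q : ℕ} (D : ℕ → ℕ → ℝ) (a b : ℕ) :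
    ∀ (ha : a < p) (hb : b < q), ∃ W : List (Fin p × Fin q), W.IsChain WarpStep ∧
      (∃ v ∈ W.head?, (v.1 : ℕ) = 0 ∧ (v.2 : ℕ) = 0) ∧ W.getLast? = some (⟨a, ha⟩, ⟨b, hb⟩) ∧
      ∀ w ∈ W, D w.1 w.2 ≤ frechetRec D a b := by
  have key : ∀ (a b a' b' : ℕ) (ha : a < p) (hb : b < q) (ha' : a' < p) (hb' : b' < q)
      (W : List (Fin p × Fin q)) (M M' : ℝ), W.IsChain WarpStep →
      (∃ v ∈ W.head?, (v.1 : ℕ) = 0 ∧ (v.2 : ℕ) = 0) →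
      W.getLast? = some (⟨a, ha⟩, ⟨b, hb⟩) → (∀ w ∈ W, D w.1 w.2 ≤ M) →
      WarpStep (⟨a, ha⟩, ⟨b, hb⟩) ((⟨a', ha'⟩, ⟨b', hb'⟩) : Fin p × Fin q) → M ≤ M' →
      D a' b' ≤ M' → ∃ W : List (Fin p × Fin q), W.IsChain WarpStep ∧
      (∃ v ∈ W.head?, (v.1 : ℕ) = 0 ∧ (v.2 : ℕ) = 0) ∧
      W.getLast? = some (⟨a', ha'⟩, ⟨b', hb'⟩) ∧ ∀ w ∈ W, D w.1 w.2 ≤ M' := by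
    intro a b a' b' ha hb ha' hb' W M M' hc hh hl hM hs hMM' hD
    refine ⟨W ++ [(⟨a', ha'⟩, ⟨b', hb'⟩)], ?_, ?_, by simp, ?_⟩
    · refine List.isChain_append.2 ⟨hc, List.isChain_singleton _, ?_⟩
      intro x hx y hy
      rw [hl] at hx
      simp only [Option.mem_def, Option.some.injEq, List.head?_cons] at hx hy
      rwa [← hx, ← hy]
    · obtain ⟨v, hv, h⟩ := hh
      exact ⟨v, by simp [List.head?_append, Option.mem_def.1 hv], h⟩
    · intro w hw
      rcases List.mem_append.1 hw with hw | hw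
      · exact (hM w hw).trans hMM'
      · rw [List.mem_singleton.1 hw]
        exact hD
  induction a, b using frechetRec.induct with
  | case1 =>
    intro ha hb
    exact ⟨[(⟨0, ha⟩, ⟨0, hb⟩)], List.isChain_singleton _, by simp, by simp, by simp [frechetRec]⟩
  | case2 b ih =>
    intro ha hb
    obtain ⟨W, hc, hh, hl, hM⟩ := ih ha (by omega)
    exact key _ _ _ _ _ _ ha hb W _ _ hc hh hl hM (by simp [WarpStep]) (by simp [frechetRec])
      (frechetRec_self_le _ _ _)
  | case3 a ih =>
    intro ha hb
    obtain ⟨W, hc, hh, hl, hM⟩ := ih (by omega) hb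
    exact key _ _ _ _ _ _ ha hb W _ _ hc hh hl hM (by simp [WarpStep]) (by simp [frechetRec])
      (frechetRec_self_le _ _ _)
  | case4 a b ih1 ih2 ih3 =>
    intro ha hb
    rcases min_choice (min (frechetRec D a (b + 1)) (frechetRec D (a + 1) b)) (frechetRec D a b)
      with h | h
    · rcases min_choice (frechetRec D a (b + 1)) (frechetRec D (a + 1) b) with h' | h'
      · obtain ⟨W, hc, hh, hl, hM⟩ := ih1 (by omega) hb
        exact key _ _ _ _ _ _ ha hb W _ _ hc hh hl hM (by simp [WarpStep])
          (by rw [frechetRec.eq_4, h, h']; exact le_max_right _ _) (frechetRec_self_le _ _ _)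
      · obtain ⟨W, hc, hh, hl, hM⟩ := ih2 ha (by omega)
        exact key _ _ _ _ _ _ ha hb W _ _ hc hh hl hM (by simp [WarpStep])
          (by rw [frechetRec.eq_4 _ a b, h, h']; exact le_max_right _ _) (frechetRec_self_le _ _ _)
    · obtain ⟨W, hc, hh, hl, hM⟩ := ih3 (by omega) (by omega)
      exact key _ _ _ _ _ _ ha hb W _ _ hc hh hl hM (by simp [WarpStep])
        (by rw [frechetRec.eq_4 _ a b, h]; exact le_max_right _ _) (frechetRec_self_le _ _ _)

end RealRAM

open RealRAM

/-- The vertices of a curve, where the last vertex is repeated indefinitely. -/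
def Curve.pad {d : ℕ} (x : Curve d) (a : ℕ) : EuclideanSpace ℝ (Fin d) :=
  x.vertex ⟨min a (x.complexity - 1), by have := x.complexity_pos; omega⟩

theorem Curve.pad_val {d : ℕ} (x : Curve d) (a : Fin x.complexity) : x.pad a = x.vertex a := by
  unfold Curve.pad
  congr 1
  ext
  simp only
  omega

theorem warpCost_le_iff {d : ℕ} {x y : Curve d} {W : List (Fin x.complexity × Fin y.complexity)}
    {M : ℝ} : warpCost x y W ≤ M ↔ 0 ≤ M ∧ ∀ w ∈ W, dist (x.vertex w.1) (y.vertex w.2) ≤ M := by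
  unfold warpCost
  induction W with
  | nil => simp
  | cons w W ih => simp only [List.map_cons, List.foldr_cons, max_le_iff, ih, List.mem_cons,
      forall_eq_or_imp]; tauto

/-- The traced-back path gives one inequality, and following an arbitrary path the other. Padding
only serves to have a cost for all natural indices. -/
theorem discreteFrechet_eq {d : ℕ} (x y : Curve d) : discreteFrechet x y =
    frechetRec (fun a b => dist (x.pad a) (y.pad b)) (x.complexity - 1) (y.complexity - 1) := by
  have hx := x.complexity_pos
  have hy := y.complexity_pos
  set Δ : ℕ → ℕ → ℝ := fun a b => dist (x.pad a) (y.pad b) with hΔ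
  obtain ⟨W, hc, hh, hl, hM⟩ := exists_warpingPath (p := x.complexity) (q := y.complexity) Δ
    (x.complexity - 1) (y.complexity - 1) (by omega) (by omega)
  have hW : IsWarpingPath W := ⟨hh, ⟨_, hl, by simp only; omega, by simp only; omega⟩, hc⟩
  have hle : warpCost x y W ≤ frechetRec Δ (x.complexity - 1) (y.complexity - 1) := by
    refine warpCost_le_iff.2 ⟨dist_nonneg.trans (frechetRec_self_le Δ _ _), fun w hw => ?_⟩
    have := hM w hw
    simpa only [hΔ, Curve.pad_val] using this
  refine le_antisymm (le_trans (csInf_le ⟨0, ?_⟩ ⟨W, hW, rfl⟩) hle) (le_csInf ⟨_, W, hW, rfl⟩ ?_)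
  · rintro _ ⟨W, -, rfl⟩
    exact (warpCost_le_iff.1 le_rfl).1
  · rintro _ ⟨W, hW, rfl⟩
    have h := (warpCost_le_iff (x := x) (y := y) (W := W)).1 le_rfl
    obtain ⟨v, hv, hv1, hv2⟩ := hW.first
    obtain ⟨w, hw, hw1, hw2⟩ := hW.last
    cases W with
    | nil => simp at hv
    | cons v' W =>
      obtain rfl : v' = v := by simpa using hv
      have h' : ∀ u ∈ v' :: W, Δ u.1 u.2 ≤ warpCost x y (v' :: W) := fun u hu => by
        simpa only [hΔ, Curve.pad_val] using h.2 u hu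
      have := frechetRec_getLast_le Δ W v' hW.step (M := warpCost x y (v' :: W)) ?_
        (fun u hu => h' u (List.mem_cons_of_mem _ hu)) w hw
      · rwa [show (w.1 : ℕ) = x.complexity - 1 by omega,
          show (w.2 : ℕ) = y.complexity - 1 by omega] at this
      · have := h' v' List.mem_cons_self
        rw [hv1, hv2] at this ⊢
        simpa [frechetRec] using this

theorem discreteFrechet_nonneg {d : ℕ} (x y : Curve d) : 0 ≤ discreteFrechet x y := by
  rw [discreteFrechet_eq]
  exact dist_nonneg.trans (frechetRec_self_le (fun a b => dist (x.pad a) (y.pad b)) _ _)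

theorem exists_dist_le_discreteFrechet_left {d : ℕ} (x y : Curve d) (a : ℕ) :
    ∃ b < y.complexity, dist (x.pad a) (y.pad b) ≤ discreteFrechet x y := by
  have hy := y.complexity_pos
  rw [discreteFrechet_eq]
  obtain ⟨b, hb, h⟩ := exists_le_frechetRec_of_le_left (fun a b => dist (x.pad a) (y.pad b))
    (x.complexity - 1) (y.complexity - 1) (min a (x.complexity - 1)) (min_le_right _ _)
  refine ⟨b, by omega, ?_⟩
  simpa [Curve.pad] using h

theorem exists_dist_le_discreteFrechet_right {d : ℕ} (x y : Curve d) {b : ℕ}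
    (hb : b < y.complexity) :
    ∃ a < x.complexity, dist (x.pad a) (y.pad b) ≤ discreteFrechet x y := by
  have hx := x.complexity_pos
  rw [discreteFrechet_eq]
  obtain ⟨a, ha, h⟩ := exists_le_frechetRec_of_le_right (fun a b => dist (x.pad a) (y.pad b))
    (x.complexity - 1) (y.complexity - 1) b (by omega)
  exact ⟨a, by omega, h⟩

/-- The dynamic program is at most the discrete Fréchet distance plus `δ`, if it is run for a
curve with `ℓ` vertices that are within `δ` of those of `x`, padded to `ℓ` vertices. -/
theorem frechetRec_le_discreteFrechet_add {d ℓ : ℕ} {x y : Curve d} (hℓ : x.complexity ≤ ℓ)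
    {D : ℕ → ℕ → ℝ} {δ : ℝ}
    (h : ∀ a < ℓ, ∀ b < y.complexity, D a b ≤ dist (x.pad a) (y.pad b) + δ) :
    frechetRec D (ℓ - 1) (y.complexity - 1) ≤ discreteFrechet x y + δ := by
  have hx := x.complexity_pos
  have hy := y.complexity_pos
  set Δ : ℕ → ℕ → ℝ := fun a b => dist (x.pad a) (y.pad b) with hΔ
  refine (frechetRec_le_add (D' := Δ) fun a ha b hb => h a (by omega) b (by omega)).trans ?_
  rw [discreteFrechet_eq]
  refine add_le_add_left (?_ : frechetRec Δ (ℓ - 1) _ ≤ _) δ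
  obtain ⟨t, rfl⟩ := Nat.exists_eq_add_of_le hℓ
  -- Repeating the last vertex of `x` is free: the copies are matched to the last vertex of `y`, at
  -- a distance that the path pays anyway.
  have hpad : ∀ t, Δ (x.complexity - 1 + t) (y.complexity - 1) =
      Δ (x.complexity - 1) (y.complexity - 1) := by
    intro t
    simp [hΔ, Curve.pad]
  rw [show x.complexity + t - 1 = x.complexity - 1 + t by omega]
  induction t with
  | zero => exact le_rfl
  | succ t ih =>
    refine (frechetRec_succ_left_le Δ _ _).trans
      (max_le ?_ (ih (by omega) fun a ha => h a (by omega)))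
    exact (hpad (t + 1)).trans_le (frechetRec_self_le Δ _ _)

/-! ### The center cost -/

theorem centerCost_le_iff {d m k : ℕ} (hm : 1 ≤ m) (hk : 1 ≤ k) {g : Fin m → Curve d}
    {c : Fin k → Curve d} {M : ℝ} :
    centerCost g c ≤ M ↔ ∀ j, ∃ i, discreteFrechet (c i) (g j) ≤ M := by
  have : Nonempty (Fin m) := ⟨⟨0, hm⟩⟩
  have : Nonempty (Fin k) := ⟨⟨0, hk⟩⟩
  unfold centerCost
  constructor
  · intro h j
    obtain ⟨i, hi⟩ := exists_eq_ciInf_of_finite (f := fun i => discreteFrechet (c i) (g j))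
    exact ⟨i, hi.trans_le ((le_ciSup (f := fun j => ⨅ i, discreteFrechet (c i) (g j))
      (Set.finite_range _).bddAbove j).trans h)⟩
  · intro h
    refine ciSup_le fun j => ?_
    obtain ⟨i, hi⟩ := h j
    exact (ciInf_le (Set.finite_range _).bddBelow i).trans hi

theorem centerCost_nonneg {d m k : ℕ} (hm : 1 ≤ m) (hk : 1 ≤ k) (g : Fin m → Curve d)
    (c : Fin k → Curve d) : 0 ≤ centerCost g c := by
  obtain ⟨i, hi⟩ := (centerCost_le_iff hm hk).1 (le_refl (centerCost g c)) ⟨0, hm⟩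
  exact (discreteFrechet_nonneg _ _).trans hi

namespace RealRAM

/-! ### Computed minima, maxima and Euclidean distances -/

theorem runMin_spec {f : ℕ → ℝ} (hf : ∀ i, 0 ≤ f i) {n : ℕ} (hn : 1 ≤ n) :
    (∀ i < n, runMin f n ≤ f i) ∧ ∃ i < n, runMin f n = f i := by
  induction n, hn using Nat.le_induction with
  | base =>
    have : runMin f 1 = f 0 := by simp [runMin]
    refine ⟨fun i hi => ?_, 0, one_pos, this⟩
    obtain rfl : i = 0 := by omega
    exact this.le
  | succ n hn ih =>
    obtain ⟨h1, i, hi, h2⟩ := ih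
    have hpos : ¬ runMin f n < 0 := by rw [h2]; exact not_lt.2 (hf i)
    rw [runMin]
    split_ifs with h
    · have h := h.resolve_left hpos
      refine ⟨fun i' hi' => ?_, n, by omega, rfl⟩
      rcases Nat.lt_succ_iff_lt_or_eq.1 hi' with hi' | rfl
      · exact h.le.trans (h1 i' hi')
      · exact le_rfl
    · refine ⟨fun i' hi' => ?_, i, by omega, h2⟩
      rcases Nat.lt_succ_iff_lt_or_eq.1 hi' with hi' | rfl
      · exact h1 i' hi'
      · exact not_lt.1 (not_or.1 h).2

theorem runMax_le_iff {f : ℕ → ℝ} {n : ℕ} {M : ℝ} :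
    runMax f n ≤ M ↔ 0 ≤ M ∧ ∀ i < n, f i ≤ M := by
  induction n with
  | zero => simp [runMax]
  | succ n ih =>
    rw [runMax, max_le_iff, ih]
    constructor
    · rintro ⟨⟨h0, h1⟩, h2⟩
      refine ⟨h0, fun i hi => ?_⟩
      rcases Nat.lt_succ_iff_lt_or_eq.1 hi with hi | rfl
      · exact h1 i hi
      · exact h2
    · exact fun ⟨h0, h1⟩ => ⟨⟨h0, fun i hi => h1 i (by omega)⟩, h1 n (by omega)⟩

theorem Data.frechet_nonneg (D : Data) (Y : ℕ → ℕ → ℝ) (i j : ℕ) : 0 ≤ D.frechet Y i j :=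
  (rawDist_nonneg _ _ _).trans (frechetRec_self_le (D.pairDist Y i j) _ _)

theorem Data.Valid.cost_le_iff {D : Data} (hD : D.Valid) {Y : ℕ → ℕ → ℝ} {M : ℝ} :
    D.cost Y ≤ M ↔ 0 ≤ M ∧ ∀ j < D.m, ∃ i < D.k, D.frechet Y i j ≤ M := by
  unfold Data.cost
  rw [runMax_le_iff]
  refine and_congr_right fun _ => forall₂_congr fun j _ => ?_
  obtain ⟨h1, i, hi, h2⟩ := runMin_spec (fun i => D.frechet_nonneg Y i j) hD.k
  exact ⟨fun h => ⟨i, hi, h2 ▸ h⟩, fun ⟨i', hi', h⟩ => (h1 i' hi').trans h⟩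

theorem rawDist_eq_dist {d : ℕ} {f g : ℕ → ℝ} {x y : EuclideanSpace ℝ (Fin d)}
    (hx : ∀ c : Fin d, f c = x c) (hy : ∀ c : Fin d, g c = y c) : rawDist d f g = dist x y := by
  rw [rawDist, EuclideanSpace.dist_eq,
    ← Fin.sum_univ_eq_sum_range fun c => (f c - g c) * (f c - g c)]
  congr 1
  refine Finset.sum_congr rfl fun c _ => ?_
  rw [hx, hy, Real.dist_eq, sq_abs, sq]

theorem rawDist_le {d : ℕ} {f g : ℕ → ℝ} {t : ℝ} (ht : 0 ≤ t) (h : ∀ c < d, |f c - g c| ≤ t) :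
    rawDist d f g ≤ √(d : ℝ) * t := by
  rw [rawDist, ← Real.sqrt_sq ht, ← Real.sqrt_mul (Nat.cast_nonneg _)]
  refine Real.sqrt_le_sqrt ?_
  calc _ ≤ ∑ c ∈ Finset.range d, t ^ 2 := Finset.sum_le_sum fun c hc => by
        rw [← sq, ← sq_abs]
        exact pow_le_pow_left₀ (abs_nonneg _) (h c (Finset.mem_range.1 hc)) 2
    _ = _ := by simp

theorem abs_sub_le_rawDist {d : ℕ} {f g : ℕ → ℝ} {c : ℕ} (hc : c < d) :
    |f c - g c| ≤ rawDist d f g := by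
  rw [rawDist, ← Real.sqrt_sq_eq_abs, sq]
  exact Real.sqrt_le_sqrt (Finset.single_le_sum (f := fun c => (f c - g c) * (f c - g c))
    (fun i _ => mul_self_nonneg _) (Finset.mem_range.2 hc))

/-! ### The coordinates of a sequence of curves -/

/-- Block `j` of a concatenation starts at the sum of the lengths of the earlier blocks. Used once
for vertices within curves and once for coordinates within vertices. -/
theorem getElem?_flatMap_add {α β : Type*} {l : List α} {f : α → List β} {n : ℕ → ℕ}
    (hn : ∀ i (h : i < l.length), (f l[i]).length = n i) {j b : ℕ} (hj : j < l.length)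
    (hb : b < n j) : (l.flatMap f)[∑ i ∈ Finset.range j, n i + b]? = (f l[j])[b]? := by
  induction l generalizing n j with
  | nil => simp at hj
  | cons x l ih =>
    have h0 : (f x).length = n 0 := hn 0 (by simp)
    rw [List.flatMap_cons]
    cases j with
    | zero =>
      rw [List.getElem?_append_left (by simpa [h0] using hb)]
      simp
    | succ j =>
      rw [Finset.sum_range_succ', List.getElem?_append_right (by omega), h0,
        show ∑ i ∈ Finset.range j, n (i + 1) + n 0 + b - n 0 =
          ∑ i ∈ Finset.range j, n (i + 1) + b by omega,
        ih (n := fun i => n (i + 1)) (fun i hi => hn (i + 1) (by simpa using hi))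
          (by simpa using hj) hb]
      rfl

theorem coords_eq {d m : ℕ} (g : Fin m → Curve d) : coords g =
    ((List.ofFn g).flatMap fun c => List.ofFn c.vertex).flatMap
      fun v => List.ofFn fun i => v i := by
  rw [List.flatMap_assoc]
  rfl

theorem length_coords {d m : ℕ} (g : Fin m → Curve d) :
    (coords g).length = (∑ j, (g j).complexity) * d := by
  simp [coords, List.length_flatMap, List.sum_ofFn, List.map_ofFn, Function.comp_def,
    Finset.sum_mul]

theorem getElem?_coords {d m : ℕ} (g : Fin m → Curve d) {n : ℕ → ℕ}
    (hn : ∀ j : Fin m, (g j).complexity = n j) (j : Fin m) {b : ℕ} (hb : b < n j) (c : Fin d) :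
    (coords g)[(∑ i ∈ Finset.range j, n i + b) * d + c]? = some ((g j).pad b c) := by
  set l := (List.ofFn g).flatMap fun c => List.ofFn c.vertex with hl
  have h1 : l[∑ i ∈ Finset.range j, n i + b]? = some ((g j).pad b) := by
    have hj : (List.ofFn g)[(j : ℕ)]'(by simp) = g j := by simp
    have := (g j).pad_val ⟨b, by rw [hn]; exact hb⟩
    rw [hl, getElem?_flatMap_add (fun i hi => by simpa using hn ⟨i, by simpa using hi⟩)
      (by simp) hb, hj, List.getElem?_eq_getElem (by simpa [hn] using hb), this]
    simp
  obtain ⟨h, h2⟩ := List.getElem?_eq_some_iff.1 h1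
  have h3 := getElem?_flatMap_add (l := l)
    (f := fun v : EuclideanSpace ℝ (Fin d) => List.ofFn fun i => v i) (n := fun _ => d)
    (fun i hi => by simp) h c.2
  rw [coords_eq]
  simp only [Finset.sum_const, Finset.card_range, smul_eq_mul] at h3
  rw [h3, h2]
  simp

/-! ### The data of an instance -/

/-- The data of an instance of the `(k,ℓ)`-center problem. -/
def instData {d m : ℕ} (k ℓ N : ℕ) (g : Fin m → Curve d) : Data where
  d := d
  m := m
  k := k
  ℓ := ℓ
  N := N
  len j := (List.ofFn fun j => (g j).complexity).getD j 0
  pt v c := (coords g).getD (v * d + c) 0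

/-- The curve with `ℓ` vertices, the coordinates of which are given by `Y`. -/
noncomputable def curveOf (d : ℕ) {ℓ : ℕ} (hℓ : 1 ≤ ℓ) (Y : ℕ → ℕ → ℝ) : Curve d where
  complexity := ℓ
  complexity_pos := hℓ
  vertex a := WithLp.toLp 2 fun c => Y a c

section

variable {d m k ℓ N : ℕ} {g : Fin m → Curve d}

theorem instData_len (j : Fin m) : (instData k ℓ N g).len j = (g j).complexity := by
  simp [instData, List.getD_eq_getElem?_getD]

theorem instData_pt (j : Fin m) {b : ℕ} (hb : b < (g j).complexity) (c : Fin d) :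
    (instData k ℓ N g).pt ((instData k ℓ N g).start j + b) c = (g j).pad b c := by
  have h := getElem?_coords g (n := (instData k ℓ N g).len) (fun j => (instData_len j).symm) j
    (by rwa [instData_len]) c
  change (coords g).getD ((∑ i ∈ Finset.range j, (instData k ℓ N g).len i + b) * d + c) 0 = _
  rw [List.getD_eq_getElem?_getD, h]
  rfl

theorem exists_start_add {D : Data} {v : ℕ} (hv : v < D.V) :
    ∃ j < D.m, ∃ b < D.len j, v = D.start j + b := by
  have : ∀ n, v < D.start n → ∃ j < n, ∃ b < D.len j, v = D.start j + b := by
    intro n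
    induction n with
    | zero => simp [Data.start]
    | succ n ih =>
      intro h
      by_cases h' : v < D.start n
      · obtain ⟨j, hj, h⟩ := ih h'
        exact ⟨j, by omega, h⟩
      · rw [D.start_succ] at h
        exact ⟨n, by omega, v - D.start n, by omega, by omega⟩
  exact this _ hv

theorem instData_valid (hd : 1 ≤ d) (hm : 1 ≤ m) (hk : 1 ≤ k) (hℓ : 1 ≤ ℓ) (hN : 1 ≤ N) :
    (instData k ℓ N g).Valid :=
  ⟨hd, hm, hk, hℓ, hN, fun j hj => by
    rw [show j = ((⟨j, hj⟩ : Fin m) : ℕ) from rfl, instData_len]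
    exact (g _).complexity_pos⟩

theorem discreteFrechet_curveOf (hℓ : 1 ≤ ℓ) (Y : ℕ → ℕ → ℝ) (i : ℕ) (j : Fin m) :
    discreteFrechet (curveOf d hℓ fun a => Y (i * ℓ + a)) (g j) =
      (instData k ℓ N g).frechet Y i j := by
  have hg := (g j).complexity_pos
  rw [discreteFrechet_eq, Data.frechet, instData_len]
  refine frechetRec_congr fun a ha b hb => (rawDist_eq_dist (fun c => ?_) (fun c => ?_)).symm
  · have ha : a ≤ ℓ - 1 := ha
    simp [Curve.pad, curveOf, min_eq_left ha, instData]
  · exact instData_pt j (by omega) c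

theorem centerCost_curveOf (hd : 1 ≤ d) (hm : 1 ≤ m) (hk : 1 ≤ k) (hℓ : 1 ≤ ℓ) (hN : 1 ≤ N)
    (Y : ℕ → ℕ → ℝ) : centerCost g (fun i : Fin k => curveOf d hℓ fun a => Y (i * ℓ + a)) =
      (instData k ℓ N g).cost Y := by
  have hD : (instData k ℓ N g).Valid := instData_valid hd hm hk hℓ hN
  apply le_antisymm
  · rw [centerCost_le_iff hm hk]
    intro j
    obtain ⟨i, hi, h⟩ := (hD.cost_le_iff.1 le_rfl).2 j j.2
    exact ⟨⟨i, hi⟩, (discreteFrechet_curveOf hℓ Y i j).trans_le h⟩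
  · rw [hD.cost_le_iff]
    refine ⟨centerCost_nonneg hm hk _ _, fun j hj => ?_⟩
    obtain ⟨i, hi⟩ := (centerCost_le_iff hm hk).1 (le_refl (centerCost g
      (fun i : Fin k => curveOf d hℓ fun a => Y (i * ℓ + a)))) ⟨j, hj⟩
    exact ⟨i, i.2, (discreteFrechet_curveOf (N := N) (k := k) hℓ Y i ⟨j, hj⟩).symm.trans_le hi⟩

end

theorem outputs_curveOf {d k ℓ : ℕ} (hd : 1 ≤ d) (hℓ : 1 ≤ ℓ) {s : State} {Y : ℕ → ℕ → ℝ}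
    (h1 : ∀ i < k, s.narr 1 i = ℓ)
    (h2 : ∀ u < k * ℓ, ∀ c < d, s.rarr 1 (u * d + c) = Y u c) :
    Outputs s (fun i : Fin k => curveOf d hℓ fun a => Y (i * ℓ + a)) := by
  set cs : Fin k → Curve d := fun i => curveOf d hℓ fun a => Y (i * ℓ + a)
  refine ⟨fun i => h1 i i.2, fun x => ?_⟩
  have hlen : (coords cs).length = k * ℓ * d := by simp [length_coords, cs, curveOf]
  have hx : (x : ℕ) < k * ℓ * d := hlen ▸ x.2
  -- The flat index is decomposed as `x = (i * ℓ + a) * d + c` by two divisions with remainder.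
  have hu : (x : ℕ) / d < k * ℓ := Nat.div_lt_of_lt_mul (by rwa [mul_comm])
  have hc : (x : ℕ) % d < d := Nat.mod_lt _ hd
  have hi : (x : ℕ) / d / ℓ < k := Nat.div_lt_of_lt_mul (by rwa [mul_comm])
  have ha : (x : ℕ) / d % ℓ < ℓ := Nat.mod_lt _ hℓ
  have h := getElem?_coords cs (n := fun _ => ℓ) (fun _ => rfl) ⟨_, hi⟩ ha ⟨_, hc⟩
  simp only [Finset.sum_const, Finset.card_range, smul_eq_mul] at h
  rw [mul_comm _ ℓ, Nat.div_add_mod, mul_comm _ d, Nat.div_add_mod,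
    List.getElem?_eq_getElem x.2, Option.some.injEq] at h
  rw [List.get_eq_getElem, h]
  have h3 := h2 _ hu _ hc
  rw [mul_comm _ d, Nat.div_add_mod] at h3
  rw [h3]
  simp only [Curve.pad, cs, curveOf, min_eq_left (Nat.le_sub_one_of_lt ha)]
  rw [mul_comm _ ℓ, Nat.div_add_mod]

/-! ### The candidate solutions cover all solutions -/

theorem Data.Valid.exists_digits {D : Data} (hD : D.Valid) {x : ℕ → ℕ} {y : ℕ → ℕ → ℕ}
    (hx : ∀ u < D.kl, x u < D.kl) (hy : ∀ u < D.kl, ∀ c < D.d, y u c < D.N) :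
    ∃ e, D.IsDigits e ∧ (∀ u < D.kl, e u = x u) ∧
      ∀ u < D.kl, ∀ c < D.d, e (D.kl + u * D.d + c) = y u c := by
  have hd : 0 < D.d := hD.d
  refine ⟨fun p => if p < D.kl then x p else if p < D.digits then
    y ((p - D.kl) / D.d) ((p - D.kl) % D.d) else 0, ⟨fun p hp => ?_, fun p hp => ?_⟩,
    fun u hu => if_pos hu, fun u hu c hc => ?_⟩
  · simp only [Data.base]
    split_ifs with h
    · exact hx p h
    · refine hy _ ?_ _ (Nat.mod_lt _ hd)
      refine Nat.div_lt_of_lt_mul ?_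
      rw [mul_comm]
      unfold Data.digits at hp
      omega
  · have : D.kl ≤ D.digits := Nat.le_add_right _ _
    rw [if_neg (by omega), if_neg (by omega)]
  · beta_reduce
    rw [if_neg (by omega), if_pos (D.digit_lt hu hc),
      show D.kl + u * D.d + c - D.kl = D.d * u + c by rw [mul_comm]; omega,
      Nat.mul_add_div hd, Nat.mul_add_mod, Nat.div_eq_of_lt hc, Nat.mod_eq_of_lt hc, add_zero]

/-- The interval from `-R` to `R` is cut into `N` pieces of length `2R/N`, whose midpoints are
`R((2i + 1)/N - 1)`; a point is within half a length of the midpoint of its piece. -/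
theorem exists_grid {N : ℕ} (hN : 1 ≤ N) {R x : ℝ} (hx : |x| ≤ R) :
    ∃ i < N, |x - R * (((i + i + 1 : ℕ) : ℝ) / N - 1)| ≤ R / N := by
  have hN' : (0 : ℝ) < N := by exact_mod_cast hN
  obtain ⟨h1, h2⟩ := abs_le.1 hx
  rcases (show 0 ≤ R by linarith).eq_or_lt with rfl | hR
  · refine ⟨0, hN, ?_⟩
    have : x = 0 := by linarith
    simp [this]
  -- The position of `x` in units of pieces, so the floor of `t` is the index of its piece.
  set t : ℝ := (x + R) / (2 * R) * N with ht
  have hxt : x = R * (2 * t / N - 1) := by rw [ht]; field_simp; ring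
  have ht0 : 0 ≤ t := by
    rw [ht]
    have : 0 ≤ x + R := by linarith
    positivity
  have htN : t ≤ N := by
    rw [ht]
    have : (x + R) / (2 * R) ≤ 1 := by rw [div_le_one (by linarith)]; linarith
    nlinarith
  have hfl := Nat.floor_le ht0
  have hfl' := Nat.lt_floor_add_one t
  have key : ∀ i : ℕ, (i : ℝ) ≤ t → t ≤ i + 1 →
      |x - R * (((i + i + 1 : ℕ) : ℝ) / N - 1)| ≤ R / N := by
    intro i hi hi'
    have : x - R * (((i + i + 1 : ℕ) : ℝ) / N - 1) = R / N * (2 * t - (2 * i + 1)) := by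
      rw [hxt]; push_cast; field_simp; ring
    rw [this, abs_mul, abs_of_pos (by positivity : 0 < R / N)]
    have : |2 * t - (2 * (i : ℝ) + 1)| ≤ 1 := abs_le.2 ⟨by linarith, by linarith⟩
    have hRN : 0 < R / N := by positivity
    nlinarith
  by_cases h : ⌊t⌋₊ < N
  · exact ⟨_, h, key _ hfl hfl'.le⟩
  -- Only the right end point `x = R` has floor `N`; it belongs to the last piece.
  · have hc : ((N - 1 : ℕ) : ℝ) = N - 1 := by rw [Nat.cast_sub hN]; simp
    have : (N : ℝ) ≤ ⌊t⌋₊ := by exact_mod_cast not_lt.1 h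
    exact ⟨N - 1, by omega, key _ (by rw [hc]; linarith) (by rw [hc]; linarith)⟩

/-- There is a candidate solution with every vertex `u` of a set `S` within `√d * 3b / N` of `z u`,
if `z u` is within `3b` of the traversal. -/
theorem Data.Valid.exists_cand {D : Data} (hD : D.Valid) (q : ℕ → ℕ) {b : ℝ} (hb : 0 ≤ b)
    {S : ℕ → Prop} {z : ℕ → ℕ → ℝ}
    (h : ∀ u < D.kl, S u → ∃ i < D.kl, rawDist D.d (z u) (D.pt (q i)) ≤ 3 * b) :
    ∃ e, D.IsDigits e ∧ ∀ u < D.kl, S u →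
      rawDist D.d (D.cand q e b u) (z u) ≤ √(D.d : ℝ) * (3 * b / D.N) := by
  -- The conditions on `u` are moved inside the existential, with default index `0`, so that
  -- `choose` yields functions on all of `ℕ`.
  have hx : ∀ u, ∃ i < D.kl, u < D.kl → S u → rawDist D.d (z u) (D.pt (q i)) ≤ 3 * b := by
    intro u
    by_cases hu : u < D.kl ∧ S u
    · obtain ⟨i, hi, h'⟩ := h u hu.1 hu.2
      exact ⟨i, hi, fun _ _ => h'⟩
    · exact ⟨0, hD.kl, fun h1 h2 => absurd ⟨h1, h2⟩ hu⟩
  choose x hx1 hx2 using hx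
  have hy : ∀ u c, ∃ i < D.N, u < D.kl → c < D.d → S u →
      |z u c - D.pt (q (x u)) c - 3 * b * (((i + i + 1 : ℕ) : ℝ) / D.N - 1)| ≤ 3 * b / D.N := by
    intro u c
    by_cases hu : u < D.kl ∧ c < D.d ∧ S u
    · obtain ⟨i, hi, h'⟩ := exists_grid hD.N
        ((abs_sub_le_rawDist hu.2.1).trans (hx2 u hu.1 hu.2.2))
      exact ⟨i, hi, fun _ _ _ => h'⟩
    · exact ⟨0, hD.N, fun h1 h2 h3 => absurd ⟨h1, h2, h3⟩ hu⟩
  choose y hy1 hy2 using hy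
  obtain ⟨e, he, e1, e2⟩ := hD.exists_digits (fun u _ => hx1 u) (fun u _ c _ => hy1 u c)
  refine ⟨e, he, fun u hu hS => rawDist_le (by positivity) fun c hc => ?_⟩
  rw [abs_sub_comm, Data.cand, e1 u hu, e2 u hu c hc, ← sub_sub]
  exact hy2 u c hu hc hS

/-- For cubes of size `0`, there is a candidate solution with every vertex `u` of a set `S` within
`t` of `z u`, if `z u` is within `t` of the traversal. -/
theorem Data.Valid.exists_cand_zero {D : Data} (hD : D.Valid) (q : ℕ → ℕ) {t : ℝ}
    {S : ℕ → Prop} {z : ℕ → ℕ → ℝ}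
    (h : ∀ u < D.kl, S u → ∃ i < D.kl, rawDist D.d (D.pt (q i)) (z u) ≤ t) :
    ∃ e, D.IsDigits e ∧ ∀ u < D.kl, S u → rawDist D.d (D.cand q e 0 u) (z u) ≤ t := by
  have hx : ∀ u, ∃ i < D.kl, u < D.kl → S u → rawDist D.d (D.pt (q i)) (z u) ≤ t := by
    intro u
    by_cases hu : u < D.kl ∧ S u
    · obtain ⟨i, hi, h'⟩ := h u hu.1 hu.2
      exact ⟨i, hi, fun _ _ => h'⟩
    · exact ⟨0, hD.kl, fun h1 h2 => absurd ⟨h1, h2⟩ hu⟩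
  choose x hx1 hx2 using hx
  obtain ⟨e, he, e1, -⟩ := hD.exists_digits (y := fun _ _ => 0) (fun u _ => hx1 u)
    (fun _ _ _ _ => hD.N)
  refine ⟨e, he, fun u hu hS => ?_⟩
  have : D.cand q e 0 u = D.pt (q (x u)) := by
    funext c
    simp [Data.cand, e1 u hu]
  rw [this]
  exact hx2 u hu hS

/-! ### The approximation guarantee -/

section

variable {d m k ℓ N : ℕ} {g : Fin m → Curve d}

/-- The coordinates of the vertices of a sequence of curves, padded to `ℓ` vertices each. -/
noncomputable def padCoord {d k : ℕ} (ℓ : ℕ) (c : Fin k → Curve d) (u x : ℕ) : ℝ :=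
  if h : u / ℓ < k ∧ x < d then (c ⟨u / ℓ, h.1⟩).pad (u % ℓ) ⟨x, h.2⟩ else 0

theorem padCoord_index (c : Fin k → Curve d) (i : Fin k) {a : ℕ} (ha : a < ℓ) (x : Fin d) :
    padCoord ℓ c (i * ℓ + a) x = (c i).pad a x := by
  have h1 : (i * ℓ + a) / ℓ = (i : ℕ) := by
    rw [mul_comm, Nat.mul_add_div (by omega), Nat.div_eq_of_lt ha, add_zero]
  have h2 : (i * ℓ + a) % ℓ = a := by
    rw [mul_comm, Nat.mul_add_mod, Nat.mod_eq_of_lt ha]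
  unfold padCoord
  simp [h1, h2]

/-- Each curve keeps the center that served it, whose vertices move by at most `δ`. Closeness is
therefore required only for centers within `o` of some curve; the others may be far from all input
vertices, out of reach of any candidate. -/
theorem cost_cand_le (hd : 1 ≤ d) (hm : 1 ≤ m) (hk : 1 ≤ k) (hℓ : 1 ≤ ℓ) (hN : 1 ≤ N)
    {c : Fin k → Curve d} (hc : IsFeasible ℓ c) {o δ : ℝ} (ho : centerCost g c ≤ o) (hδ : 0 ≤ δ)
    {Y : ℕ → ℕ → ℝ} (hY : ∀ u < k * ℓ,
      (∃ i : Fin k, (i : ℕ) = u / ℓ ∧ ∃ j, discreteFrechet (c i) (g j) ≤ o) →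
      rawDist d (Y u) (padCoord ℓ c u) ≤ δ) : (instData k ℓ N g).cost Y ≤ o + δ := by
  have hD : (instData k ℓ N g).Valid := instData_valid hd hm hk hℓ hN
  rw [hD.cost_le_iff]
  refine ⟨by linarith [centerCost_nonneg hm hk g c], fun j hj => ?_⟩
  obtain ⟨i, hi⟩ := (centerCost_le_iff hm hk).1 ho ⟨j, hj⟩
  refine ⟨i, i.2, le_trans ?_ (add_le_add_left hi δ)⟩
  have hlen : (instData k ℓ N g).len j = (g ⟨j, hj⟩).complexity := instData_len ⟨j, hj⟩
  rw [Data.frechet, hlen]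
  refine frechetRec_le_discreteFrechet_add (hc i) fun a ha b hb => ?_
  have hu : (i : ℕ) * ℓ + a < k * ℓ := (instData k ℓ N g).index_lt i.2 ha
  have hy := hY _ hu ⟨i, by
    rw [mul_comm, Nat.mul_add_div (by omega), Nat.div_eq_of_lt ha, add_zero], ⟨j, hj⟩, hi⟩
  rw [rawDist_eq_dist (x := WithLp.toLp 2 fun x : Fin d => Y (i * ℓ + a) x) (fun _ => rfl)
    (padCoord_index c i ha)] at hy
  have : (instData k ℓ N g).pairDist Y i j a b =
      dist (WithLp.toLp 2 fun x : Fin d => Y (i * ℓ + a) x) ((g ⟨j, hj⟩).pad b) :=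
    rawDist_eq_dist (fun _ => rfl) (instData_pt ⟨j, hj⟩ hb)
  rw [this]
  linarith [dist_triangle (WithLp.toLp 2 fun x : Fin d => Y (i * ℓ + a) x) ((c i).pad a)
    ((g ⟨j, hj⟩).pad b)]

/-- An input vertex as a point. -/
noncomputable def ptVec (k ℓ N : ℕ) (g : Fin m → Curve d) (v : ℕ) : EuclideanSpace ℝ (Fin d) :=
  WithLp.toLp 2 fun x : Fin d => (instData k ℓ N g).pt v x

theorem ptDist_eq (u v : ℕ) :
    (instData k ℓ N g).ptDist u v = dist (ptVec k ℓ N g u) (ptVec k ℓ N g v) :=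
  rawDist_eq_dist (fun _ => rfl) (fun _ => rfl)

theorem ptVec_start_add (j : Fin m) {b : ℕ} (hb : b < (g j).complexity) :
    ptVec k ℓ N g ((instData k ℓ N g).start j + b) = (g j).pad b := by
  ext x
  exact instData_pt j hb x

theorem exists_dist_ptVec_le (hm : 1 ≤ m) (hk : 1 ≤ k) {c : Fin k → Curve d}
    (hc : IsFeasible ℓ c) {v : ℕ} (hv : v < (instData k ℓ N g).V) :
    ∃ i : Fin k, ∃ a : Fin ℓ, dist ((c i).pad a) (ptVec k ℓ N g v) ≤ centerCost g c := by
  obtain ⟨j, hj, b, hb, rfl⟩ := exists_start_add hv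
  have hlen : (instData k ℓ N g).len j = (g ⟨j, hj⟩).complexity := instData_len ⟨j, hj⟩
  rw [hlen] at hb
  obtain ⟨i, hi⟩ := (centerCost_le_iff hm hk).1 (le_refl (centerCost g c)) ⟨j, hj⟩
  obtain ⟨a, ha, h⟩ := exists_dist_le_discreteFrechet_right (c i) (g ⟨j, hj⟩) hb
  refine ⟨i, ⟨a, ha.trans_le (hc i)⟩, ?_⟩
  have := ptVec_start_add (k := k) (ℓ := ℓ) (N := N) (g := g) ⟨j, hj⟩ hb
  simp only at this
  rw [this]
  exact h.trans hi

/-- The covering radius of the traversal is at most twice the cost of every feasible solution. -/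
theorem Traversal.exists_dist_le (hm : 1 ≤ m) (hk : 1 ≤ k) (hℓ : 1 ≤ ℓ)
    {q : ℕ → ℕ} {M : ℕ → ℝ} (hT : Traversal (instData k ℓ N g) (k * ℓ) q M)
    {c : Fin k → Curve d} (hc : IsFeasible ℓ c) {v : ℕ} (hv : v < (instData k ℓ N g).V) :
    ∃ i < k * ℓ, dist (ptVec k ℓ N g (q i)) (ptVec k ℓ N g v) ≤ 2 * centerCost g c := by
  have hkl : 0 < k * ℓ := Nat.mul_pos hk hℓ
  have key : ∀ v < (instData k ℓ N g).V, M v ≤ 2 * centerCost g c := by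
    intro v hv
    have hnear := fun i : Fin (k * ℓ + 1) =>
      exists_dist_ptVec_le (N := N) hm hk hc (hT.lt i (Nat.le_of_lt_succ i.2))
    choose x a hxa using hnear
    -- Pigeonhole: `kℓ + 1` traversal vertices, but only `kℓ` pairs of a center and a vertex index.
    -- Two traversal vertices near the same center vertex are within twice the cost of each other.
    obtain ⟨i, i', hne, heq⟩ := Fintype.exists_ne_map_eq_of_card_lt
      (fun i => (x i, a i)) (by simp)
    have hx : x i = x i' := congrArg Prod.fst heq
    have ha : a i = a i' := congrArg Prod.snd heq
    have h1 := hxa i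
    have h2 := hxa i'
    rw [← hx, ← ha] at h2
    have h3 : dist (ptVec k ℓ N g (q i)) (ptVec k ℓ N g (q i')) ≤ 2 * centerCost g c := by
      have := dist_triangle_left (ptVec k ℓ N g (q i)) (ptVec k ℓ N g (q i')) ((c (x i)).pad (a i))
      linarith
    rcases lt_or_gt_of_ne (fun h => hne (Fin.ext h) : (i : ℕ) ≠ i') with hlt | hlt
    · exact ((hT.sep i' (Nat.le_of_lt_succ i'.2) i hlt v hv).trans_eq (ptDist_eq _ _)).trans h3
    · rw [dist_comm] at h3
      exact ((hT.sep i (Nat.le_of_lt_succ i.2) i' hlt v hv).trans_eq (ptDist_eq _ _)).trans h3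
  obtain ⟨i, hi, h⟩ := hT.near hkl v hv
  exact ⟨i, hi, (ptDist_eq _ _).symm.trans_le (h.trans (key v hv))⟩

/-- One cost from the center vertex to the input vertex matched to it, and two more from there to
the traversal. -/
theorem Traversal.exists_rawDist_le (hm : 1 ≤ m) (hk : 1 ≤ k) (hℓ : 1 ≤ ℓ)
    {q : ℕ → ℕ} {M : ℕ → ℝ} (hT : Traversal (instData k ℓ N g) (k * ℓ) q M)
    {c : Fin k → Curve d} (hc : IsFeasible ℓ c) {u : ℕ}
    (h : ∃ i : Fin k, (i : ℕ) = u / ℓ ∧ ∃ j, discreteFrechet (c i) (g j) ≤ centerCost g c) :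
    ∃ i < k * ℓ, rawDist d (padCoord ℓ c u) ((instData k ℓ N g).pt (q i)) ≤
      3 * centerCost g c := by
  obtain ⟨i, hi, j, hj⟩ := h
  obtain ⟨b, hb, h⟩ := exists_dist_le_discreteFrechet_left (c i) (g j) (u % ℓ)
  have hv : (instData k ℓ N g).start j + b < (instData k ℓ N g).V :=
    (instData k ℓ N g).start_add_lt j.2 (by rwa [instData_len])
  obtain ⟨x, hx, h'⟩ := hT.exists_dist_le hm hk hℓ hc hv
  rw [ptVec_start_add j hb] at h'
  refine ⟨x, hx, ?_⟩
  have hu : u = i * ℓ + u % ℓ := by rw [hi, mul_comm, Nat.div_add_mod]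
  rw [hu, rawDist_eq_dist (padCoord_index c i (Nat.mod_lt _ hℓ))
    (y := ptVec k ℓ N g (q x)) (fun _ => rfl)]
  have := dist_triangle_right ((c i).pad (u % ℓ)) (ptVec k ℓ N g (q x)) ((g j).pad b)
  linarith

/-- The best solution of the search is an approximation. -/
theorem Searched.le_centerCost (hd : 1 ≤ d) (hm : 1 ≤ m) (hk : 1 ≤ k) (hℓ : 1 ≤ ℓ) (hN : 1 ≤ N)
    {ε : ℝ} (hε : 0 < ε) (hNε : 5 * √(d : ℝ) ≤ N * ε) {q : ℕ → ℕ} {M : ℕ → ℝ} {r x : ℝ}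
    (hT : Traversal (instData k ℓ N g) (k * ℓ) q M) (hS : Searched (instData k ℓ N g) q r x)
    (hx : ∀ i < 3, ∀ e, (instData k ℓ N g).IsDigits e →
      x ≤ (instData k ℓ N g).cost ((instData k ℓ N g).cand q e (r * (3 / 5) ^ i)))
    {c : Fin k → Curve d} (hc : IsFeasible ℓ c) : x ≤ (1 + ε) * centerCost g c := by
  have hD : (instData k ℓ N g).Valid := instData_valid hd hm hk hℓ hN
  have ho := centerCost_nonneg hm hk g c
  have hnear := fun u => hT.exists_rawDist_le (u := u) hm hk hℓ hc
  have hcost := fun (δ : ℝ) Y => cost_cand_le (N := N) (δ := δ) (Y := Y) hd hm hk hℓ hN hc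
    (le_refl (centerCost g c))
  generalize centerCost g c = o at *
  have hεo : 0 ≤ ε * o := mul_nonneg hε.le ho
  rcases le_or_gt r o with hr | hr
  · linarith [hS.le]
  -- Moving all relevant vertices into the traversal, by at most `3o` each, gives a candidate of the
  -- first pass with cost at most `o + 3o`.
  have hr4 : r ≤ 4 * o := by
    obtain ⟨e, he, h⟩ := hD.exists_cand_zero q (t := 3 * o) (z := padCoord ℓ c)
      (S := fun u => ∃ i : Fin k, (i : ℕ) = u / ℓ ∧ ∃ j, discreteFrechet (c i) (g j) ≤ o)
      (fun u _ hu => by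
        obtain ⟨i, hi, h⟩ := hnear u hu
        refine ⟨i, hi, le_trans (le_of_eq ?_) h⟩
        unfold rawDist
        congr 1
        exact Finset.sum_congr rfl fun _ _ => by ring)
    have := hcost (3 * o) _ (by linarith) h
    linarith [hS.first e he]
  -- Three sizes suffice, since `4 * (3/5)^3 = 108/125 < 1`.
  obtain ⟨i, hi, h1, h2⟩ : ∃ i < 3, 3 / 5 * (r * (3 / 5) ^ i) ≤ o ∧ o ≤ r * (3 / 5) ^ i := by
    by_cases h1 : r * (3 / 5) ≤ o
    · exact ⟨0, by norm_num, by simp; linarith, by simp; linarith⟩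
    by_cases h2 : r * (3 / 5) ^ 2 ≤ o
    · exact ⟨1, by norm_num, by linarith, by linarith⟩
    · exact ⟨2, by norm_num, by linarith, by linarith⟩
  set b := r * (3 / 5) ^ i
  have hb : 0 ≤ b := by linarith
  have hN' : (0 : ℝ) < N := by exact_mod_cast hN
  obtain ⟨e, he, h⟩ := hD.exists_cand q hb (z := padCoord ℓ c)
    (S := fun u => ∃ i : Fin k, (i : ℕ) = u / ℓ ∧ ∃ j, discreteFrechet (c i) (g j) ≤ o)
    (fun u _ hu => by
      obtain ⟨i, hi, h⟩ := hnear u hu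
      exact ⟨i, hi, h.trans (by linarith)⟩)
  have h3 : _ ≤ o + √(d : ℝ) * (3 * b / N) := hcost _ _ (by positivity) h
  -- By `h1`, `3b ≤ 5o`, so the rounding error is at most `5√d · o / N`; this is where the `5` in
  -- the grid size comes from.
  have h4 : √(d : ℝ) * (3 * b / N) ≤ ε * o := by
    rw [← mul_div_assoc, div_le_iff₀ hN']
    have h5 := mul_le_mul_of_nonneg_right hNε hb
    have h6 := mul_le_mul_of_nonneg_left h1 (by positivity : 0 ≤ N * ε)
    linarith
  have h5 : x ≤ o + √(d : ℝ) * (3 * b / N) := (hx i hi e he).trans h3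
  linarith

end

/-! ### The running time -/

theorem Data.weight_digits (D : Data) : D.weight D.digits = (D.kl * D.N ^ D.d) ^ D.kl := by
  have h1 : ∏ i ∈ Finset.range D.kl, D.base i = D.kl ^ D.kl := by
    rw [Finset.prod_congr rfl fun i hi =>
      show D.base i = D.kl from if_pos (Finset.mem_range.1 hi)]
    simp
  have h2 : ∏ i ∈ Finset.range (D.kl * D.d), D.base (D.kl + i) = D.N ^ (D.kl * D.d) := by
    rw [Finset.prod_congr rfl fun i _ =>
      show D.base (D.kl + i) = D.N from if_neg (by omega)]
    simp
  rw [Data.weight, Data.digits, Finset.prod_range_add, h1, h2, mul_pow, ← pow_mul,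
    mul_comm D.d]

/-- Every setup and traversal term is dominated by the enumeration, also the count up to `N`, as `N
≤ (kℓ · N^d)^(kℓ)`. The constants add up to `5 * 300 + 170 + 4300 = 5970`. -/
theorem Data.Valid.time_le {D : Data} (hD : D.Valid) {n : ℕ} (hn : ∀ j < D.m, D.len j ≤ n) :
    300 * (D.k + D.m + D.V + D.kl * D.d + D.N) + D.kl * (D.V * (D.d * 170)) +
      D.weight D.digits * (D.m * (D.k * (n * (D.ℓ * (D.d * 4300))))) ≤
    6000 * (D.d * D.weight D.digits * D.kl * (D.m * n)) := by
  have hd := hD.d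
  have hm := hD.m
  have hkl := hD.kl
  have hn1 : 1 ≤ n := (hD.len 0 hD.m).trans (hn 0 hD.m)
  have hV : D.V ≤ D.m * n := by
    refine (Finset.sum_le_sum fun j hj => hn j (Finset.mem_range.1 hj)).trans ?_
    simp
  have hk : D.k ≤ D.kl := Nat.le_mul_of_pos_right _ hD.ℓ
  have hNW : D.N ≤ D.weight D.digits := by
    rw [D.weight_digits]
    have h1 : D.N ≤ D.N ^ D.d := Nat.le_self_pow (by omega) _
    have h2 : D.N ^ D.d ≤ D.kl * D.N ^ D.d := Nat.le_mul_of_pos_left _ hkl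
    exact h1.trans (h2.trans (Nat.le_self_pow (by omega) _))
  have hW : 1 ≤ D.weight D.digits := hD.N.trans hNW
  have e : D.weight D.digits * (D.m * (D.k * (n * (D.ℓ * (D.d * 4300))))) =
      4300 * (D.d * D.weight D.digits * D.kl * (D.m * n)) := by
    unfold Data.kl; ring
  rw [e]
  generalize D.weight D.digits = W at *
  generalize D.kl = κ at *
  generalize hμ : D.m * n = μ at *
  have hμ1 : 1 ≤ μ := hμ ▸ Nat.mul_pos hm hn1
  have hmμ : D.m ≤ μ := hμ ▸ Nat.le_mul_of_pos_right _ hn1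
  have le_of : ∀ {a b c e : ℕ}, 1 ≤ a → 1 ≤ b → 1 ≤ c → 1 ≤ e →
      a ≤ a * b * c * e ∧ b ≤ a * b * c * e ∧ c ≤ a * b * c * e ∧ e ≤ a * b * c * e := by
    intro a b c e ha hb hc he
    have h1 : 1 ≤ a * b := Nat.mul_pos ha hb
    have h2 : 1 ≤ a * b * c := Nat.mul_pos h1 hc
    have h3 : a * b * c ≤ a * b * c * e := Nat.le_mul_of_pos_right _ he
    have h4 : a * b ≤ a * b * c := Nat.le_mul_of_pos_right _ hc
    exact ⟨(Nat.le_mul_of_pos_right _ hb).trans (h4.trans h3),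
      (Nat.le_mul_of_pos_left _ ha).trans (h4.trans h3),
      (Nat.le_mul_of_pos_left _ h1).trans h3, Nat.le_mul_of_pos_left _ h2⟩
  obtain ⟨-, b2, b3, b4⟩ := le_of hd hW hkl hμ1
  have b5 : κ * D.d ≤ D.d * W * κ * μ := by
    have : 1 ≤ W * μ := Nat.mul_pos hW hμ1
    calc κ * D.d ≤ κ * D.d * (W * μ) := Nat.le_mul_of_pos_right _ this
      _ = _ := by ring
  have b6 : κ * (D.V * (D.d * 170)) ≤ 170 * (D.d * W * κ * μ) := by
    calc κ * (D.V * (D.d * 170)) ≤ κ * (μ * (D.d * 170)) := by gcongr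
      _ ≤ κ * (μ * (D.d * 170)) * W := Nat.le_mul_of_pos_right _ hW
      _ = _ := by ring
  omega

/-- Bernoulli's inequality: `(7/6)^d ≥ 1 + d/6`. -/
theorem mul_pow_six_sevenths_le (d : ℕ) : (d : ℝ) * (6 / 7) ^ d ≤ 6 := by
  have h := one_add_mul_le_pow (show (-2 : ℝ) ≤ 1 / 6 by norm_num) d
  have h2 : (6 / 7 : ℝ) ^ d * (1 + 1 / 6) ^ d = 1 := by
    rw [← mul_pow]; norm_num
  have h3 : (0 : ℝ) < (6 / 7) ^ d := by positivity
  nlinarith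

/-- For `x ≥ 1`, `5x + 1 ≤ (6/7)(6x + 1)`. One of the `κ ≥ 1` resulting factors `(6/7)^d` suffices
to pay for `d`. -/
theorem mul_pow_gridSize_le {d κ N : ℕ} {x : ℝ} (hκ : 1 ≤ κ) (hx : 1 ≤ x)
    (hN : (N : ℝ) ≤ 5 * x + 1) :
    (d : ℝ) * ((κ : ℝ) * N ^ d) ^ κ ≤ 6 * ((6 * x + 1) ^ d * κ) ^ κ := by
  have h1 : (N : ℝ) ≤ 6 / 7 * (6 * x + 1) := by linarith
  have h2 : (N : ℝ) ^ d ≤ (6 / 7) ^ d * (6 * x + 1) ^ d := by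
    rw [← mul_pow]
    exact pow_le_pow_left₀ (Nat.cast_nonneg _) h1 d
  have h3 : ((6 / 7 : ℝ) ^ d) ^ κ ≤ (6 / 7) ^ d :=
    pow_le_of_le_one (by positivity) (pow_le_one₀ (by norm_num) (by norm_num)) (by omega)
  have hC : 0 ≤ ((6 * x + 1) ^ d * κ) ^ κ := by positivity
  calc (d : ℝ) * ((κ : ℝ) * N ^ d) ^ κ
      ≤ d * ((κ : ℝ) * ((6 / 7) ^ d * (6 * x + 1) ^ d)) ^ κ := by gcongr
    _ = d * (((6 / 7 : ℝ) ^ d) ^ κ * ((6 * x + 1) ^ d * κ) ^ κ) := by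
      rw [mul_comm (κ : ℝ), mul_assoc, mul_pow ((6 / 7 : ℝ) ^ d)]
    _ ≤ d * ((6 / 7 : ℝ) ^ d * ((6 * x + 1) ^ d * κ) ^ κ) := by gcongr
    _ = d * (6 / 7 : ℝ) ^ d * ((6 * x + 1) ^ d * κ) ^ κ := by ring
    _ ≤ 6 * ((6 * x + 1) ^ d * κ) ^ κ := by
      gcongr
      exact mul_pow_six_sevenths_le d

theorem initial_input {d m : ℕ} (k ℓ N : ℕ) (ε : ℝ) (g : Fin m → Curve d) :
    Initial (instData k ℓ N g) ε (input k ℓ ε g) :=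
  ⟨rfl, rfl, rfl, rfl, rfl, rfl, rfl, rfl, fun _ _ => rfl, rfl, fun _ _ _ _ => rfl⟩

end RealRAM

/-! ### The main theorem -/

theorem theorem3 :
    ∃ (P : RealRAM.Cmd) (K : ℝ),
      ∀ (d m n k ℓ : ℕ) (ε : ℝ) (g : Fin m → Curve d),
        1 ≤ d → 1 ≤ m → 1 ≤ k → 1 ≤ ℓ → 0 < ε → ε ≤ 1 →
        (∀ j, (g j).complexity ≤ n) →
        ∃ (t : ℕ) (s : RealRAM.State) (c : Fin k → Curve d),
          RealRAM.Exec P (RealRAM.input k ℓ ε g) t s ∧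
          RealRAM.Outputs s c ∧
          IsCenterApprox ℓ (1 + ε) g c ∧
          (t : ℝ) ≤ K * (((((6 * Real.sqrt d / ε + 1) ^ d * k * ℓ) ^ (k * ℓ)
            + Real.log ((ℓ : ℝ) + n)) * (k * ℓ) * (m * n))) := by
  -- The constant is `6000 * 6`, from `time_le` and `mul_pow_gridSize_le`.
  refine ⟨RealRAM.centerCmd, 36000, ?_⟩
  intro d m n k ℓ ε g hd hm hk hℓ hε hε1 hn
  have hsd : 1 ≤ √(d : ℝ) := Real.one_le_sqrt.2 (by exact_mod_cast hd)
  set x : ℝ := √(d : ℝ) / ε with hx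
  -- This is where `ε ≤ 1 ≤ √d` enters.
  have hx1 : 1 ≤ x := by rw [hx, le_div_iff₀ hε]; linarith
  set N : ℕ := ⌈5 * x⌉₊ with hN
  have hN1 : 1 ≤ N := Nat.one_le_iff_ne_zero.2 (Nat.ceil_pos.2 (by linarith)).ne'
  have hNle : (N : ℝ) ≤ 5 * x + 1 := (Nat.ceil_lt_add_one (by linarith)).le
  have hxε : x * ε = √(d : ℝ) := div_mul_cancel₀ _ hε.ne'
  have hNiff : ∀ i : ℕ, (i : ℝ) * ε < 5 * √(d : ℝ) ↔ i < N := by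
    intro i
    rw [hN, Nat.lt_ceil, ← hxε, ← mul_assoc]
    exact mul_lt_mul_iff_left₀ hε
  have hD := RealRAM.instData_valid (g := g) hd hm hk hℓ hN1
  have hlen : ∀ j < (RealRAM.instData k ℓ N g).m, (RealRAM.instData k ℓ N g).len j ≤ n :=
    fun j hj => (RealRAM.instData_len (⟨j, hj⟩ : Fin m)).trans_le (hn _)
  obtain ⟨t, s, he, ht, ⟨Y, hY⟩, hC, q, M, r, hT, hS, hopt⟩ := RealRAM.centerCmd_runs hD hlen
    (RealRAM.initial_input k ℓ N ε g) hNiff rfl rfl rfl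
  refine ⟨t, s, fun i => RealRAM.curveOf d hℓ fun a => Y (i * ℓ + a), he,
    RealRAM.outputs_curveOf hd hℓ hC.out hY.coord, ⟨fun _ => le_rfl, fun c' hc' => ?_⟩, ?_⟩
  · rw [RealRAM.centerCost_curveOf hd hm hk hℓ hN1, ← hY.cost]
    exact hS.le_centerCost hd hm hk hℓ hN1 hε (not_lt.1 fun h => (hNiff N).1 h |>.false) hT
      hopt hc'
  · have hn1 : 1 ≤ n := (g ⟨0, hm⟩).complexity_pos.trans_le (hn _)
    -- The search involves no logarithmic factor, so the logarithm only has to be nonnegative.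
    have hlog : 0 ≤ Real.log ((ℓ : ℝ) + n) := by
      refine Real.log_nonneg ?_
      have : (1 : ℝ) ≤ ℓ := by exact_mod_cast hℓ
      have : (0 : ℝ) ≤ n := Nat.cast_nonneg n
      linarith
    have h1 := ht.trans (hD.time_le hlen)
    rw [RealRAM.Data.weight_digits] at h1
    change t ≤ 6000 * (d * (k * ℓ * N ^ d) ^ (k * ℓ) * (k * ℓ) * (m * n)) at h1
    have h2 : (t : ℝ) ≤ 6000 * (d * ((k * ℓ : ℕ) * (N : ℝ) ^ d) ^ (k * ℓ) * (k * ℓ) * (m * n)) := by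
      exact_mod_cast h1
    have h3 := RealRAM.mul_pow_gridSize_le (d := d) (κ := k * ℓ) (Nat.mul_pos hk hℓ) hx1 hNle
    have h4 : ((6 * √(d : ℝ) / ε + 1) ^ d * k * ℓ) = (6 * x + 1) ^ d * ((k * ℓ : ℕ) : ℝ) := by
      rw [hx]; push_cast; ring
    rw [h4]
    refine h2.trans ?_
    calc (6000 : ℝ) * (d * ((k * ℓ : ℕ) * (N : ℝ) ^ d) ^ (k * ℓ) * (k * ℓ) * (m * n))
        ≤ 6000 * ((6 * ((6 * x + 1) ^ d * ((k * ℓ : ℕ) : ℝ)) ^ (k * ℓ)) * (k * ℓ) * (m * n)) := by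
          gcongr
      _ = 36000 * (((6 * x + 1) ^ d * ((k * ℓ : ℕ) : ℝ)) ^ (k * ℓ) * (k * ℓ) * (m * n)) := by ring
      _ ≤ _ := by
          gcongr
          linarith
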